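/- Let $M$ be a compact $n$-dimensional smooth manifold with (possibly empty) boundary, $n\ge 1$. Let $g(t)$, $|t|<\varepsilon$, be Riemannian metrics on $M$ of class $C^k$ ($1\le k\le\infty$), differentiable at $t=0$ uniformly on $M$ (that is, as a curve in the space of continuous symmetric $(0,2)$-tensors with the supremum norm), and put $g=g(0)$, $H=g'(0)$. Write $dM_t$ for the Riemannian measure of $g(t)$, $dM=dM_0$, and $\nu_t$ for the exterior $g(t)$-unit normal along $\partial M$. For a metric $g$ let $\Delta_g f=\operatorname{tr}_g\nabla^2 f$ be the Laplacian (trace of the Hessian), $\Delta=\Delta_{g(0)}$, and for $(0,2)$-tensors let $\langle T,S\rangle=g^{ik}g^{jl}T_{ij}S_{kl}$. Let $\{\phi_i(t)\}_{i}$, $|t|<\varepsilon$, be functions on $M$ of class $C^r$ ($2\le r\le\infty$; in particular $C^\infty$) such that each $t\mapsto\phi_i(t)$ is differentiable at $t=0$ uniformly on $M$, and let $\lambda(t)$ be a real function which is differentiable at $t=0$. Assume that for all $|t|<\varepsilon$ and all $i,j$ $$\int_M\phi_i(t)\phi_j(t)\,dM_t=\delta_{ij},\qquad -\Delta_{g(t)}\phi_i(t)=\lambda(t)\phi_i(t)\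 \text{ in } M,\qquad \frac{\partial}{\partial\nu_t}\phi_i(t)=0\ \text{ on }\partial M .$$ Then for all $i,j$, with $\phi_i=\phi_i(0)$, the following integrand is integrable and $$\lambda'(0)\,\delta_{ij}=\int_M\Big\langle \tfrac14\,\Delta(\phi_i\phi_j)\,g-d\phi_i\otimes d\phi_j,\;H\Big\rangle\,dM .$$ -/

import Mathlib

open Set Filter Topology MeasureTheory Bundle
open scoped Manifold ContDiff ENNReal

noncomputable section

namespace NeumannVariation

variable {n : ℕ} [NeZero n] {M : Type*} [TopologicalSpace M]
  [ChartedSpace (EuclideanHalfSpace n) M]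

/-- Covariant 2-tensors on the tangent space at `p`. -/
abbrev CovTwoTensor (p : M) : Type _ :=
  TangentSpace (𝓡∂ n) p →L[ℝ] TangentSpace (𝓡∂ n) p →L[ℝ] ℝ

variable [IsManifold (𝓡∂ n) ∞ M]

variable (n M) in
/-- Riemannian metrics of class `C^k` (up to the boundary) on the `n`-manifold with boundary `M`. -/
abbrev Metric (k : ℕ∞) : Type _ :=
  ContMDiffRiemannianMetric (𝓡∂ n) (k : WithTop ℕ∞) (EuclideanSpace ℝ (Fin n))
    (fun p : M ↦ TangentSpace (𝓡∂ n) p)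

variable {k : ℕ∞}

/-- The coordinate vector `∂ᵢ` at `q` of the chart centred at `x` (for `q` in its domain).
The model half-space is `{y | 0 ≤ y 0}`, so at boundary points `∂₀` points inwards and the
other `∂ᵢ` span the tangent space of the boundary. -/
def coordVec (x q : M) (i : Fin n) : TangentSpace (𝓡∂ n) q :=
  (trivializationAt (EuclideanSpace ℝ (Fin n)) (TangentSpace (𝓡∂ n) : M → Type) x).symmL ℝ q
    (EuclideanSpace.single i (1 : ℝ))

/-- The matrix `g_{ij} = g(∂ᵢ, ∂ⱼ)` in the chart centred at `x`, as a function of the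
coordinates `y`. -/
def gram (g : Metric n M k) (x : M) (y : EuclideanSpace ℝ (Fin n)) : Matrix (Fin n) (Fin n) ℝ :=
  Matrix.of fun i j ↦
    g.inner ((extChartAt (𝓡∂ n) x).symm y)
      (coordVec x ((extChartAt (𝓡∂ n) x).symm y) i) (coordVec x ((extChartAt (𝓡∂ n) x).symm y) j)

/-- The matrix `g_{ij}` at the point `p`, in the chart centred at `p`. -/
def gramAt (g : Metric n M k) (p : M) : Matrix (Fin n) (Fin n) ℝ :=
  Matrix.of fun i j ↦ g.inner p (coordVec p p i) (coordVec p p j)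

/-- The inner product `⟨T, S⟩ = g^{ik} g^{jl} T_{ij} S_{kl}` of covariant 2-tensors. -/
def tensorInner (g : Metric n M k) (p : M) (T S : CovTwoTensor (n := n) p) : ℝ :=
  ∑ i, ∑ j, ∑ a, ∑ b, (gramAt g p)⁻¹ i a * (gramAt g p)⁻¹ j b *
    T (coordVec p p i) (coordVec p p j) * S (coordVec p p a) (coordVec p p b)

/-- The partial derivative `∂ᵢ f` of a function on the model half-space (one-sided at the boundary
in the direction `0`). -/
def partialD (i : Fin n) (f : EuclideanSpace ℝ (Fin n) → ℝ) (y : EuclideanSpace ℝ (Fin n)) : ℝ :=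
  fderivWithin ℝ f (range (𝓡∂ n)) y (EuclideanSpace.single i (1 : ℝ))

/-- The Christoffel symbol `Γ^c_{ij}` of `g` in the chart centred at `x`. -/
def christoffel (g : Metric n M k) (x : M) (c i j : Fin n) (y : EuclideanSpace ℝ (Fin n)) : ℝ :=
  (1 / 2) * ∑ l, (gram g x y)⁻¹ c l *
    (partialD i (fun z ↦ gram g x z j l) y + partialD j (fun z ↦ gram g x z i l) y
      - partialD l (fun z ↦ gram g x z i j) y)

/-- The components `(∇²f)_{ij} = ∂ᵢ∂ⱼ f - Γ^c_{ij} ∂_c f` of the Hessian `∇²f = ∇df`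
in the chart centred at `x`. -/
def hessian (g : Metric n M k) (f : M → ℝ) (x : M) (i j : Fin n)
    (y : EuclideanSpace ℝ (Fin n)) : ℝ :=
  partialD i (partialD j (f ∘ (extChartAt (𝓡∂ n) x).symm)) y
    - ∑ c, christoffel g x c i j y * partialD c (f ∘ (extChartAt (𝓡∂ n) x).symm) y

/-- The Laplacian `Δ_g f = ⟨∇²f, g⟩ = g^{ij} (∇²f)_{ij}` at `p`, computed in the chart
centred at `p`. -/
def laplacian (g : Metric n M k) (f : M → ℝ) (p : M) : ℝ :=
  ∑ i, ∑ j, (gram g p (extChartAt (𝓡∂ n) p p))⁻¹ i j *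
    hessian g f p i j (extChartAt (𝓡∂ n) p p)

/-- The differential `df` at `p`. -/
def differential (f : M → ℝ) (p : M) : TangentSpace (𝓡∂ n) p →L[ℝ] ℝ :=
  mfderiv (𝓡∂ n) 𝓘(ℝ, ℝ) f p

/-- The tensor `df ⊗ dl` at `p`: it sends `(v, w)` to `df(v) dl(w)`. -/
def diffTensor (f l : M → ℝ) (p : M) : CovTwoTensor (n := n) p :=
  (differential f p).smulRight (differential l p)

/-- The exterior unit normal `ν = - (g^{00})^{-1/2} g^{0i} ∂ᵢ` at a boundary point `p`. -/
def outwardNormal (g : Metric n M k) (p : M) : TangentSpace (𝓡∂ n) p :=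
  (-(Real.sqrt ((gramAt g p)⁻¹ 0 0))⁻¹) • ∑ i, (gramAt g p)⁻¹ 0 i • coordVec p p i

/-- The normal derivative `∂f/∂ν = df(ν)` at a boundary point `p`. -/
def normalDeriv (g : Metric n M k) (f : M → ℝ) (p : M) : ℝ :=
  differential f p (outwardNormal g p)

/-- The Riemannian measure of `g` on the domain of the chart centred at `x`: it has density
`√det(g_{ij})` with respect to Lebesgue measure in the coordinates. -/
def chartVolume [MeasurableSpace M] (g : Metric n M k) (x : M) : Measure M :=
  ((volume.restrict (extChartAt (𝓡∂ n) x).target).withDensity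
    (fun y ↦ ENNReal.ofReal (Real.sqrt (gram g x y).det))).map (extChartAt (𝓡∂ n) x).symm

/-- The Riemannian measure `dM` of `g`. The measures `chartVolume g x` agree on overlaps of chart
domains, so their least upper bound is the measure which restricts to each of them. -/
def riemannianVolume [MeasurableSpace M] (g : Metric n M k) : Measure M :=
  ⨆ x : M, chartVolume g x

/-- `H` is the derivative at time `t` of the family of metrics `g`, in the space of
continuous 2-tensors with the supremum norm: `g(s) = g(t) + (s - t) H + o(s - t)` uniformly on
`M`, where tensors are measured with the metric `g(t)`. -/
def HasMetricDerivAt (g : ℝ → Metric n M k) (H : ∀ p : M, CovTwoTensor (n := n) p) (t : ℝ) : Prop :=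
  ∀ c : ℝ, 0 < c → ∀ᶠ s in 𝓝 t, ∀ (p : M) (v w : TangentSpace (𝓡∂ n) p),
    |(g s).inner p v w - (g t).inner p v w - (s - t) * H p v w| ≤
      c * |s - t| * (Real.sqrt ((g t).inner p v v) * Real.sqrt ((g t).inner p w w))

end NeumannVariation

end

/-!
The eigenvalue equation is used in its weak form only. Green's formula and the Neumann condition
give, for every function `w` of class `C¹`,
`∫ ⟨dφᵢ(t), dw⟩_t dM_t = λ(t) ∫ φᵢ(t) w dM_t`.
Subtract from this, for `w = φⱼ(0)`, the same identity with the metric `g(0)` and `λ(0)` in place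
of `g(t)` and `λ(t)`; the latter holds because `φⱼ(0)` is an eigenfunction of `g(0)`, tested against
`φᵢ(t)`. The time dependence of `φᵢ` then enters the difference only through the argument `φᵢ(t)`.
Dividing by `t`, only the variation of the cometric and of the measure is differentiated:
`λ'(0) δᵢⱼ = ∫ (½ tr H (⟨dφᵢ, dφⱼ⟩ - λ φᵢ φⱼ) - ⟨dφᵢ ⊗ dφⱼ, H⟩) dM`,
and this is the assertion, since `Δ(φᵢφⱼ) = 2⟨dφᵢ, dφⱼ⟩ - 2λφᵢφⱼ` (`laplacian_mul`).

The functions `φᵢ(t)` are only assumed to converge uniformly, while the limit involves their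
differentials. These converge in `L²`: the energies of `φᵢ(t)` for the metric `g(t)` are `λ(t)`,
hence the energies for `g(0)` tend to `λ(0)` (`HasMetricDerivAt.tendsto_energy`), and so
`E(φᵢ(t) - φᵢ(0)) = E(φᵢ(t)) - 2 λ(0) ∫ φᵢ(t) φᵢ(0) + λ(0)` tends to `0` (`tendsto_energy_sub`).
With the expansion of the Dirichlet integrand, which is uniform on `M`
(`HasMetricDerivAt.eventually_expansion`), this gives the limit of the difference quotients
(`HasMetricDerivAt.tendsto_dirichlet_quotient`). The expressions in `H` that
occur are continuous, being uniform limits of difference quotients.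

Green's formula (`integral_gradInner`) is reduced by a partition of unity to test functions
supported in a chart. There it is the divergence theorem on the half-space, applied to
`√(det G) w G⁻¹∇f`, whose normal component vanishes by the Neumann condition. The Laplacian at `p`
is defined in the chart centred at `p`, so this uses its invariance under changes of coordinates
(`coordLaplacian_comp`), proved at interior points, which is enough for integrals. Likewise the
measures of the charts agree on overlaps, by the change of variables formula
(`restrict_riemannianVolume`).
-/

namespace NeumannVariation

/-! ### Differentiating matrix-valued functions -/

section MatrixCalculus

variable {ι : Type*} {F : Type*} [NormedAddCommGroup F]
  [NormedSpace ℝ F]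

/-- The derivative of the matrix-valued function `A` at `y` in the direction `v`, taken entry by
entry, so that no norm on matrices has to be chosen. -/
noncomputable def matrixDeriv (A : F → Matrix ι ι ℝ) (y v : F) : Matrix ι ι ℝ :=
  Matrix.of fun a b ↦ fderiv ℝ (fun z ↦ A z a b) y v

theorem matrixDeriv_apply (A : F → Matrix ι ι ℝ) (y v : F) (a b : ι) :
    matrixDeriv A y v a b = fderiv ℝ (fun z ↦ A z a b) y v := rfl

variable [Fintype ι]

theorem differentiableAt_mul_entry {A B : F → Matrix ι ι ℝ} {y : F}
    (hA : ∀ a b, DifferentiableAt ℝ (fun z ↦ A z a b) y)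
    (hB : ∀ a b, DifferentiableAt ℝ (fun z ↦ B z a b) y) (a b : ι) :
    DifferentiableAt ℝ (fun z ↦ (A z * B z) a b) y := by
  simp only [Matrix.mul_apply]
  fun_prop

theorem matrixDeriv_mul {A B : F → Matrix ι ι ℝ} {y : F}
    (hA : ∀ a b, DifferentiableAt ℝ (fun z ↦ A z a b) y)
    (hB : ∀ a b, DifferentiableAt ℝ (fun z ↦ B z a b) y) (v : F) :
    matrixDeriv (fun z ↦ A z * B z) y v =
      matrixDeriv A y v * B y + A y * matrixDeriv B y v := by
  ext a b
  simp only [matrixDeriv_apply, Matrix.mul_apply, Matrix.add_apply]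
  rw [fderiv_fun_sum (fun c _ ↦ (hA a c).fun_mul (hB c b))]
  simp only [FunLike.coe_sum, Finset.sum_apply]
  rw [← Finset.sum_add_distrib]
  refine Finset.sum_congr rfl fun c _ ↦ ?_
  rw [fderiv_fun_mul (hA a c) (hB c b)]
  simp
  ring

variable [DecidableEq ι]

theorem differentiableAt_det {A : F → Matrix ι ι ℝ} {y : F}
    (hA : ∀ a b, DifferentiableAt ℝ (fun z ↦ A z a b) y) :
    DifferentiableAt ℝ (fun z ↦ (A z).det) y := by
  simp only [Matrix.det_apply']
  fun_prop

theorem differentiableAt_inv_entry {A : F → Matrix ι ι ℝ} {y : F}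
    (hA : ∀ a b, DifferentiableAt ℝ (fun z ↦ A z a b) y) (hy : (A y).det ≠ 0) (a b : ι) :
    DifferentiableAt ℝ (fun z ↦ (A z)⁻¹ a b) y := by
  simp only [Matrix.inv_def, Matrix.smul_apply, Ring.inverse_eq_inv', smul_eq_mul,
    Matrix.adjugate_apply]
  refine ((differentiableAt_det hA).fun_inv hy).fun_mul (differentiableAt_det fun c d ↦ ?_)
  by_cases hc : c = b
  · subst hc
    simp
  · simpa [Matrix.updateRow_ne hc] using hA c d

/-- Jacobi's formula at a point where the matrix is the identity: of the terms of the Leibniz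
expansion only the one of the identity permutation contributes to the derivative. -/
theorem fderiv_det_of_eq_one {A : F → Matrix ι ι ℝ} {y : F}
    (hA : ∀ a b, DifferentiableAt ℝ (fun z ↦ A z a b) y) (hy : A y = 1) (v : F) :
    fderiv ℝ (fun z ↦ (A z).det) y v = (matrixDeriv A y v).trace := by
  have hprod : ∀ σ : Equiv.Perm ι, HasFDerivAt (fun z ↦ ∏ i, A z (σ i) i)
      (∑ i, (∏ j ∈ Finset.univ.erase i, A y (σ j) j) • fderiv ℝ (fun z ↦ A z (σ i) i) y) y :=
    fun σ ↦ HasFDerivAt.finsetProd (g := fun i z ↦ A z (σ i) i)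
      fun i _ ↦ (hA (σ i) i).hasFDerivAt
  simp only [Matrix.det_apply']
  rw [(HasFDerivAt.fun_sum fun σ (_ : σ ∈ Finset.univ) ↦
    (hprod σ).const_mul ((Equiv.Perm.sign σ : ℤ) : ℝ)).fderiv]
  simp only [FunLike.coe_sum, Finset.sum_apply, FunLike.coe_smul,
    Pi.smul_apply, smul_eq_mul]
  rw [Finset.sum_eq_single 1]
  · simp only [hy, Equiv.Perm.sign_one, Equiv.Perm.coe_one, id_eq, Matrix.one_apply_eq,
      Finset.prod_const_one, Matrix.trace, Matrix.diag, matrixDeriv_apply]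
    simp
  · intro σ _ hσ
    refine mul_eq_zero_of_right _ (Finset.sum_eq_zero fun i _ ↦ ?_)
    -- a permutation other than the identity moves at least two points
    obtain ⟨j, hji, hj⟩ : ∃ j, j ≠ i ∧ σ j ≠ j := by
      by_contra! h
      refine hσ (Equiv.ext fun k ↦ ?_)
      by_cases hk : k = i
      · subst hk
        by_contra hk'
        have := h (σ k) hk'
        exact hk' (σ.injective this)
      · exact h k hk
    have : ∏ j ∈ Finset.univ.erase i, A y (σ j) j = 0 :=
      Finset.prod_eq_zero (Finset.mem_erase.2 ⟨hji, Finset.mem_univ j⟩)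
        (by rw [hy, Matrix.one_apply_ne hj])
    simp [this]
  · simp

/-- **Jacobi's formula** for the derivative of a determinant. -/
theorem fderiv_det {A : F → Matrix ι ι ℝ} {y : F}
    (hA : ∀ a b, DifferentiableAt ℝ (fun z ↦ A z a b) y) (hy : (A y).det ≠ 0) (v : F) :
    fderiv ℝ (fun z ↦ (A z).det) y v = (A y).det * ((A y)⁻¹ * matrixDeriv A y v).trace := by
  have hu : IsUnit (A y).det := isUnit_iff_ne_zero.2 hy
  have hconst : ∀ a b, DifferentiableAt ℝ (fun _ : F ↦ (A y)⁻¹ a b) y := fun a b ↦ by fun_prop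
  have h1 := fderiv_det_of_eq_one (A := fun z ↦ (A y)⁻¹ * A z)
    (differentiableAt_mul_entry hconst hA) (Matrix.nonsing_inv_mul _ hu) v
  rw [matrixDeriv_mul (A := fun _ ↦ (A y)⁻¹) hconst hA] at h1
  have h0 : matrixDeriv (fun _ : F ↦ (A y)⁻¹) y v = 0 := by
    ext a b
    simp [matrixDeriv_apply]
  rw [h0, zero_mul, zero_add] at h1
  rw [← h1]
  have : (fun z ↦ (A z).det) = fun z ↦ (A y).det * ((A y)⁻¹ * A z).det := by
    ext z
    rw [Matrix.det_mul, ← mul_assoc, ← Matrix.det_mul, Matrix.mul_nonsing_inv _ hu,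
      Matrix.det_one, one_mul]
  rw [this, fderiv_const_mul (differentiableAt_det (differentiableAt_mul_entry hconst hA))]
  simp

theorem eventually_det_ne_zero {A : F → Matrix ι ι ℝ} {y : F}
    (hA : ∀ a b, DifferentiableAt ℝ (fun z ↦ A z a b) y) (hy : (A y).det ≠ 0) :
    ∀ᶠ z in 𝓝 y, (A z).det ≠ 0 :=
  (differentiableAt_det hA).continuousAt.eventually_ne hy

theorem matrixDeriv_inv {A : F → Matrix ι ι ℝ} {y : F}
    (hA : ∀ a b, DifferentiableAt ℝ (fun z ↦ A z a b) y) (hy : (A y).det ≠ 0) (v : F) :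
    matrixDeriv (fun z ↦ (A z)⁻¹) y v = -((A y)⁻¹ * matrixDeriv A y v * (A y)⁻¹) := by
  have hu : IsUnit (A y).det := isUnit_iff_ne_zero.2 hy
  have h1 := matrixDeriv_mul hA (differentiableAt_inv_entry hA hy) v
  have h0 : matrixDeriv (fun z ↦ A z * (A z)⁻¹) y v = 0 := by
    ext a b
    rw [matrixDeriv_apply, Filter.EventuallyEq.fderiv_eq (f := fun _ ↦ (1 : Matrix ι ι ℝ) a b)]
    · simp
    · filter_upwards [eventually_det_ne_zero hA hy] with z hz
      rw [Matrix.mul_nonsing_inv _ (isUnit_iff_ne_zero.2 hz)]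
  rw [h0] at h1
  have h2 : A y * matrixDeriv (fun z ↦ (A z)⁻¹) y v = -(matrixDeriv A y v * (A y)⁻¹) := by
    rw [eq_neg_iff_add_eq_zero, add_comm, ← h1]
  calc matrixDeriv (fun z ↦ (A z)⁻¹) y v
      = (A y)⁻¹ * (A y * matrixDeriv (fun z ↦ (A z)⁻¹) y v) := by
        rw [← mul_assoc, Matrix.nonsing_inv_mul _ hu, one_mul]
    _ = _ := by rw [h2, mul_neg, mul_assoc]

/-- The derivative of the volume density `√(det A)`. -/
theorem differentiableAt_sqrt_det {A : F → Matrix ι ι ℝ} {y : F}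
    (hA : ∀ a b, DifferentiableAt ℝ (fun z ↦ A z a b) y) (hy : 0 < (A y).det) :
    DifferentiableAt ℝ (fun z ↦ √(A z).det) y ∧
      ∀ v, fderiv ℝ (fun z ↦ √(A z).det) y v =
        √(A y).det * (1 / 2 * ((A y)⁻¹ * matrixDeriv A y v).trace) := by
  have h := (differentiableAt_det hA).hasFDerivAt.sqrt hy.ne'
  refine ⟨h.differentiableAt, fun v ↦ ?_⟩
  rw [h.fderiv]
  simp only [FunLike.coe_smul, Pi.smul_apply, smul_eq_mul]
  rw [fderiv_det hA hy.ne']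
  have hs : √(A y).det ≠ 0 := (Real.sqrt_pos.2 hy).ne'
  have h2 : (A y).det = √(A y).det * √(A y).det := (Real.mul_self_sqrt hy.le).symm
  field_simp
  rw [sq, ← h2]

end MatrixCalculus

/-! ### The Laplacian in coordinates -/

section LaplacianSymbol

variable {ι : Type*} [Fintype ι]

theorem sum_sum_comm_sum_sum (f : ι → ι → ι → ι → ℝ) :
    ∑ i, ∑ j, ∑ a, ∑ b, f i j a b = ∑ b, ∑ a, ∑ i, ∑ j, f i j a b := by
  calc ∑ i, ∑ j, ∑ a, ∑ b, f i j a b = ∑ i, ∑ a, ∑ j, ∑ b, f i j a b :=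
        Finset.sum_congr rfl fun _ _ ↦ Finset.sum_comm
    _ = ∑ a, ∑ i, ∑ j, ∑ b, f i j a b := Finset.sum_comm
    _ = ∑ a, ∑ i, ∑ b, ∑ j, f i j a b :=
        Finset.sum_congr rfl fun _ _ ↦ Finset.sum_congr rfl fun _ _ ↦ Finset.sum_comm
    _ = ∑ a, ∑ b, ∑ i, ∑ j, f i j a b := Finset.sum_congr rfl fun _ _ ↦ Finset.sum_comm
    _ = _ := Finset.sum_comm

variable [DecidableEq ι]

/-- The expression `G^{ij} h_{ij} - γ_l G^{lm} p_m` with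
`γ_l = G^{ij} (D_i)_{jl} - ½ G^{ij} (D_l)_{ij}`. For `D_i = ∂ᵢG`, `h = (∂ᵢ∂ⱼu)` and `p = (∂ᵢu)`
this is the Laplacian of `u` with respect to the metric `G`. -/
noncomputable def laplacianSymbol (G : Matrix ι ι ℝ) (D : ι → Matrix ι ι ℝ) (h : Matrix ι ι ℝ)
    (p : ι → ℝ) : ℝ :=
  ∑ i, ∑ j, G⁻¹ i j * h i j
    - (∑ i, ((G⁻¹ * D i).mulVec (G⁻¹.mulVec p)) i
      - 1 / 2 * ∑ l, (G⁻¹ * D l).trace * (G⁻¹.mulVec p) l)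

/-- The trace of the Hessian, written with Christoffel symbols, is `laplacianSymbol`. -/
theorem laplacianSymbol_eq_sum_christoffel {G : Matrix ι ι ℝ} {D : ι → Matrix ι ι ℝ}
    (h : Matrix ι ι ℝ) (p : ι → ℝ) (hG : G.transpose = G)
    (hD : ∀ i, (D i).transpose = D i) :
    ∑ i, ∑ j, G⁻¹ i j * (h i j - ∑ c, (1 / 2 * ∑ l, G⁻¹ c l *
      (D i j l + D j i l - D l i j)) * p c) = laplacianSymbol G D h p := by
  have mv : ∀ (A : Matrix ι ι ℝ) (v : ι → ℝ) i, A.mulVec v i = ∑ j, A i j * v j :=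
    fun _ _ _ ↦ rfl
  have hs : ∀ i j, G⁻¹ i j = G⁻¹ j i := fun i j ↦ by
    have : G⁻¹.transpose = G⁻¹ := by rw [Matrix.transpose_nonsing_inv, hG]
    exact congrFun (congrFun this.symm i) j
  have hDs : ∀ k i j, D k i j = D k j i := fun k i j ↦ congrFun (congrFun (hD k).symm i) j
  set q := G⁻¹.mulVec p with hq
  have hqc : ∀ l, ∑ c, G⁻¹ c l * p c = q l := fun l ↦ by
    simp only [hq, mv]
    exact Finset.sum_congr rfl fun c _ ↦ by rw [hs]
  have h1 : ∀ i j, ∑ c, (1 / 2 * ∑ l, G⁻¹ c l * (D i j l + D j i l - D l i j)) * p c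
      = 1 / 2 * ∑ l, (D i j l + D j i l - D l i j) * q l := fun i j ↦ by
    simp_rw [← hqc, Finset.mul_sum, Finset.sum_mul]
    rw [Finset.sum_comm]
    refine Finset.sum_congr rfl fun l _ ↦ Finset.sum_congr rfl fun c _ ↦ by ring
  simp_rw [h1]
  have h2 : ∑ i, ((G⁻¹ * D i).mulVec q) i = ∑ i, ∑ j, ∑ l, G⁻¹ i j * D i j l * q l := by
    refine Finset.sum_congr rfl fun i _ ↦ ?_
    rw [← Matrix.mulVec_mulVec]
    simp only [mv, Finset.mul_sum, mul_assoc]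
  have h2' : ∑ i, ((G⁻¹ * D i).mulVec q) i = ∑ i, ∑ j, ∑ l, G⁻¹ i j * D j i l * q l := by
    rw [h2, Finset.sum_comm]
    exact Finset.sum_congr rfl fun i _ ↦ Finset.sum_congr rfl fun j _ ↦
      Finset.sum_congr rfl fun l _ ↦ by rw [hs]
  have h3 : ∑ l, (G⁻¹ * D l).trace * q l = ∑ i, ∑ j, ∑ l, G⁻¹ i j * D l i j * q l := by
    simp only [Matrix.trace, Matrix.diag, Matrix.mul_apply, Finset.sum_mul]
    rw [Finset.sum_comm]
    refine Finset.sum_congr rfl fun i _ ↦ ?_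
    rw [Finset.sum_comm]
    exact Finset.sum_congr rfl fun j _ ↦ Finset.sum_congr rfl fun l _ ↦ by rw [hDs l j i]
  rw [laplacianSymbol, h3]
  have h4 : ∑ i, ((G⁻¹ * D i).mulVec q) i = 1 / 2 * (∑ i, ∑ j, ∑ l, G⁻¹ i j * D i j l * q l)
      + 1 / 2 * ∑ i, ∑ j, ∑ l, G⁻¹ i j * D j i l * q l := by
    rw [← h2, ← h2']; ring
  rw [h4]
  simp only [Finset.mul_sum, ← Finset.sum_add_distrib, ← Finset.sum_sub_distrib]
  refine Finset.sum_congr rfl fun i _ ↦ Finset.sum_congr rfl fun j _ ↦ ?_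
  rw [mul_sub, Finset.mul_sum]
  congr 1
  exact Finset.sum_congr rfl fun l _ ↦ by ring

/-- The Laplacian does not depend on the coordinates: `J` is the Jacobian matrix of a change of
coordinates, `K i` the derivative of `J` in the direction `i`. The terms with `K` in the transformed
Hessian are compensated by those in the derivatives of the transformed metric; this needs the
symmetry `hK` of second derivatives. -/
theorem laplacianSymbol_change {J g : Matrix ι ι ℝ} {D : ι → Matrix ι ι ℝ}
    {K : ι → Matrix ι ι ℝ} (h : Matrix ι ι ℝ) (p : ι → ℝ) (hJ : J.det ≠ 0) (hg : g.det ≠ 0)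
    (hgs : g.transpose = g) (hK : ∀ i a l, K i a l = K l a i) :
    laplacianSymbol (J.transpose * g * J)
      (fun i ↦ (K i).transpose * g * J + J.transpose * (∑ c, J c i • D c) * J
        + J.transpose * g * K i)
      (Matrix.of fun i j ↦ ∑ a, K i a j * p a + ∑ a, ∑ b, J a j * J b i * h b a)
      (J.transpose.mulVec p) = laplacianSymbol g D h p := by
  have mv : ∀ (A : Matrix ι ι ℝ) (v : ι → ℝ) i, A.mulVec v i = ∑ j, A i j * v j :=
    fun _ _ _ ↦ rfl
  have uJ : IsUnit J.det := isUnit_iff_ne_zero.2 hJ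
  have ug : IsUnit g.det := isUnit_iff_ne_zero.2 hg
  have uJt : IsUnit J.transpose.det := by rwa [Matrix.det_transpose]
  set L := J⁻¹ with hL
  have hLJ : L * J = 1 := Matrix.nonsing_inv_mul _ uJ
  have hJL : J * L = 1 := Matrix.mul_nonsing_inv _ uJ
  have hinv : (J.transpose * g * J)⁻¹ = L * g⁻¹ * L.transpose := by
    rw [Matrix.mul_inv_rev, Matrix.mul_inv_rev, Matrix.transpose_nonsing_inv, mul_assoc]
  have hLtJt : L.transpose * J.transpose = 1 := by
    rw [← Matrix.transpose_mul, hJL, Matrix.transpose_one]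
  set G := J.transpose * g * J with hGdef
  set q := g⁻¹.mulVec p with hq
  have hgq : g.mulVec q = p := by
    rw [hq, Matrix.mulVec_mulVec, Matrix.mul_nonsing_inv _ ug, Matrix.one_mulVec]
  have hGp : G⁻¹.mulVec (J.transpose.mulVec p) = L.mulVec q := by
    rw [hinv, Matrix.mulVec_mulVec, mul_assoc, hLtJt, mul_one, hq, Matrix.mulVec_mulVec]
  have hJq : J.mulVec (L.mulVec q) = q := by
    rw [Matrix.mulVec_mulVec, hJL, Matrix.one_mulVec]
  have hginvs : (g⁻¹).transpose = g⁻¹ := by rw [Matrix.transpose_nonsing_inv, hgs]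
  have hGinvs : ∀ i j, G⁻¹ i j = G⁻¹ j i := fun i j ↦ by
    have : (G⁻¹).transpose = G⁻¹ := by
      rw [hinv]
      simp only [Matrix.transpose_mul, Matrix.transpose_transpose, hginvs, mul_assoc]
    exact congrFun (congrFun this.symm i) j
  set X : ι → Matrix ι ι ℝ := fun i ↦ ∑ c, J c i • D c with hX
  have hGD : ∀ i, G⁻¹ * ((K i).transpose * g * J + J.transpose * X i * J + J.transpose * g * K i)
      = G⁻¹ * (K i).transpose * g * J + L * g⁻¹ * X i * J + L * K i := fun i ↦ by
    have e1 : G⁻¹ * (J.transpose * X i * J) = L * g⁻¹ * X i * J := by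
      rw [hinv]
      calc L * g⁻¹ * L.transpose * (J.transpose * X i * J)
          = L * g⁻¹ * (L.transpose * J.transpose) * X i * J := by simp only [mul_assoc]
        _ = _ := by rw [hLtJt, mul_one]
    have e2 : G⁻¹ * (J.transpose * g * K i) = L * K i := by
      rw [hinv]
      calc L * g⁻¹ * L.transpose * (J.transpose * g * K i)
          = L * (g⁻¹ * ((L.transpose * J.transpose) * g)) * K i := by simp only [mul_assoc]
        _ = _ := by rw [hLtJt, one_mul, Matrix.nonsing_inv_mul _ ug, mul_one]
    rw [mul_add, mul_add, e1, e2]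
    simp only [mul_assoc]
  have htr : ∀ l, (G⁻¹ * ((K l).transpose * g * J + J.transpose * X l * J
      + J.transpose * g * K l)).trace = 2 * (L * K l).trace + (g⁻¹ * X l).trace := fun l ↦ by
    rw [hGD, Matrix.trace_add, Matrix.trace_add]
    have e1 : (G⁻¹ * (K l).transpose * g * J).trace = (L * K l).trace := by
      rw [← Matrix.trace_transpose, hinv]
      calc _ = (J.transpose * g * K l * (L * (g⁻¹ * L.transpose))).trace := by
            simp only [Matrix.transpose_mul, Matrix.transpose_transpose, hgs, hginvs, mul_assoc]
        _ = (L * (g⁻¹ * ((L.transpose * J.transpose) * g)) * K l).trace := by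
            rw [Matrix.trace_mul_comm]
            simp only [mul_assoc]
        _ = _ := by rw [hLtJt, one_mul, Matrix.nonsing_inv_mul _ ug, mul_one]
    have e2 : (L * g⁻¹ * X l * J).trace = (g⁻¹ * X l).trace := by
      rw [Matrix.trace_mul_comm, ← mul_assoc, ← mul_assoc, hJL, one_mul]
    rw [e1, e2]
    ring
  have hsum1 : ∀ i, ((G⁻¹ * (K i).transpose * g * J).mulVec (L.mulVec q)) i
      = ∑ j, G⁻¹ i j * ∑ a, K i a j * p a := fun i ↦ by
    rw [← Matrix.mulVec_mulVec, hJq, ← Matrix.mulVec_mulVec, hgq, ← Matrix.mulVec_mulVec]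
    simp only [mv, Matrix.transpose_apply]
  have hsum2 : ∑ i, ((L * g⁻¹ * X i * J).mulVec (L.mulVec q)) i
      = ∑ c, ((g⁻¹ * D c).mulVec q) c := by
    have e : ∀ i, ((L * g⁻¹ * X i * J).mulVec (L.mulVec q)) i
        = ∑ a, ∑ c, L i a * J c i * ((g⁻¹ * D c).mulVec q) a := fun i ↦ by
      have : g⁻¹ * X i = ∑ c, J c i • (g⁻¹ * D c) := by
        simp only [hX, Finset.mul_sum, mul_smul_comm]
      rw [← Matrix.mulVec_mulVec, hJq, mul_assoc, ← Matrix.mulVec_mulVec, this,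
        Matrix.sum_mulVec, mv]
      simp only [Finset.sum_apply, Matrix.smul_mulVec, Pi.smul_apply, smul_eq_mul, Finset.mul_sum,
        mul_assoc]
    simp_rw [e]
    rw [Finset.sum_comm]
    have e' : ∀ a, ∑ i, ∑ c, L i a * J c i * ((g⁻¹ * D c).mulVec q) a
        = ((g⁻¹ * D a).mulVec q) a := fun a ↦ by
      rw [Finset.sum_comm]
      simp_rw [← Finset.sum_mul]
      have : ∀ c, ∑ i, L i a * J c i = (1 : Matrix ι ι ℝ) c a := fun c ↦ by
        rw [← hJL, Matrix.mul_apply]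
        exact Finset.sum_congr rfl fun i _ ↦ mul_comm _ _
      simp_rw [this, Matrix.one_apply]
      simp
    simp_rw [e']
  have hsum3 : ∑ i, ((L * K i).mulVec (L.mulVec q)) i
      = ∑ l, (L * K l).trace * (L.mulVec q) l := by
    have e : ∀ i, ((L * K i).mulVec (L.mulVec q)) i = ∑ l, (L * K i) i l * (L.mulVec q) l :=
      fun i ↦ rfl
    simp_rw [e]
    rw [Finset.sum_comm]
    refine Finset.sum_congr rfl fun l _ ↦ ?_
    rw [← Finset.sum_mul]
    congr 1
    simp only [Matrix.trace, Matrix.diag, Matrix.mul_apply]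
    exact Finset.sum_congr rfl fun i _ ↦ Finset.sum_congr rfl fun a _ ↦ by rw [hK]
  have hsum4 : ∑ l, (g⁻¹ * X l).trace * (L.mulVec q) l = ∑ c, (g⁻¹ * D c).trace * q c := by
    have e : ∀ l, (g⁻¹ * X l).trace = ∑ c, J c l * (g⁻¹ * D c).trace := fun l ↦ by
      simp only [hX, Finset.mul_sum, Matrix.trace_sum, mul_smul_comm, Matrix.trace_smul,
        smul_eq_mul]
    simp_rw [e, Finset.sum_mul]
    rw [Finset.sum_comm]
    refine Finset.sum_congr rfl fun c _ ↦ ?_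
    have := congrFun hJq c
    rw [← this, mv J, Finset.mul_sum]
    exact Finset.sum_congr rfl fun i _ ↦ by ring
  have hsum5 : ∑ i, ∑ j, G⁻¹ i j * ∑ a, ∑ b, J a j * J b i * h b a
      = ∑ b, ∑ a, g⁻¹ b a * h b a := by
    have e : ∀ b a, g⁻¹ b a = ∑ i, ∑ j, J b i * G⁻¹ i j * J a j := fun b a ↦ by
      have : g⁻¹ = J * G⁻¹ * J.transpose := by
        rw [hinv]
        calc g⁻¹ = (J * L) * g⁻¹ * (L.transpose * J.transpose) := by rw [hJL, hLtJt]; simp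
          _ = _ := by simp only [mul_assoc]
      conv_lhs => rw [this]
      simp only [Matrix.mul_apply, Matrix.transpose_apply, Finset.sum_mul]
      rw [Finset.sum_comm]
    simp_rw [e, Finset.mul_sum, Finset.sum_mul]
    rw [sum_sum_comm_sum_sum]
    exact Finset.sum_congr rfl fun b _ ↦ Finset.sum_congr rfl fun a _ ↦
      Finset.sum_congr rfl fun i _ ↦ Finset.sum_congr rfl fun j _ ↦ by ring
  have hA : ∑ i, ∑ j, G⁻¹ i j * (∑ a, K i a j * p a + ∑ a, ∑ b, J a j * J b i * h b a)
      = ∑ i, ∑ j, G⁻¹ i j * ∑ a, K i a j * p a + ∑ b, ∑ a, g⁻¹ b a * h b a := by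
    rw [← hsum5, ← Finset.sum_add_distrib]
    refine Finset.sum_congr rfl fun i _ ↦ ?_
    rw [← Finset.sum_add_distrib]
    exact Finset.sum_congr rfl fun j _ ↦ mul_add _ _ _
  have hB : ∑ i, ((G⁻¹ * ((K i).transpose * g * J + J.transpose * X i * J
        + J.transpose * g * K i)).mulVec (L.mulVec q)) i
      = ∑ i, ∑ j, G⁻¹ i j * ∑ a, K i a j * p a + ∑ c, ((g⁻¹ * D c).mulVec q) c
        + ∑ l, (L * K l).trace * (L.mulVec q) l := by
    rw [← hsum2, ← hsum3, ← Finset.sum_add_distrib, ← Finset.sum_add_distrib]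
    refine Finset.sum_congr rfl fun i _ ↦ ?_
    rw [hGD, Matrix.add_mulVec, Matrix.add_mulVec, ← hsum1]
    rfl
  have hC : ∑ l, (G⁻¹ * ((K l).transpose * g * J + J.transpose * X l * J
        + J.transpose * g * K l)).trace * (L.mulVec q) l
      = 2 * ∑ l, (L * K l).trace * (L.mulVec q) l + ∑ c, (g⁻¹ * D c).trace * q c := by
    rw [← hsum4, Finset.mul_sum, ← Finset.sum_add_distrib]
    refine Finset.sum_congr rfl fun l _ ↦ ?_
    rw [htr]
    ring
  change ∑ i, ∑ j, G⁻¹ i j * (∑ a, K i a j * p a + ∑ a, ∑ b, J a j * J b i * h b a)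
    - (∑ i, ((G⁻¹ * ((K i).transpose * g * J + J.transpose * X i * J
        + J.transpose * g * K i)).mulVec (G⁻¹.mulVec (J.transpose.mulVec p))) i
      - 1 / 2 * ∑ l, (G⁻¹ * ((K l).transpose * g * J + J.transpose * X l * J
        + J.transpose * g * K l)).trace * (G⁻¹.mulVec (J.transpose.mulVec p)) l)
    = ∑ b, ∑ a, g⁻¹ b a * h b a - (∑ c, ((g⁻¹ * D c).mulVec q) c
      - 1 / 2 * ∑ c, (g⁻¹ * D c).trace * q c)
  rw [hGp, hA, hB, hC]
  ring

end LaplacianSymbol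

/-! ### Divergence form and invariance of the coordinate Laplacian -/

section CoordinateCalculus

variable {n : ℕ}

/-- The standard basis vectors of the model space. -/
noncomputable abbrev stdVec (i : Fin n) : EuclideanSpace ℝ (Fin n) := EuclideanSpace.single i 1

theorem clm_apply_eq_sum (L : EuclideanSpace ℝ (Fin n) →L[ℝ] ℝ) (v : EuclideanSpace ℝ (Fin n)) :
    L v = ∑ c, v c * L (stdVec c) := by
  conv_lhs => rw [← (EuclideanSpace.basisFun (Fin n) ℝ).sum_repr v]
  simp [map_sum]

/-- The partial derivatives `∂ᵢu`. -/
noncomputable def coordGrad (u : EuclideanSpace ℝ (Fin n) → ℝ) (y : EuclideanSpace ℝ (Fin n)) :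
    Fin n → ℝ :=
  fun i ↦ fderiv ℝ u y (stdVec i)

/-- The second partial derivatives `∂ᵢ∂ⱼu`. -/
noncomputable def coordHess (u : EuclideanSpace ℝ (Fin n) → ℝ) (y : EuclideanSpace ℝ (Fin n)) :
    Matrix (Fin n) (Fin n) ℝ :=
  Matrix.of fun i j ↦ fderiv ℝ (fun z ↦ coordGrad u z j) y (stdVec i)

/-- The Laplacian of `u` with respect to the metric with components `G`, on an open subset of the
model space. -/
noncomputable def coordLaplacian (G : EuclideanSpace ℝ (Fin n) → Matrix (Fin n) (Fin n) ℝ)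
    (u : EuclideanSpace ℝ (Fin n) → ℝ) (y : EuclideanSpace ℝ (Fin n)) : ℝ :=
  laplacianSymbol (G y) (fun i ↦ matrixDeriv G y (stdVec i)) (coordHess u y) (coordGrad u y)

/-- The Jacobian matrix of a map of the model space. -/
noncomputable def jacobian (τ : EuclideanSpace ℝ (Fin n) → EuclideanSpace ℝ (Fin n))
    (y : EuclideanSpace ℝ (Fin n)) : Matrix (Fin n) (Fin n) ℝ :=
  Matrix.of fun a i ↦ fderiv ℝ τ y (stdVec i) a

theorem differentiableAt_coordGrad {u : EuclideanSpace ℝ (Fin n) → ℝ}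
    {y : EuclideanSpace ℝ (Fin n)} (hu : ContDiffAt ℝ 2 u y) (j : Fin n) :
    DifferentiableAt ℝ (fun z ↦ coordGrad u z j) y :=
  (((hu.fderiv_right (m := 1) (by norm_num)).differentiableAt one_ne_zero).clm_apply
    (differentiableAt_const _))

/-- The divergence form of the Laplacian, multiplied by a function `W`: the divergence of
`√(det G) W G⁻¹∇u` is `√(det G) (W Δu + ⟨dW, du⟩)`. -/
theorem sum_fderiv_flux {G : EuclideanSpace ℝ (Fin n) → Matrix (Fin n) (Fin n) ℝ}
    {u W : EuclideanSpace ℝ (Fin n) → ℝ} {y : EuclideanSpace ℝ (Fin n)}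
    (hG : ∀ a b, DifferentiableAt ℝ (fun z ↦ G z a b) y) (hdet : 0 < (G y).det)
    (hu : ContDiffAt ℝ 2 u y) (hW : DifferentiableAt ℝ W y) :
    (∀ i, DifferentiableAt ℝ
      (fun z ↦ √(G z).det * ((G z)⁻¹.mulVec (coordGrad u z)) i * W z) y) ∧
    ∑ i, fderiv ℝ (fun z ↦ √(G z).det * ((G z)⁻¹.mulVec (coordGrad u z)) i * W z) y (stdVec i) =
      √(G y).det * (coordLaplacian G u y * W y
        + ∑ i, coordGrad W y i * ((G y)⁻¹.mulVec (coordGrad u y)) i) := by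
  have mv : ∀ (A : Matrix (Fin n) (Fin n) ℝ) (v : Fin n → ℝ) i, A.mulVec v i = ∑ j, A i j * v j :=
    fun _ _ _ ↦ rfl
  obtain ⟨hs, hs'⟩ := differentiableAt_sqrt_det hG hdet
  have hinv := differentiableAt_inv_entry hG hdet.ne'
  have hgr := differentiableAt_coordGrad hu
  have hm : ∀ i, DifferentiableAt ℝ (fun z ↦ ((G z)⁻¹.mulVec (coordGrad u z)) i) y := fun i ↦ by
    simp only [mv]
    exact DifferentiableAt.fun_sum fun j _ ↦ (hinv i j).fun_mul (hgr j)
  refine ⟨fun i ↦ (hs.fun_mul (hm i)).fun_mul hW, ?_⟩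
  set q := (G y)⁻¹.mulVec (coordGrad u y) with hq
  have hd : ∀ i, fderiv ℝ (fun z ↦ ((G z)⁻¹.mulVec (coordGrad u z)) i) y (stdVec i)
      = ∑ j, (G y)⁻¹ i j * coordHess u y i j
        - (((G y)⁻¹ * matrixDeriv G y (stdVec i)).mulVec q) i := fun i ↦ by
    simp only [mv (G _)⁻¹]
    rw [fderiv_fun_sum fun j _ ↦ (hinv i j).fun_mul (hgr j)]
    simp only [FunLike.coe_sum, Finset.sum_apply]
    have e : ∀ j, fderiv ℝ (fun z ↦ (G z)⁻¹ i j * coordGrad u z j) y (stdVec i)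
        = (G y)⁻¹ i j * coordHess u y i j
          + matrixDeriv (fun z ↦ (G z)⁻¹) y (stdVec i) i j * coordGrad u y j := fun j ↦ by
      rw [fderiv_fun_mul (hinv i j) (hgr j)]
      simp [coordHess, matrixDeriv_apply]
      ring
    simp_rw [e]
    rw [Finset.sum_add_distrib, ← mv (matrixDeriv (fun z ↦ (G z)⁻¹) y (stdVec i)),
      matrixDeriv_inv hG hdet.ne', Matrix.neg_mulVec,
      ← Matrix.mulVec_mulVec, ← hq]
    rw [Pi.neg_apply]
    ring
  have e : ∀ i, fderiv ℝ (fun z ↦ √(G z).det * ((G z)⁻¹.mulVec (coordGrad u z)) i * W z) y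
      (stdVec i) = √(G y).det * (((∑ j, (G y)⁻¹ i j * coordHess u y i j)
        - (((G y)⁻¹ * matrixDeriv G y (stdVec i)).mulVec q) i
        + 1 / 2 * (((G y)⁻¹ * matrixDeriv G y (stdVec i)).trace * q i)) * W y
        + coordGrad W y i * q i) := fun i ↦ by
    rw [fderiv_fun_mul (hs.fun_mul (hm i)) hW, fderiv_fun_mul hs (hm i)]
    simp only [FunLike.coe_add, FunLike.coe_smul, Pi.add_apply, Pi.smul_apply, smul_eq_mul]
    rw [hd, hs']
    simp only [coordGrad, ← hq]
    ring
  simp_rw [e]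
  rw [← Finset.mul_sum, Finset.sum_add_distrib, ← Finset.sum_mul, Finset.sum_add_distrib,
    Finset.sum_sub_distrib, ← Finset.mul_sum, coordLaplacian, laplacianSymbol, ← hq]
  ring

/-- Invariance of the Laplacian under a change of coordinates `τ`. -/
theorem coordLaplacian_comp {G g : EuclideanSpace ℝ (Fin n) → Matrix (Fin n) (Fin n) ℝ}
    {u w : EuclideanSpace ℝ (Fin n) → ℝ}
    {τ : EuclideanSpace ℝ (Fin n) → EuclideanSpace ℝ (Fin n)} {y : EuclideanSpace ℝ (Fin n)}
    (hτ : ContDiffAt ℝ 2 τ y) (hJ : (jacobian τ y).det ≠ 0)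
    (hg : ∀ a b, DifferentiableAt ℝ (fun z ↦ g z a b) (τ y)) (hdet : (g (τ y)).det ≠ 0)
    (hgs : (g (τ y)).transpose = g (τ y)) (hw : ContDiffAt ℝ 2 w (τ y))
    (hG : ∀ᶠ z in 𝓝 y, G z = (jacobian τ z).transpose * g (τ z) * jacobian τ z)
    (hu : ∀ᶠ z in 𝓝 y, u z = w (τ z)) :
    coordLaplacian G u y = coordLaplacian g w (τ y) := by
  have hτd : DifferentiableAt ℝ τ y := hτ.differentiableAt two_ne_zero
  have hτ1 : DifferentiableAt ℝ (fderiv ℝ τ) y :=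
    (hτ.fderiv_right (m := 1) (by norm_num)).differentiableAt one_ne_zero
  have happ : ∀ (a : Fin n) {f : EuclideanSpace ℝ (Fin n) → EuclideanSpace ℝ (Fin n)},
      DifferentiableAt ℝ f y → HasFDerivAt (fun z ↦ f z a)
        ((EuclideanSpace.proj a : EuclideanSpace ℝ (Fin n) →L[ℝ] ℝ).comp (fderiv ℝ f y)) y :=
    fun a f hf ↦ ((EuclideanSpace.proj a : EuclideanSpace ℝ (Fin n) →L[ℝ] ℝ).hasFDerivAt).comp y
      hf.hasFDerivAt
  have hJl : ∀ l, HasFDerivAt (fun z ↦ fderiv ℝ τ z (stdVec l))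
      ((fderiv ℝ (fderiv ℝ τ) y).flip (stdVec l)) y := fun l ↦ by
    simpa using hτ1.hasFDerivAt.clm_apply (hasFDerivAt_const (stdVec l) y)
  have hJd : ∀ a l, DifferentiableAt ℝ (fun z ↦ jacobian τ z a l) y :=
    fun a l ↦ (happ a (hJl l).differentiableAt).differentiableAt
  have hKapp : ∀ i a l, matrixDeriv (jacobian τ) y (stdVec i) a l
      = fderiv ℝ (fderiv ℝ τ) y (stdVec i) (stdVec l) a := fun i a l ↦ by
    rw [matrixDeriv_apply]
    change fderiv ℝ (fun z ↦ (fderiv ℝ τ z (stdVec l)) a) y (stdVec i) = _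
    rw [(happ a (hJl l).differentiableAt).fderiv, (hJl l).fderiv]
    rfl
  have hK : ∀ i a l, matrixDeriv (jacobian τ) y (stdVec i) a l
      = matrixDeriv (jacobian τ) y (stdVec l) a i := fun i a l ↦ by
    rw [hKapp, hKapp, (hτ.isSymmSndFDerivAt (by simp)).eq]
  -- the chain rule for a partial derivative of `f ∘ τ`
  have hchain : ∀ {f : EuclideanSpace ℝ (Fin n) → ℝ} {z : EuclideanSpace ℝ (Fin n)},
      DifferentiableAt ℝ f (τ z) → DifferentiableAt ℝ τ z → ∀ i,
      fderiv ℝ (fun z ↦ f (τ z)) z (stdVec i)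
        = ∑ c, jacobian τ z c i * fderiv ℝ f (τ z) (stdVec c) := fun {f z} hf hz i ↦ by
    have := (hf.hasFDerivAt.comp z hz.hasFDerivAt).fderiv
    change fderiv ℝ (f ∘ τ) z (stdVec i) = _
    rw [this, ContinuousLinearMap.comp_apply, clm_apply_eq_sum]
    rfl
  have hgτ : ∀ a b, DifferentiableAt ℝ (fun z ↦ g (τ z) a b) y := fun a b ↦
    (hg a b).comp y hτd
  have hgτD : ∀ i, matrixDeriv (fun z ↦ g (τ z)) y (stdVec i)
      = ∑ c, jacobian τ y c i • matrixDeriv g (τ y) (stdVec c) := fun i ↦ by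
    ext a b
    rw [matrixDeriv_apply, hchain (hg a b) hτd, Matrix.sum_apply]
    rfl
  have hJt : ∀ a b, DifferentiableAt ℝ (fun z ↦ (jacobian τ z).transpose a b) y :=
    fun a b ↦ hJd b a
  have hD : ∀ i, matrixDeriv G y (stdVec i)
      = (matrixDeriv (jacobian τ) y (stdVec i)).transpose * g (τ y) * jacobian τ y
        + (jacobian τ y).transpose * (∑ c, jacobian τ y c i • matrixDeriv g (τ y) (stdVec c))
          * jacobian τ y
        + (jacobian τ y).transpose * g (τ y) * matrixDeriv (jacobian τ) y (stdVec i) := fun i ↦ by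
    have e : matrixDeriv G y (stdVec i) = matrixDeriv
        (fun z ↦ (jacobian τ z).transpose * g (τ z) * jacobian τ z) y (stdVec i) := by
      ext a b
      rw [matrixDeriv_apply, matrixDeriv_apply]
      congr 1
      exact Filter.EventuallyEq.fderiv_eq (hG.mono fun z hz ↦ by simp only [hz])
    rw [e, matrixDeriv_mul (differentiableAt_mul_entry hJt hgτ) hJd, matrixDeriv_mul hJt hgτ,
      hgτD, add_mul]
    rfl
  have hτev : ∀ᶠ z in 𝓝 y, DifferentiableAt ℝ τ z :=
    (hτ.eventually (by simp)).mono fun z hz ↦ hz.differentiableAt two_ne_zero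
  have hwev : ∀ᶠ z in 𝓝 y, DifferentiableAt ℝ w (τ z) :=
    hτd.continuousAt.eventually
      ((hw.eventually (by simp)).mono fun z hz ↦ hz.differentiableAt two_ne_zero)
  have hgrad : ∀ᶠ z in 𝓝 y, ∀ j, coordGrad u z j
      = ∑ a, jacobian τ z a j * coordGrad w (τ z) a := by
    filter_upwards [hτev, hwev, hu.eventually_nhds] with z hz hz' hz'' j
    rw [coordGrad, Filter.EventuallyEq.fderiv_eq (f := fun z ↦ w (τ z)) hz'']
    exact hchain hz' hz j
  have hp : coordGrad u y = (jacobian τ y).transpose.mulVec (coordGrad w (τ y)) :=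
    funext hgrad.self_of_nhds
  have hh : coordHess u y = Matrix.of fun i j ↦
      ∑ a, matrixDeriv (jacobian τ) y (stdVec i) a j * coordGrad w (τ y) a
      + ∑ a, ∑ b, jacobian τ y a j * jacobian τ y b i * coordHess w (τ y) b a := by
    ext i j
    have hwj := differentiableAt_coordGrad hw
    have e1 : coordHess u y i j = fderiv ℝ
        (fun z ↦ ∑ a, jacobian τ z a j * coordGrad w (τ z) a) y (stdVec i) := by
      change fderiv ℝ (fun z ↦ coordGrad u z j) y (stdVec i) = _
      rw [Filter.EventuallyEq.fderiv_eq (hgrad.mono fun z hz ↦ hz j)]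
    have hc : ∀ a, DifferentiableAt ℝ (fun z ↦ coordGrad w (τ z) a) y :=
      fun a ↦ (hwj a).comp y hτd
    rw [e1, fderiv_fun_sum fun a _ ↦ (hJd a j).fun_mul (hc a)]
    simp only [FunLike.coe_sum, Finset.sum_apply, Matrix.of_apply]
    rw [← Finset.sum_add_distrib]
    refine Finset.sum_congr rfl fun a _ ↦ ?_
    rw [fderiv_fun_mul (hJd a j) (hc a)]
    simp only [FunLike.coe_add, FunLike.coe_smul, Pi.add_apply, Pi.smul_apply, smul_eq_mul]
    rw [hchain (hwj a) hτd, Finset.mul_sum, matrixDeriv_apply, add_comm]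
    congr 1
    · ring
    · exact Finset.sum_congr rfl fun b _ ↦ by
        rw [coordHess, Matrix.of_apply]; ring
  rw [coordLaplacian, hG.self_of_nhds, hp, hh]
  simp_rw [hD]
  exact laplacianSymbol_change _ _ hJ hdet hgs hK

end CoordinateCalculus

/-! ### The divergence theorem on the half-space -/

/-- The divergence theorem for a compactly supported vector field on the half-space which is
tangent to the boundary. Differentiability is only needed in the open half-space. -/
theorem setIntegral_halfSpace_divergence_eq_zero {n : ℕ} [NeZero n]
    {X : Fin n → EuclideanSpace ℝ (Fin n) → ℝ} {D : EuclideanSpace ℝ (Fin n) → ℝ}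
    {K : Set (EuclideanSpace ℝ (Fin n))} (hK : IsCompact K)
    (hX : ∀ i, ContinuousOn (X i) {y | 0 ≤ y 0}) (hD : ContinuousOn D {y | 0 ≤ y 0})
    (hXK : ∀ i, ∀ y ∉ K, X i y = 0) (hDK : ∀ y ∉ K, D y = 0)
    (hX0 : ∀ y : EuclideanSpace ℝ (Fin n), y 0 = 0 → X 0 y = 0)
    (hd : ∀ y : EuclideanSpace ℝ (Fin n), 0 < y 0 → ∀ i, DifferentiableAt ℝ (X i) y)
    (hdiv : ∀ y : EuclideanSpace ℝ (Fin n), 0 < y 0 →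
      ∑ i, fderiv ℝ (X i) y (stdVec i) = D y) :
    ∫ y in {y : EuclideanSpace ℝ (Fin n) | 0 ≤ y 0}, D y = 0 := by
  obtain ⟨m, rfl⟩ := Nat.exists_eq_succ_of_ne_zero (NeZero.ne n)
  obtain ⟨R, hR0, hR⟩ : ∃ R, 0 < R ∧ K ⊆ Metric.ball 0 R := hK.isBounded.subset_ball_lt 0 0
  have hKR : ∀ y ∈ K, ∀ i, |y i| < R := fun y hy i ↦ by
    have h1 := PiLp.norm_apply_le y i
    have h2 := hR hy
    rw [mem_ball_zero_iff] at h2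
    exact lt_of_le_of_lt h1 h2
  set e := (EuclideanSpace.equiv (Fin (m + 1)) ℝ) with he
  have hemp : MeasurePreserving (e.symm : (Fin (m + 1) → ℝ) → EuclideanSpace ℝ (Fin (m + 1))) :=
    PiLp.volume_preserving_toLp _
  set a : Fin (m + 1) → ℝ := fun i ↦ if i = 0 then 0 else -R with ha
  set b : Fin (m + 1) → ℝ := fun _ ↦ R with hb
  have hab : a ≤ b := fun i ↦ by
    by_cases h : i = 0 <;> simp [ha, hb, h, hR0.le]
  have hIcc0 : ∀ x ∈ Icc a b, 0 ≤ x 0 := fun x hx ↦ by simpa [ha] using hx.1 0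
  have hIoo0 : ∀ x ∈ pi Set.univ fun i ↦ Ioo (a i) (b i), 0 < x 0 := fun x hx ↦ by
    simpa [ha] using (hx 0 (mem_univ _)).1
  have hecont : Continuous (e.symm : (Fin (m + 1) → ℝ) → EuclideanSpace ℝ (Fin (m + 1))) :=
    e.symm.continuous
  have hmaps : MapsTo e.symm (Icc a b) {y : EuclideanSpace ℝ (Fin (m + 1)) | 0 ≤ y 0} :=
    fun x hx ↦ hIcc0 x hx
  have hDint : IntegrableOn (fun x ↦ D (e.symm x)) (Icc a b) :=
    (hD.comp hecont.continuousOn hmaps).integrableOn_compact isCompact_Icc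
  have hopen : ∀ x ∈ pi Set.univ fun i ↦ Ioo (a i) (b i),
      D (e.symm x) = ∑ i, ((fderiv ℝ (X i) (e.symm x)).comp
        (e.symm : (Fin (m + 1) → ℝ) →L[ℝ] _)) (Pi.single i 1) := fun x hx ↦ by
    rw [← hdiv (e.symm x) (hIoo0 x hx)]
    rfl
  have hae : (pi Set.univ fun i ↦ Ioo (a i) (b i)) =ᵐ[volume] Icc a b :=
    Measure.univ_pi_Ioo_ae_eq_Icc
  have hmeas : MeasurableSet (pi Set.univ fun i ↦ Ioo (a i) (b i)) :=
    MeasurableSet.univ_pi fun _ ↦ measurableSet_Ioo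
  have hdivthm := integral_divergence_of_hasFDerivAt_off_countable' a b hab
    (fun i x ↦ X i (e.symm x))
    (fun i x ↦ (fderiv ℝ (X i) (e.symm x)).comp (e.symm : (Fin (m + 1) → ℝ) →L[ℝ] _)) ∅
    countable_empty (fun i ↦ (hX i).comp hecont.continuousOn hmaps)
    (fun x hx i ↦ (hd (e.symm x) (hIoo0 x hx.1) i).hasFDerivAt.comp x e.symm.hasFDerivAt)
    (((hDint.congr_set_ae hae).congr_fun hopen hmeas).congr_set_ae hae.symm)
  have hzero : ∀ i, (∀ x : Fin (m + 1) → ℝ, R ≤ |x i| → X i (e.symm x) = 0) := fun i x hx ↦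
    hXK i _ fun h ↦ absurd (hKR _ h i) (not_lt.2 hx)
  have hface : ∑ i : Fin (m + 1),
      ((∫ x in Icc (a ∘ i.succAbove) (b ∘ i.succAbove), X i (e.symm (i.insertNth (b i) x))) -
        ∫ x in Icc (a ∘ i.succAbove) (b ∘ i.succAbove), X i (e.symm (i.insertNth (a i) x)))
      = 0 := by
    refine Finset.sum_eq_zero fun i _ ↦ ?_
    have h1 : ∀ x : Fin m → ℝ, X i (e.symm (i.insertNth (b i) x)) = 0 := fun x ↦
      hzero i _ (by simp [hb, abs_of_pos hR0])
    have h2 : ∀ x : Fin m → ℝ, X i (e.symm (i.insertNth (a i) x)) = 0 := fun x ↦ by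
      by_cases h : i = 0
      · subst h
        refine hX0 _ ?_
        change (Fin.insertNth (α := fun _ ↦ ℝ) 0 (a 0) x) 0 = 0
        simp [ha]
      · exact hzero i _ (by simp [ha, h, abs_of_pos hR0])
    simp [h1, h2]
  rw [hface] at hdivthm
  have hDK' : ∀ y ∈ {y : EuclideanSpace ℝ (Fin (m + 1)) | 0 ≤ y 0} \ (e ⁻¹' Icc a b), D y = 0 := by
    rintro y ⟨hy, hy'⟩
    refine hDK y fun hyK ↦ hy' ⟨fun i ↦ ?_, fun i ↦ (abs_lt.1 (hKR y hyK i)).2.le⟩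
    by_cases h : i = 0
    · subst h
      simp only [ha, if_true]
      exact hy
    · simp only [ha, h, if_false]
      exact (abs_lt.1 (hKR y hyK i)).1.le
  have hsub : e ⁻¹' Icc a b ⊆ {y : EuclideanSpace ℝ (Fin (m + 1)) | 0 ≤ y 0} :=
    fun y hy ↦ hIcc0 (e y) hy
  have hHs : MeasurableSet {y : EuclideanSpace ℝ (Fin (m + 1)) | 0 ≤ y 0} :=
    (isClosed_le continuous_const (by fun_prop)).measurableSet
  refine (setIntegral_eq_of_subset_of_forall_sdiff_eq_zero hHs hsub hDK').trans ?_
  have hemb : MeasurableEmbedding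
      (e.symm : (Fin (m + 1) → ℝ) → EuclideanSpace ℝ (Fin (m + 1))) :=
    e.symm.toHomeomorph.measurableEmbedding
  rw [← hemp.setIntegral_preimage_emb hemb]
  have hpre : e.symm ⁻¹' (e ⁻¹' Icc a b) = Icc a b := by
    ext x
    simp
  rw [hpre, ← setIntegral_congr_set hae, setIntegral_congr_fun hmeas hopen,
    setIntegral_congr_set hae, hdivthm]

/-! ### Expansion of the cometric density at the identity -/

section Expansion

/-- A differentiable function on `ℝ^κ` is expanded to first order in `t` along `x₀ + th + o(t)`,
uniformly for bounded `h`. -/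
theorem exists_uniform_expansion {κ : Type*} [Fintype κ] {f : (κ → ℝ) → ℝ} {x₀ : κ → ℝ}
    (hf : DifferentiableAt ℝ f x₀) (C : ℝ) {η : ℝ} (hη : 0 < η) :
    ∃ c > 0, ∃ δ > 0, ∀ t : ℝ, |t| < δ → ∀ x h : κ → ℝ, (∀ i, |h i| ≤ C) →
      (∀ i, |x i - x₀ i - t * h i| ≤ c * |t|) →
      |f x - f x₀ - t * fderiv ℝ f x₀ h| ≤ η * |t| := by
  set L := fderiv ℝ f x₀ with hL
  set C' := max C 0 + 1 with hC'
  have hC'0 : 0 < C' := by positivity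
  have hlit := hf.hasFDerivAt.isLittleO
  have hpos : 0 < η / (2 * C') := by positivity
  obtain ⟨r, hr, hball⟩ := Metric.eventually_nhds_iff.1 (hlit.def hpos)
  refine ⟨min 1 (η / (2 * (‖L‖ + 1))), by positivity, r / C', by positivity,
    fun t ht x h hh hx ↦ ?_⟩
  set c := min 1 (η / (2 * (‖L‖ + 1))) with hc
  have hc0 : 0 < c := by positivity
  set e := x - x₀ - t • h with he
  have henorm : ‖e‖ ≤ c * |t| := by
    rw [pi_norm_le_iff_of_nonneg (by positivity)]
    exact fun i ↦ hx i
  have hhnorm : ‖h‖ ≤ max C 0 := by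
    rw [pi_norm_le_iff_of_nonneg (by positivity)]
    exact fun i ↦ (hh i).trans (le_max_left _ _)
  have hx1 : x - x₀ = t • h + e := by simp [he]
  have hxnorm : ‖x - x₀‖ ≤ C' * |t| := by
    rw [hx1]
    refine (norm_add_le _ _).trans ?_
    rw [norm_smul, Real.norm_eq_abs]
    have h1 : c ≤ 1 := min_le_left _ _
    nlinarith [abs_nonneg t]
  have hdist : dist x x₀ < r := by
    rw [dist_eq_norm]
    refine hxnorm.trans_lt ?_
    rwa [lt_div_iff₀' hC'0] at ht
  have h1 := hball hdist
  have h2 : ‖L e‖ ≤ η / 2 * |t| := by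
    refine (L.le_opNorm e).trans ?_
    have h3 : c ≤ η / (2 * (‖L‖ + 1)) := min_le_right _ _
    have h4 : ‖L‖ * c ≤ η / 2 := by
      calc ‖L‖ * c ≤ (‖L‖ + 1) * (η / (2 * (‖L‖ + 1))) := by gcongr; linarith
        _ = η / 2 := by field_simp
    calc ‖L‖ * ‖e‖ ≤ ‖L‖ * (c * |t|) := by gcongr
      _ = (‖L‖ * c) * |t| := by ring
      _ ≤ η / 2 * |t| := by gcongr
  have h5 : f x - f x₀ - t * L h = (f x - f x₀ - L (x - x₀)) + L e := by
    rw [hx1, map_add, map_smul, smul_eq_mul]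
    ring
  rw [h5]
  have h6 : ‖f x - f x₀ - L (x - x₀)‖ ≤ η / 2 * |t| := by
    refine h1.trans ?_
    calc η / (2 * C') * ‖x - x₀‖ ≤ η / (2 * C') * (C' * |t|) := by gcongr
      _ = η / 2 * |t| := by field_simp
  calc |f x - f x₀ - L (x - x₀) + L e| ≤ |f x - f x₀ - L (x - x₀)| + |L e| := abs_add_le _ _
    _ ≤ η / 2 * |t| + η / 2 * |t| := add_le_add h6 h2
    _ = η * |t| := by ring

theorem exists_pos_forall_le {κ : Type*} [Finite κ] {c : κ → ℝ} (hc : ∀ p, 0 < c p) :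
    ∃ c₁ > 0, ∀ p, c₁ ≤ c p := by
  cases nonempty_fintype κ
  rcases isEmpty_or_nonempty κ with h | h
  · exact ⟨1, one_pos, fun p ↦ h.elim p⟩
  · obtain ⟨p, hp⟩ := Finite.exists_min c
    exact ⟨c p, hc p, hp⟩

variable {ι : Type*} [Fintype ι] [DecidableEq ι]

/-- First-order expansions of the density `√(det A)` and of the cometric density `√(det A) A⁻¹`
at the identity. -/
theorem exists_expansion_sqrt_det (C : ℝ) {η : ℝ} (hη : 0 < η) :
    ∃ c > 0, ∃ δ > 0, ∀ t : ℝ, |t| < δ → ∀ A h : Matrix ι ι ℝ, (∀ i j, |h i j| ≤ C) →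
      (∀ i j, |A i j - (1 : Matrix ι ι ℝ) i j - t * h i j| ≤ c * |t|) →
      |√A.det - 1 - t * (1 / 2 * h.trace)| ≤ η * |t| ∧
      ∀ i j, |√A.det * A⁻¹ i j - (1 : Matrix ι ι ℝ) i j
        - t * (1 / 2 * h.trace * (1 : Matrix ι ι ℝ) i j - h i j)| ≤ η * |t| := by
  -- matrices are parametrized by `ℝ^(ι × ι)`, which carries a norm
  set M : (ι × ι → ℝ) → Matrix ι ι ℝ := fun x ↦ Matrix.of fun i j ↦ x (i, j) with hM
  set x₀ : ι × ι → ℝ := fun p ↦ (1 : Matrix ι ι ℝ) p.1 p.2 with hx₀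
  have hM1 : M x₀ = 1 := rfl
  have hd1 : 0 < (M x₀).det := by simp [hM1]
  have hid : ∀ a b, DifferentiableAt ℝ (fun x ↦ M x a b) x₀ := fun a b ↦ by
    simp only [hM, Matrix.of_apply]
    fun_prop
  have hMD : ∀ v : ι × ι → ℝ, matrixDeriv M x₀ v = M v := fun v ↦ by
    ext a b
    rw [matrixDeriv_apply]
    exact congrFun (congrArg _ (ContinuousLinearMap.fderiv
      (ContinuousLinearMap.proj (R := ℝ) (φ := fun _ : ι × ι ↦ ℝ) (a, b)))) v
  obtain ⟨hs, hs'⟩ := differentiableAt_sqrt_det hid hd1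
  have hinv := differentiableAt_inv_entry hid hd1.ne'
  have hinv' : ∀ (v : ι × ι → ℝ) i j,
      fderiv ℝ (fun x ↦ (M x)⁻¹ i j) x₀ v = -v (i, j) := fun v i j ↦ by
    refine (congrFun (congrFun (matrixDeriv_inv hid hd1.ne' v) i) j).trans ?_
    rw [hMD, hM1]
    simp [hM]
  have hF : ∀ p : ι × ι, DifferentiableAt ℝ (fun x ↦ √(M x).det * (M x)⁻¹ p.1 p.2) x₀ :=
    fun p ↦ hs.fun_mul (hinv p.1 p.2)
  obtain ⟨c₀, hc₀, δ₀, hδ₀, h₀⟩ := exists_uniform_expansion hs C hη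
  choose c hc δ hδ hcδ using fun p ↦ exists_uniform_expansion (hF p) C hη
  obtain ⟨c₁, hc₁, hc₁'⟩ := exists_pos_forall_le hc
  obtain ⟨δ₁, hδ₁, hδ₁'⟩ := exists_pos_forall_le hδ
  refine ⟨min c₀ c₁, lt_min hc₀ hc₁, min δ₀ δ₁, lt_min hδ₀ hδ₁, fun t ht A h hh hA ↦ ?_⟩
  have hMA : M (fun p ↦ A p.1 p.2) = A := rfl
  have hMh : M (fun p ↦ h p.1 p.2) = h := rfl
  refine ⟨?_, fun i j ↦ ?_⟩
  · have := h₀ t (ht.trans_le (min_le_left _ _)) (fun p ↦ A p.1 p.2) (fun p ↦ h p.1 p.2)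
      (fun p ↦ hh p.1 p.2) fun p ↦ (hA p.1 p.2).trans (by gcongr; exact min_le_left _ _)
    rw [hs', hMD, hMA, hMh, hM1] at this
    simpa using this
  · have := hcδ (i, j) t (ht.trans_le ((min_le_right _ _).trans (hδ₁' _))) (fun p ↦ A p.1 p.2)
      (fun p ↦ h p.1 p.2) (fun p ↦ hh p.1 p.2)
      fun p ↦ (hA p.1 p.2).trans (by gcongr; exact (min_le_right _ _).trans (hc₁' _))
    rw [fderiv_fun_mul hs (hinv i j)] at this
    simp only [FunLike.coe_add, FunLike.coe_smul, Pi.add_apply, Pi.smul_apply, smul_eq_mul] at this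
    rw [hs', hMD, hinv', hMA, hMh, hM1] at this
    simp only [Matrix.det_one, Real.sqrt_one, one_mul, inv_one] at this
    convert this using 3
    ring

end Expansion

/-! ### Coordinates on the manifold -/

theorem sum_smul_stdVec {n : ℕ} (v : EuclideanSpace ℝ (Fin n)) : ∑ a, v a • stdVec a = v := by
  conv_rhs => rw [← (EuclideanSpace.basisFun (Fin n) ℝ).sum_repr v]
  simp

theorem clm_sum_smul_sum_smul {V ι : Type*} [AddCommGroup V] [Module ℝ V] [TopologicalSpace V]
    [Fintype ι] (B : V →L[ℝ] V →L[ℝ] ℝ) (a b : ι → ℝ) (v w : ι → V) :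
    B (∑ i, a i • v i) (∑ j, b j • w j) = ∑ i, ∑ j, a i * b j * B (v i) (w j) := by
  simp only [map_sum, map_smul, FunLike.coe_sum, Finset.sum_apply, FunLike.coe_smul,
    Pi.smul_apply, smul_eq_mul, Finset.mul_sum]
  rw [Finset.sum_comm]
  exact Finset.sum_congr rfl fun _ _ ↦ Finset.sum_congr rfl fun _ _ ↦ by ring

section Coordinates

variable {n : ℕ} [NeZero n] {M : Type*} [TopologicalSpace M]
  [ChartedSpace (EuclideanHalfSpace n) M] [IsManifold (𝓡∂ n) ∞ M]

/-- The matrix `g(∂ᵢ, ∂ⱼ)` at `q`, for the coordinate vectors of the chart centred at `x`. -/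
noncomputable def gramIn {k : ℕ∞} (g : Metric n M k) (x q : M) : Matrix (Fin n) (Fin n) ℝ :=
  Matrix.of fun i j ↦ g.inner q (coordVec x q i) (coordVec x q j)

/-- The components `df(∂ᵢ)` at `q`, in the chart centred at `x`. -/
noncomputable def diffIn (f : M → ℝ) (x q : M) : Fin n → ℝ :=
  fun i ↦ differential f q (coordVec x q i)

/-- The Jacobian matrix at `q` of the change from the chart centred at `x` to the one centred
at `x'`. -/
noncomputable def transition (x x' q : M) : Matrix (Fin n) (Fin n) ℝ :=
  Matrix.of fun a i ↦ tangentCoordChange (𝓡∂ n) x x' q (stdVec i) a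

theorem gram_eq_gramIn {k : ℕ∞} (g : Metric n M k) (x : M) (y : EuclideanSpace ℝ (Fin n)) :
    gram g x y = gramIn g x ((extChartAt (𝓡∂ n) x).symm y) := rfl

theorem gramAt_eq_gramIn {k : ℕ∞} (g : Metric n M k) (p : M) : gramAt g p = gramIn g p p := rfl

theorem coordVec_eq_tangentCoordChange {x q : M} (hq : q ∈ (extChartAt (𝓡∂ n) x).source)
    (i : Fin n) : coordVec x q i = tangentCoordChange (𝓡∂ n) x q q (stdVec i) := by
  rw [extChartAt_source] at hq
  rw [coordVec, TangentBundle.symmL_trivializationAt_eq_core hq]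
  rfl

theorem coordVec_eq_sum {x x' q : M} (hq : q ∈ (extChartAt (𝓡∂ n) x).source)
    (hq' : q ∈ (extChartAt (𝓡∂ n) x').source) (i : Fin n) :
    coordVec x q i = ∑ a, transition x x' q a i • coordVec x' q a := by
  have h1 := tangentCoordChange_comp (I := 𝓡∂ n) (w := x) (x := x') (y := q) (z := q)
    (v := stdVec i) ⟨⟨hq, hq'⟩, mem_extChartAt_source q⟩
  rw [coordVec_eq_tangentCoordChange hq]
  simp_rw [coordVec_eq_tangentCoordChange hq']
  refine h1.symm.trans ?_
  conv_lhs => rw [← sum_smul_stdVec (tangentCoordChange (𝓡∂ n) x x' q (stdVec i))]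
  rw [map_sum]
  simp_rw [map_smul]
  rfl

theorem transition_mul_transition {x x' q : M} (hq : q ∈ (extChartAt (𝓡∂ n) x).source)
    (hq' : q ∈ (extChartAt (𝓡∂ n) x').source) :
    transition (n := n) x' x q * transition x x' q = 1 := by
  ext i j
  have h1 := tangentCoordChange_comp (I := 𝓡∂ n) (w := x) (x := x') (y := x) (z := q)
    (v := stdVec j) ⟨⟨hq, hq'⟩, hq⟩
  rw [tangentCoordChange_self hq] at h1
  rw [← sum_smul_stdVec (tangentCoordChange (𝓡∂ n) x x' q (stdVec j)), map_sum] at h1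
  simp_rw [map_smul] at h1
  have h2 := congrArg (fun v : EuclideanSpace ℝ (Fin n) ↦ v i) h1
  simp only [WithLp.ofLp_sum, Finset.sum_apply] at h2
  rw [Matrix.mul_apply]
  have h3 : (stdVec j : EuclideanSpace ℝ (Fin n)) i = (1 : Matrix (Fin n) (Fin n) ℝ) i j := by
    simp [Matrix.one_apply]
  rw [← h3, ← h2]
  exact Finset.sum_congr rfl fun a _ ↦ mul_comm _ _

theorem isUnit_transition {x x' q : M} (hq : q ∈ (extChartAt (𝓡∂ n) x).source)
    (hq' : q ∈ (extChartAt (𝓡∂ n) x').source) : IsUnit (transition (n := n) x x' q) :=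
  (isUnit_iff_exists_inv'.2 ⟨_, transition_mul_transition hq hq'⟩)

/-- Transformation of the components of a bilinear form under a change of charts. -/
theorem bilin_eq_transition {x x' q : M} (hq : q ∈ (extChartAt (𝓡∂ n) x).source)
    (hq' : q ∈ (extChartAt (𝓡∂ n) x').source) (B : CovTwoTensor (n := n) q) :
    (Matrix.of fun i j ↦ B (coordVec x q i) (coordVec x q j)) = (transition x x' q).transpose *
      (Matrix.of fun i j ↦ B (coordVec x' q i) (coordVec x' q j)) * transition x x' q := by
  ext i j
  rw [Matrix.of_apply, coordVec_eq_sum hq hq' i, coordVec_eq_sum hq hq' j,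
    clm_sum_smul_sum_smul]
  simp only [Matrix.mul_apply, Matrix.transpose_apply, Matrix.of_apply, Finset.sum_mul]
  rw [Finset.sum_comm]
  exact Finset.sum_congr rfl fun a _ ↦ Finset.sum_congr rfl fun b _ ↦ by ring

theorem gramIn_eq_transition {k : ℕ∞} (g : Metric n M k) {x x' q : M}
    (hq : q ∈ (extChartAt (𝓡∂ n) x).source) (hq' : q ∈ (extChartAt (𝓡∂ n) x').source) :
    gramIn g x q = (transition x x' q).transpose * gramIn g x' q * transition x x' q :=
  bilin_eq_transition hq hq' (g.inner q)

theorem diffIn_eq_transition (f : M → ℝ) {x x' q : M}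
    (hq : q ∈ (extChartAt (𝓡∂ n) x).source) (hq' : q ∈ (extChartAt (𝓡∂ n) x').source) :
    diffIn f x q = (transition (n := n) x x' q).transpose.mulVec (diffIn f x' q) := by
  ext i
  rw [diffIn, coordVec_eq_sum hq hq' i, map_sum]
  simp_rw [map_smul]
  rfl

theorem coordVec_self (p : M) (i : Fin n) : coordVec p p i = stdVec i := by
  rw [coordVec_eq_tangentCoordChange (mem_extChartAt_source p)]
  exact tangentCoordChange_self (I := 𝓡∂ n) (v := stdVec i) (mem_extChartAt_source p)

theorem gramAt_posDef {k : ℕ∞} (g : Metric n M k) (p : M) : (gramAt g p).PosDef := by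
  refine Matrix.PosDef.of_dotProduct_mulVec_pos ?_ fun v hv ↦ ?_
  · ext i j
    simp [gramAt, g.symm p (coordVec p p i)]
  · have hv' : ∑ i, v i • coordVec (n := n) p p i ≠ 0 := by
      intro h
      refine hv (funext fun i ↦ ?_)
      have h2 : ∑ i, v i • (stdVec i : EuclideanSpace ℝ (Fin n)) = 0 := by
        refine Eq.trans (Finset.sum_congr rfl fun i _ ↦ ?_) h
        rw [coordVec_self]
        rfl
      have h3 := congrArg (fun v : EuclideanSpace ℝ (Fin n) ↦ v i) h2
      simpa [Finset.sum_apply, Pi.single_apply] using h3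
    have := g.pos p _ hv'
    rw [clm_sum_smul_sum_smul] at this
    refine this.trans_eq (Finset.sum_congr rfl fun a _ ↦ ?_)
    change _ = v a * ∑ b, gramAt g p a b * v b
    rw [Finset.mul_sum]
    exact Finset.sum_congr rfl fun b _ ↦ by rw [gramAt, Matrix.of_apply]; ring

theorem gramIn_posDef {k : ℕ∞} (g : Metric n M k) {x q : M}
    (hq : q ∈ (extChartAt (𝓡∂ n) x).source) : (gramIn g x q).PosDef := by
  rw [gramIn_eq_transition g hq (mem_extChartAt_source q)]
  have := (gramAt_posDef g q).conjTranspose_mul_mul_same (B := transition (n := n) x q q)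
    (Matrix.mulVec_injective_of_isUnit (isUnit_transition hq (mem_extChartAt_source q)))
  simpa [gramAt_eq_gramIn] using this

theorem contMDiffOn_gramIn {k : ℕ∞} (g : Metric n M k) (x : M) (i j : Fin n) :
    ContMDiffOn (𝓡∂ n) 𝓘(ℝ, ℝ) k (fun q ↦ gramIn g x q i j) (extChartAt (𝓡∂ n) x).source := by
  have hframe : ∀ i, ContMDiffOn (𝓡∂ n) ((𝓡∂ n).prod 𝓘(ℝ, EuclideanSpace ℝ (Fin n))) k
      (fun q ↦ TotalSpace.mk' (EuclideanSpace ℝ (Fin n))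
        (E := fun q : M ↦ TangentSpace (𝓡∂ n) q) q (coordVec x q i))
      (extChartAt (𝓡∂ n) x).source := fun i ↦ by
    have h := (trivializationAt (EuclideanSpace ℝ (Fin n)) (TangentSpace (𝓡∂ n) : M → Type)
      x).contMDiffOn_localFrame_baseSet (I := 𝓡∂ n) (n := k)
      (EuclideanSpace.basisFun (Fin n) ℝ).toBasis i
    rw [TangentBundle.trivializationAt_baseSet, ← extChartAt_source (𝓡∂ n)] at h
    refine h.congr fun q hq ↦ ?_
    rw [extChartAt_source] at hq
    congr 1
    rw [Trivialization.localFrame_apply_of_mem_baseSet _ _ (by exact hq)]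
    simp only [Trivialization.basisAt, coordVec, Module.Basis.map_apply,
      OrthonormalBasis.coe_toBasis, EuclideanSpace.basisFun_apply]
    exact (Trivialization.symmL_apply (R := ℝ) (trivializationAt (EuclideanSpace ℝ (Fin n))
      (TangentSpace (𝓡∂ n) : M → Type) x) (by exact hq) _)
  have := ContMDiffOn.clm_bundle_apply₂ (F₁ := EuclideanSpace ℝ (Fin n))
    (F₂ := EuclideanSpace ℝ (Fin n)) (F₃ := ℝ) (E₁ := fun q : M ↦ TangentSpace (𝓡∂ n) q)
    (E₂ := fun q : M ↦ TangentSpace (𝓡∂ n) q) (E₃ := Bundle.Trivial M ℝ)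
    (g.contMDiff.contMDiffOn) (hframe i) (hframe j)
  intro q hq
  have h2 := this q hq
  rw [contMDiffWithinAt_totalSpace] at h2
  exact h2.2

end Coordinates

/-! ### Regularity in charts and the Laplacian at interior points -/

section Regularity

variable {n : ℕ} [NeZero n] {M : Type*} [TopologicalSpace M]
  [ChartedSpace (EuclideanHalfSpace n) M]

theorem two_le_coe {r : ℕ∞} (hr : 2 ≤ r) : (2 : WithTop ℕ∞) ≤ r := WithTop.coe_le_coe.2 hr

theorem coe_ne_zero_of_one_le {k : ℕ∞} (hk : 1 ≤ k) : (k : WithTop ℕ∞) ≠ 0 := by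
  intro h
  simp only [WithTop.coe_eq_zero] at h
  simp [h] at hk

theorem mem_range_iff_nonneg {y : EuclideanSpace ℝ (Fin n)} : y ∈ range (𝓡∂ n) ↔ 0 ≤ y 0 := by
  rw [range_modelWithCornersEuclideanHalfSpace]
  rfl

theorem range_mem_nhds {y : EuclideanSpace ℝ (Fin n)} (hy : 0 < y 0) : range (𝓡∂ n) ∈ 𝓝 y := by
  rw [mem_nhds_iff]
  refine ⟨interior (range (𝓡∂ n)), interior_subset, isOpen_interior, ?_⟩
  rw [interior_range_modelWithCornersEuclideanHalfSpace]
  exact hy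

theorem target_mem_nhds {x : M} {y : EuclideanSpace ℝ (Fin n)}
    (hy : y ∈ (extChartAt (𝓡∂ n) x).target) (h0 : 0 < y 0) :
    (extChartAt (𝓡∂ n) x).target ∈ 𝓝 y := by
  have := extChartAt_target_mem_nhdsWithin_of_mem hy
  rwa [nhdsWithin_eq_nhds.2 (range_mem_nhds h0)] at this

theorem extChartAt_nonneg (x q : M) : 0 ≤ extChartAt (𝓡∂ n) x q 0 :=
  mem_range_iff_nonneg.1 (mem_range_self _)

theorem partialD_eq_coordGrad {f : EuclideanSpace ℝ (Fin n) → ℝ} {y : EuclideanSpace ℝ (Fin n)}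
    (hy : 0 < y 0) (i : Fin n) : partialD i f y = coordGrad f y i := by
  rw [partialD, fderivWithin_of_mem_nhds (range_mem_nhds hy)]
  rfl

theorem eventually_pos {y : EuclideanSpace ℝ (Fin n)} (hy : 0 < y 0) :
    ∀ᶠ z : EuclideanSpace ℝ (Fin n) in 𝓝 y, 0 < z 0 :=
  (isOpen_lt continuous_const (by fun_prop)).mem_nhds hy

theorem mem_interior_target_iff {x : M} {y : EuclideanSpace ℝ (Fin n)}
    (hy : y ∈ (extChartAt (𝓡∂ n) x).target) :
    y ∈ interior (extChartAt (𝓡∂ n) x).target ↔ 0 < y 0 := by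
  refine ⟨fun h ↦ ?_, fun h ↦ mem_interior_iff_mem_nhds.2 (target_mem_nhds hy h)⟩
  have := interior_mono (extChartAt_target_subset_range x) h
  rwa [interior_range_modelWithCornersEuclideanHalfSpace] at this

variable [IsManifold (𝓡∂ n) ∞ M]

theorem isManifold_one : IsManifold (𝓡∂ n) 1 M := IsManifold.of_le (n := ∞) (by simp)

theorem diffIn_eq_partialD {f : M → ℝ} {x q : M} (hq : q ∈ (extChartAt (𝓡∂ n) x).source)
    (hf : MDifferentiableAt (𝓡∂ n) 𝓘(ℝ, ℝ) f q) (i : Fin n) :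
    diffIn f x q i = partialD i (f ∘ (extChartAt (𝓡∂ n) x).symm) (extChartAt (𝓡∂ n) x q) := by
  have hq' := hq
  rw [extChartAt_source] at hq'
  have hsymm : MDifferentiableWithinAt 𝓘(ℝ, EuclideanSpace ℝ (Fin n)) (𝓡∂ n)
      (extChartAt (𝓡∂ n) x).symm (range (𝓡∂ n)) (extChartAt (𝓡∂ n) x q) :=
    mdifferentiableWithinAt_extChartAt_symm ((extChartAt (𝓡∂ n) x).map_source hq)
  have hud : UniqueMDiffWithinAt 𝓘(ℝ, EuclideanSpace ℝ (Fin n)) (range (𝓡∂ n))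
      (extChartAt (𝓡∂ n) x q) :=
    ((𝓡∂ n).uniqueDiffOn _ (extChartAt_target_subset_range x
      ((extChartAt (𝓡∂ n) x).map_source hq))).uniqueMDiffWithinAt
  have hback : (extChartAt (𝓡∂ n) x).symm (extChartAt (𝓡∂ n) x q) = q :=
    (extChartAt (𝓡∂ n) x).left_inv hq
  have h := HasMFDerivAt.comp_hasMFDerivWithinAt (extChartAt (𝓡∂ n) x q)
    (by rw [hback]; exact hf.hasMFDerivAt) hsymm.hasMFDerivWithinAt
  have h2 := h.mfderivWithin hud
  rw [partialD, ← mfderivWithin_eq_fderivWithin, h2, diffIn, differential, coordVec,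
    TangentBundle.symmL_trivializationAt hq']
  rfl

theorem contDiffOn_comp_symm {r : ℕ∞} {f : M → ℝ} (hf : ContMDiff (𝓡∂ n) 𝓘(ℝ, ℝ) r f) (x : M) :
    ContDiffOn ℝ r (f ∘ (extChartAt (𝓡∂ n) x).symm) (extChartAt (𝓡∂ n) x).target := by
  rw [← contMDiffOn_iff_contDiffOn]
  exact hf.comp_contMDiffOn
    ((contMDiffOn_extChartAt_symm (n := ∞) x).of_le (by exact_mod_cast le_top))

theorem contDiffOn_gram {k : ℕ∞} (g : Metric n M k) (x : M) (i j : Fin n) :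
    ContDiffOn ℝ k (fun y ↦ gram g x y i j) (extChartAt (𝓡∂ n) x).target := by
  rw [← contMDiffOn_iff_contDiffOn]
  exact (contMDiffOn_gramIn g x i j).comp
    ((contMDiffOn_extChartAt_symm (n := ∞) x).of_le (by exact_mod_cast le_top))
    (fun y hy ↦ (extChartAt (𝓡∂ n) x).map_target hy)

theorem isInteriorPoint_iff_pos {x q : M} (hq : q ∈ (extChartAt (𝓡∂ n) x).source) :
    (𝓡∂ n).IsInteriorPoint q ↔ 0 < extChartAt (𝓡∂ n) x q 0 := by
  have := isManifold_one (n := n) (M := M)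
  rw [← mem_interior_target_iff ((extChartAt (𝓡∂ n) x).map_source hq)]
  rw [extChartAt_source] at hq
  exact ModelWithCorners.isInteriorPoint_iff_of_mem_atlas one_ne_zero (chart_mem_atlas _ x) hq

theorem mem_boundary_iff_eq_zero {x q : M} (hq : q ∈ (extChartAt (𝓡∂ n) x).source) :
    q ∈ (𝓡∂ n).boundary M ↔ extChartAt (𝓡∂ n) x q 0 = 0 := by
  have h := isInteriorPoint_iff_pos hq
  have h0 := extChartAt_nonneg (n := n) x q
  change (𝓡∂ n).IsBoundaryPoint q ↔ _
  rw [ModelWithCorners.isBoundaryPoint_iff_not_isInteriorPoint, h]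
  exact ⟨fun h ↦ le_antisymm (not_lt.1 h) h0, fun h ↦ by rw [h]; exact lt_irrefl _⟩

/-- A change of charts preserves the boundary, so the derivative of its normal component in the
directions tangent to the boundary vanishes. -/
theorem transition_zero_eq_zero {x x' q : M} (hq : q ∈ (extChartAt (𝓡∂ n) x).source)
    (hq' : q ∈ (extChartAt (𝓡∂ n) x').source) (hb : q ∈ (𝓡∂ n).boundary M) {i : Fin n}
    (hi : i ≠ 0) : transition (n := n) x x' q 0 i = 0 := by
  set y := extChartAt (𝓡∂ n) x q with hy
  set τ := extChartAt (𝓡∂ n) x' ∘ (extChartAt (𝓡∂ n) x).symm with hτ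
  have hd : HasFDerivWithinAt τ (tangentCoordChange (𝓡∂ n) x x' q) (range (𝓡∂ n)) y :=
    hasFDerivWithinAt_tangentCoordChange ⟨hq, hq'⟩
  have hline : ∀ s : ℝ, y + s • stdVec i ∈ range (𝓡∂ n) := fun s ↦ by
    rw [mem_range_iff_nonneg]
    simpa [hi.symm, hy] using extChartAt_nonneg (n := n) x q
  have hcurve : HasDerivAt (fun s : ℝ ↦ y + s • (stdVec i : EuclideanSpace ℝ (Fin n)))
      (stdVec i) 0 := by
    simpa using ((hasDerivAt_id (0 : ℝ)).smul_const (stdVec i)).const_add y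
  have hcomp : HasDerivAt (fun s : ℝ ↦ τ (y + s • stdVec i))
      (tangentCoordChange (𝓡∂ n) x x' q (stdVec i)) 0 := by
    have := HasFDerivWithinAt.comp_hasDerivWithinAt (s := univ) (t := range (𝓡∂ n)) (0 : ℝ)
      (l := τ) (f := fun s : ℝ ↦ y + s • (stdVec i : EuclideanSpace ℝ (Fin n)))
      (by simpa using hd) hcurve.hasDerivWithinAt (fun s _ ↦ hline s)
    rwa [hasDerivWithinAt_univ] at this
  have h0 : HasDerivAt (fun s : ℝ ↦ τ (y + s • stdVec i) 0)
      (tangentCoordChange (𝓡∂ n) x x' q (stdVec i) 0) 0 :=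
    (EuclideanSpace.proj (0 : Fin n) : EuclideanSpace ℝ (Fin n) →L[ℝ] ℝ).hasFDerivAt.comp_hasDerivAt
      (0 : ℝ) hcomp
  refine IsLocalMin.hasDerivAt_eq_zero (Eventually.of_forall fun s ↦ ?_) h0
  have h1 : τ (y + (0 : ℝ) • stdVec i) 0 = 0 := by
    rw [zero_smul, add_zero, hτ, Function.comp_apply, hy, (extChartAt (𝓡∂ n) x).left_inv hq]
    exact (mem_boundary_iff_eq_zero hq').1 hb
  change τ (y + (0 : ℝ) • stdVec i) 0 ≤ _
  rw [h1]
  exact extChartAt_nonneg _ _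

theorem transition_eq_jacobian {x x' q : M}
    (hi : 0 < extChartAt (𝓡∂ n) x q 0) : transition (n := n) x x' q =
      jacobian (extChartAt (𝓡∂ n) x' ∘ (extChartAt (𝓡∂ n) x).symm) (extChartAt (𝓡∂ n) x q) := by
  ext a i
  rw [transition, jacobian, Matrix.of_apply, Matrix.of_apply, tangentCoordChange_def,
    fderivWithin_of_mem_nhds (range_mem_nhds hi)]

theorem gram_transpose {k : ℕ∞} (g : Metric n M k) (x : M) (y : EuclideanSpace ℝ (Fin n)) :
    (gram g x y).transpose = gram g x y := by
  ext i j
  exact g.symm _ _ _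

/-- At interior points the Laplacian is the one of the coordinate expressions of the metric and of
the function. -/
theorem laplacian_eq_coordLaplacian {k : ℕ∞} (g : Metric n M k) (f : M → ℝ) {p : M}
    (hp : (𝓡∂ n).IsInteriorPoint p) : laplacian g f p =
      coordLaplacian (gram g p) (f ∘ (extChartAt (𝓡∂ n) p).symm) (extChartAt (𝓡∂ n) p p) := by
  set y := extChartAt (𝓡∂ n) p p with hy
  have hy0 : 0 < y 0 := (isInteriorPoint_iff_pos (mem_extChartAt_source p)).1 hp
  rw [coordLaplacian, ← laplacianSymbol_eq_sum_christoffel _ _ (gram_transpose g p y)]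
  · rw [laplacian]
    refine Finset.sum_congr rfl fun i _ ↦ Finset.sum_congr rfl fun j _ ↦ ?_
    congr 1
    rw [hessian]
    congr 1
    · rw [partialD_eq_coordGrad hy0]
      change fderiv ℝ _ y (stdVec i) = fderiv ℝ _ y (stdVec i)
      congr 1
      refine Filter.EventuallyEq.fderiv_eq ?_
      filter_upwards [eventually_pos hy0] with z hz
      exact partialD_eq_coordGrad hz j
    · refine Finset.sum_congr rfl fun c _ ↦ ?_
      rw [partialD_eq_coordGrad hy0, christoffel]
      congr 2
      refine Finset.sum_congr rfl fun l _ ↦ ?_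
      rw [partialD_eq_coordGrad hy0, partialD_eq_coordGrad hy0, partialD_eq_coordGrad hy0]
      rfl
  · intro i
    ext a b
    simp only [Matrix.transpose_apply, matrixDeriv_apply]
    congr 2
    funext z
    exact g.symm _ _ _

theorem contDiffAt_gram {k : ℕ∞} (g : Metric n M k) {x : M} {y : EuclideanSpace ℝ (Fin n)}
    (hy : y ∈ (extChartAt (𝓡∂ n) x).target) (h0 : 0 < y 0) (i j : Fin n) :
    ContDiffAt ℝ k (fun y ↦ gram g x y i j) y :=
  (contDiffOn_gram g x i j).contDiffAt (target_mem_nhds hy h0)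

theorem contDiffAt_comp_symm {r : ℕ∞} {f : M → ℝ} (hf : ContMDiff (𝓡∂ n) 𝓘(ℝ, ℝ) r f) {x : M}
    {y : EuclideanSpace ℝ (Fin n)} (hy : y ∈ (extChartAt (𝓡∂ n) x).target) (h0 : 0 < y 0) :
    ContDiffAt ℝ r (f ∘ (extChartAt (𝓡∂ n) x).symm) y :=
  (contDiffOn_comp_symm hf x).contDiffAt (target_mem_nhds hy h0)

/-- At interior points the Laplacian can be computed in any chart. -/
theorem coordLaplacian_eq_laplacian {k r : ℕ∞} (hk : 1 ≤ k) (hr : 2 ≤ r) (g : Metric n M k)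
    {f : M → ℝ} (hf : ContMDiff (𝓡∂ n) 𝓘(ℝ, ℝ) r f) {x : M} {y : EuclideanSpace ℝ (Fin n)}
    (hy : y ∈ (extChartAt (𝓡∂ n) x).target) (h0 : 0 < y 0) :
    coordLaplacian (gram g x) (f ∘ (extChartAt (𝓡∂ n) x).symm) y =
      laplacian g f ((extChartAt (𝓡∂ n) x).symm y) := by
  set p := (extChartAt (𝓡∂ n) x).symm y with hp
  have hpx : p ∈ (extChartAt (𝓡∂ n) x).source := (extChartAt (𝓡∂ n) x).map_target hy
  have hpp := mem_extChartAt_source (I := 𝓡∂ n) p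
  have hxp : extChartAt (𝓡∂ n) x p = y := (extChartAt (𝓡∂ n) x).right_inv hy
  have hint : (𝓡∂ n).IsInteriorPoint p := (isInteriorPoint_iff_pos hpx).2 (by rwa [hxp])
  have hpp0 : 0 < extChartAt (𝓡∂ n) p p 0 := (isInteriorPoint_iff_pos hpp).1 hint
  have hppt := mem_extChartAt_target (I := 𝓡∂ n) p
  set τ := extChartAt (𝓡∂ n) p ∘ (extChartAt (𝓡∂ n) x).symm with hτ
  have hτy : τ y = extChartAt (𝓡∂ n) p p := by rw [hτ, Function.comp_apply, ← hp]
  -- points near `y` correspond to interior points in the domain of both charts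
  have hev : ∀ᶠ z in 𝓝 y, z ∈ (extChartAt (𝓡∂ n) x).target ∧ 0 < z 0 ∧
      (extChartAt (𝓡∂ n) x).symm z ∈ (extChartAt (𝓡∂ n) p).source :=
    Filter.Eventually.and (target_mem_nhds hy h0) ((eventually_pos h0).and
      ((continuousAt_extChartAt_symm'' hy).eventually (extChartAt_source_mem_nhds p)))
  rw [laplacian_eq_coordLaplacian g f hint, ← hτy]
  have hτc : ContDiffAt ℝ 2 τ y := by
    have h := contDiffWithinAt_ext_coord_change (I := 𝓡∂ n) (n := ∞) p x (y := y)
      (by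
        rw [PartialEquiv.trans_source, PartialEquiv.symm_source]
        exact ⟨hy, hpp⟩)
    exact (h.contDiffAt (range_mem_nhds h0)).of_le (two_le_coe le_top)
  refine coordLaplacian_comp hτc ?_ ?_ ?_ ?_ ?_ ?_ ?_
  · have := isUnit_transition hpx hpp
    rw [transition_eq_jacobian (by rwa [hxp]), hxp] at this
    exact ((Matrix.isUnit_iff_isUnit_det _).1 this).ne_zero
  · intro a b
    rw [hτy]
    exact (contDiffAt_gram g hppt hpp0 a b).differentiableAt
      (coe_ne_zero_of_one_le hk)
  · rw [hτy, gram_eq_gramIn, (extChartAt (𝓡∂ n) p).left_inv hpp]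
    exact (gramAt_posDef g p).det_pos.ne'
  · exact gram_transpose g p _
  · rw [hτy]
    exact (contDiffAt_comp_symm hf hppt hpp0).of_le (two_le_coe hr)
  · filter_upwards [hev] with z ⟨hz, hz0, hzp⟩
    have hzx := (extChartAt (𝓡∂ n) x).map_target hz
    rw [gram_eq_gramIn, gram_eq_gramIn, hτ, Function.comp_apply,
      (extChartAt (𝓡∂ n) p).left_inv hzp, gramIn_eq_transition g hzx hzp,
      transition_eq_jacobian (by rwa [(extChartAt (𝓡∂ n) x).right_inv hz]),
      (extChartAt (𝓡∂ n) x).right_inv hz]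
  · filter_upwards [hev] with z ⟨hz, hz0, hzp⟩
    rw [hτ, Function.comp_apply, Function.comp_apply, Function.comp_apply,
      (extChartAt (𝓡∂ n) p).left_inv hzp]

end Regularity

/-! ### The Riemannian measure -/

/-- If measures `μ i` concentrated on sets `U i` agree on overlaps, and countably many of the `U i`
cover the space, then the supremum of the `μ i` restricts to each of them. -/
theorem restrict_iSup_eq_of_compatible {α ι : Type*} [MeasurableSpace α] {μ : ι → Measure α}
    {U : ι → Set α} (hU : ∀ i, MeasurableSet (U i)) (hμ : ∀ i, μ i (U i)ᶜ = 0)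
    (hcompat : ∀ i j A, MeasurableSet A → A ⊆ U i → A ⊆ U j → μ i A = μ j A)
    (s : ℕ → ι) (hs : ⋃ m, U (s m) = univ) (i : ι) :
    (⨆ j, μ j).restrict (U i) = μ i := by
  -- the measure glued from the pieces of a countable disjoint cover
  set D := disjointed (fun m ↦ U (s m)) with hD
  have hDm : ∀ m, MeasurableSet (D m) := MeasurableSet.disjointed fun m ↦ hU (s m)
  have hDU : ∀ m, D m ⊆ U (s m) := disjointed_subset _
  set ν := Measure.sum fun m ↦ (μ (s m)).restrict (D m) with hν
  have hνi : ∀ j A, MeasurableSet A → A ⊆ U j → ν A = μ j A := fun j A hA hAj ↦ by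
    rw [hν, Measure.sum_apply _ hA]
    calc ∑' m, (μ (s m)).restrict (D m) A = ∑' m, μ j (A ∩ D m) :=
          tsum_congr fun m ↦ by
            rw [Measure.restrict_apply hA]
            exact hcompat _ _ _ (hA.inter (hDm m)) (inter_subset_right.trans (hDU m))
              (inter_subset_left.trans hAj)
      _ = μ j (⋃ m, A ∩ D m) := by
          rw [measure_iUnion]
          · intro a b hab
            exact ((disjoint_disjointed _ hab).mono inter_subset_right inter_subset_right)
          · exact fun m ↦ hA.inter (hDm m)
      _ = μ j A := by rw [← inter_iUnion, hD, iUnion_disjointed, hs, inter_univ]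
  have hres : ∀ j, (μ j).restrict (U j) = μ j := fun j ↦
    Measure.restrict_eq_self_of_ae_mem (by
      rw [ae_iff]
      exact hμ j)
  have hle : ∀ j, μ j ≤ ν := fun j ↦ by
    refine Measure.le_intro fun A hA _ ↦ ?_
    rw [← hres j, Measure.restrict_apply hA, ← hνi j _ (hA.inter (hU j)) inter_subset_right]
    exact measure_mono inter_subset_left
  refine le_antisymm ?_ ?_
  · calc (⨆ j, μ j).restrict (U i) ≤ ν.restrict (U i) :=
          Measure.restrict_mono subset_rfl (iSup_le hle)
      _ = μ i := by
          ext A hA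
          rw [Measure.restrict_apply hA, hνi i _ (hA.inter (hU i)) inter_subset_right,
            ← Measure.restrict_apply hA, hres]
  · calc μ i = (μ i).restrict (U i) := (hres i).symm
      _ ≤ _ := Measure.restrict_mono subset_rfl (le_iSup μ i)

section Volume

variable {n : ℕ} [NeZero n] {M : Type*} [TopologicalSpace M]
  [ChartedSpace (EuclideanHalfSpace n) M]

theorem measurableSet_target (x : M) : MeasurableSet (extChartAt (𝓡∂ n) x).target := by
  rw [extChartAt_target]
  exact (((chartAt (EuclideanHalfSpace n) x).open_target.preimage
    (𝓡∂ n).continuous_symm).measurableSet).inter (𝓡∂ n).isClosed_range.measurableSet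

theorem image_coordChange (x x' : M) {A : Set M} (hA : A ⊆ (extChartAt (𝓡∂ n) x).source)
    (hA' : A ⊆ (extChartAt (𝓡∂ n) x').source) :
    (extChartAt (𝓡∂ n) x' ∘ (extChartAt (𝓡∂ n) x).symm) ''
      ((extChartAt (𝓡∂ n) x).target ∩ (extChartAt (𝓡∂ n) x).symm ⁻¹' A) =
      (extChartAt (𝓡∂ n) x').target ∩ (extChartAt (𝓡∂ n) x').symm ⁻¹' A := by
  ext z
  constructor
  · rintro ⟨y, ⟨hy, hyA⟩, rfl⟩
    refine ⟨(extChartAt (𝓡∂ n) x').map_source (hA' hyA), ?_⟩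
    rw [mem_preimage, Function.comp_apply, (extChartAt (𝓡∂ n) x').left_inv (hA' hyA)]
    exact hyA
  · rintro ⟨hz, hzA⟩
    refine ⟨extChartAt (𝓡∂ n) x ((extChartAt (𝓡∂ n) x').symm z),
      ⟨(extChartAt (𝓡∂ n) x).map_source (hA hzA), ?_⟩, ?_⟩
    · rw [mem_preimage, (extChartAt (𝓡∂ n) x).left_inv (hA hzA)]
      exact hzA
    · rw [Function.comp_apply, (extChartAt (𝓡∂ n) x).left_inv (hA hzA),
        (extChartAt (𝓡∂ n) x').right_inv hz]

theorem measurableSet_target_inter_preimage [MeasurableSpace M] [BorelSpace M] (x : M) {A : Set M}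
    (hA : MeasurableSet A) :
    MeasurableSet ((extChartAt (𝓡∂ n) x).target ∩ (extChartAt (𝓡∂ n) x).symm ⁻¹' A) := by
  have h := (continuousOn_iff_continuous_domRestrict.1
    (continuousOn_extChartAt_symm (I := 𝓡∂ n) x)).measurable hA
  have h2 := (measurableSet_target (n := n) x).subtype_image h
  convert h2 using 1
  ext y
  simp [and_comm]

variable [IsManifold (𝓡∂ n) ∞ M] {k : ℕ∞}

theorem continuousOn_sqrt_det_gram (g : Metric n M k) (x : M) :
    ContinuousOn (fun y ↦ √(gram g x y).det) (extChartAt (𝓡∂ n) x).target := by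
  refine ContinuousOn.sqrt ?_
  simp only [Matrix.det_apply']
  exact continuousOn_finsetSum _ fun σ _ ↦ continuousOn_const.mul
    (continuousOn_finsetProd _ fun i _ ↦ (contDiffOn_gram g x _ _).continuousOn)

theorem det_tangentCoordChange (x x' q : M) :
    (tangentCoordChange (𝓡∂ n) x x' q).det = (transition (n := n) x x' q).det := by
  rw [ContinuousLinearMap.det, ← LinearMap.det_toMatrix (EuclideanSpace.basisFun (Fin n) ℝ).toBasis]
  congr 1

theorem sqrt_det_gramIn_eq (g : Metric n M k) {x x' q : M}
    (hq : q ∈ (extChartAt (𝓡∂ n) x).source) (hq' : q ∈ (extChartAt (𝓡∂ n) x').source) :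
    √(gramIn g x q).det = |(transition (n := n) x x' q).det| * √(gramIn g x' q).det := by
  rw [gramIn_eq_transition g hq hq', Matrix.det_mul, Matrix.det_mul, Matrix.det_transpose,
    mul_right_comm, Real.sqrt_mul (mul_self_nonneg _), Real.sqrt_mul_self_eq_abs]

variable [MeasurableSpace M] [BorelSpace M]

theorem aemeasurable_symm (g : Metric n M k) (x : M) : AEMeasurable (extChartAt (𝓡∂ n) x).symm
    ((volume.restrict (extChartAt (𝓡∂ n) x).target).withDensity
      (fun y ↦ ENNReal.ofReal √(gram g x y).det)) :=
  ((continuousOn_extChartAt_symm x).aemeasurable (measurableSet_target x)).mono_ac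
    (withDensity_absolutelyContinuous _ _)

theorem chartVolume_apply (g : Metric n M k) (x : M) {A : Set M} (hA : MeasurableSet A) :
    chartVolume g x A =
      ∫⁻ y in (extChartAt (𝓡∂ n) x).target ∩ (extChartAt (𝓡∂ n) x).symm ⁻¹' A,
        ENNReal.ofReal √(gram g x y).det := by
  rw [chartVolume, Measure.map_apply_of_aemeasurable (aemeasurable_symm g x) hA,
    withDensity_apply', Measure.restrict_restrict' (measurableSet_target x), inter_comm]

/-- The Riemannian measures of two charts agree on the overlap of their domains. -/
theorem chartVolume_congr (g : Metric n M k) (x x' : M) {A : Set M} (hAm : MeasurableSet A)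
    (hA : A ⊆ (extChartAt (𝓡∂ n) x).source) (hA' : A ⊆ (extChartAt (𝓡∂ n) x').source) :
    chartVolume g x A = chartVolume g x' A := by
  rw [chartVolume_apply g x hAm, chartVolume_apply g x' hAm, ← image_coordChange x x' hA hA']
  have hmaps : ∀ y ∈ (extChartAt (𝓡∂ n) x).target ∩ (extChartAt (𝓡∂ n) x).symm ⁻¹' A,
      extChartAt (𝓡∂ n) x ((extChartAt (𝓡∂ n) x).symm y) = y :=
    fun y hy ↦ (extChartAt (𝓡∂ n) x).right_inv hy.1
  rw [lintegral_image_eq_lintegral_abs_det_fderiv_mul volume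
    (measurableSet_target_inter_preimage x hAm)
    (f' := fun y ↦ tangentCoordChange (𝓡∂ n) x x' ((extChartAt (𝓡∂ n) x).symm y))]
  · refine setLIntegral_congr_fun (measurableSet_target_inter_preimage x hAm) fun y hy ↦ ?_
    rw [det_tangentCoordChange, ← ENNReal.ofReal_mul (abs_nonneg _), Function.comp_apply,
      gram_eq_gramIn, gram_eq_gramIn, (extChartAt (𝓡∂ n) x').left_inv (hA' hy.2),
      sqrt_det_gramIn_eq g (hA hy.2) (hA' hy.2)]
  · intro y hy
    have := hasFDerivWithinAt_tangentCoordChange (I := 𝓡∂ n) (x := x) (y := x')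
      (z := (extChartAt (𝓡∂ n) x).symm y) ⟨hA hy.2, hA' hy.2⟩
    rw [hmaps y hy] at this
    exact this.mono (inter_subset_left.trans (extChartAt_target_subset_range x))
  · intro y hy z hz hyz
    have h := (extChartAt (𝓡∂ n) x').injOn (hA' hy.2) (hA' hz.2) hyz
    rw [← hmaps y hy, ← hmaps z hz, h]

theorem chartVolume_compl_source (g : Metric n M k) (x : M) :
    chartVolume g x (extChartAt (𝓡∂ n) x).sourceᶜ = 0 := by
  rw [chartVolume_apply g x (isOpen_extChartAt_source x).measurableSet.compl]
  have : (extChartAt (𝓡∂ n) x).target ∩ (extChartAt (𝓡∂ n) x).symm ⁻¹'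
      (extChartAt (𝓡∂ n) x).sourceᶜ = ∅ :=
    eq_empty_of_forall_notMem fun y hy ↦ hy.2 ((extChartAt (𝓡∂ n) x).map_target hy.1)
  rw [this]
  simp

variable [CompactSpace M]

/-- In the domain of a chart the Riemannian measure is given by the density `√(det g)`. -/
theorem restrict_riemannianVolume (g : Metric n M k) (x : M) :
    (riemannianVolume g).restrict (extChartAt (𝓡∂ n) x).source = chartVolume g x := by
  obtain ⟨t, ht⟩ := CompactSpace.elim_nhds_subcover (fun x : M ↦ (extChartAt (𝓡∂ n) x).source)
    (fun x : M ↦ extChartAt_source_mem_nhds (I := 𝓡∂ n) x)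
  have htne : t.Nonempty := by
    by_contra! h
    have : x ∈ ⋃ z ∈ t, (extChartAt (𝓡∂ n) z).source := ht ▸ mem_univ x
    simp [h] at this
  obtain ⟨s, hs⟩ := t.countable_toSet.exists_eq_range htne
  refine restrict_iSup_eq_of_compatible
    (fun x ↦ (isOpen_extChartAt_source (I := 𝓡∂ n) x).measurableSet)
    (chartVolume_compl_source g) (fun x x' A hA h h' ↦ chartVolume_congr g x x' hA h h') s ?_ x
  refine eq_univ_of_forall fun z ↦ ?_
  have hz' : z ∈ ⋃ x ∈ t, (extChartAt (𝓡∂ n) x).source := by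
    rw [ht]
    trivial
  obtain ⟨a, ha, hz⟩ := mem_iUnion₂.1 hz'
  obtain ⟨m, rfl⟩ : a ∈ range s := hs ▸ ha
  exact mem_iUnion.2 ⟨m, hz⟩

theorem isFiniteMeasure_riemannianVolume [T2Space M] (g : Metric n M k) :
    IsFiniteMeasure (riemannianVolume g) := by
  refine ⟨isCompact_univ.measure_lt_top_of_nhdsWithin fun p _ ↦ ?_⟩
  rw [nhdsWithin_univ]
  obtain ⟨W, hWp, hWs, hWc⟩ := local_compact_nhds (extChartAt_source_mem_nhds (I := 𝓡∂ n) p)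
  refine ⟨W, hWp, ?_⟩
  rw [← inter_eq_self_of_subset_left hWs, ← Measure.restrict_apply hWc.measurableSet,
    restrict_riemannianVolume, chartVolume_apply g p hWc.measurableSet]
  have himg : (extChartAt (𝓡∂ n) p).target ∩ (extChartAt (𝓡∂ n) p).symm ⁻¹' W
      = extChartAt (𝓡∂ n) p '' W := by
    rw [PartialEquiv.image_eq_target_inter_inv_preimage _ hWs]
  rw [himg]
  have hcomp : IsCompact (extChartAt (𝓡∂ n) p '' W) :=
    hWc.image_of_continuousOn ((continuousOn_extChartAt p).mono hWs)
  have hsub : extChartAt (𝓡∂ n) p '' W ⊆ (extChartAt (𝓡∂ n) p).target := by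
    rw [← himg]
    exact inter_subset_left
  exact (((continuousOn_sqrt_det_gram g p).mono hsub).integrableOn_compact hcomp).lintegral_lt_top

/-- Integrals of functions supported in the domain of a chart, in coordinates. -/
theorem integral_riemannianVolume_of_support (g : Metric n M k) (x : M) {f : M → ℝ}
    (hf : AEStronglyMeasurable f (riemannianVolume g))
    (hsupp : ∀ p ∉ (extChartAt (𝓡∂ n) x).source, f p = 0) :
    ∫ p, f p ∂(riemannianVolume g) = ∫ y in (extChartAt (𝓡∂ n) x).target,
      √(gram g x y).det * f ((extChartAt (𝓡∂ n) x).symm y) := by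
  rw [← setIntegral_eq_integral_of_forall_compl_eq_zero hsupp, restrict_riemannianVolume,
    chartVolume, integral_map (aemeasurable_symm g x)]
  · rw [integral_withDensity_eq_integral_toReal_smul₀]
    · refine integral_congr_ae (Eventually.of_forall fun y ↦ ?_)
      simp only
      rw [ENNReal.toReal_ofReal (Real.sqrt_nonneg _), smul_eq_mul]
    · exact ((continuousOn_sqrt_det_gram g x).aemeasurable (measurableSet_target x)).ennreal_ofReal
    · exact Eventually.of_forall fun y ↦ ENNReal.ofReal_lt_top
  · have := hf.mono_measure (Measure.restrict_le_self (s := (extChartAt (𝓡∂ n) x).source))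
    rwa [restrict_riemannianVolume] at this

end Volume

/-! ### Gradients and Green's formula -/

section Invariants

variable {ι : Type*} [Fintype ι] [DecidableEq ι]

theorem inv_congr_mulVec {T G : Matrix ι ι ℝ} (hT : IsUnit T) (b : ι → ℝ) :
    (T.transpose * G * T)⁻¹.mulVec (T.transpose.mulVec b) = T⁻¹.mulVec (G⁻¹.mulVec b) := by
  have hu := (Matrix.isUnit_iff_isUnit_det _).1 hT
  have h : (T⁻¹).transpose * T.transpose = 1 := by
    rw [← Matrix.transpose_mul, Matrix.mul_nonsing_inv _ hu, Matrix.transpose_one]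
  rw [Matrix.mul_inv_rev, Matrix.mul_inv_rev, Matrix.mulVec_mulVec, Matrix.mulVec_mulVec,
    ← Matrix.transpose_nonsing_inv, mul_assoc, mul_assoc, h, mul_one]

theorem dotProduct_inv_congr {T G : Matrix ι ι ℝ} (hT : IsUnit T) (a b : ι → ℝ) :
    T.transpose.mulVec a ⬝ᵥ (T.transpose * G * T)⁻¹.mulVec (T.transpose.mulVec b)
      = a ⬝ᵥ G⁻¹.mulVec b := by
  have hu := (Matrix.isUnit_iff_isUnit_det _).1 hT
  rw [inv_congr_mulVec hT, Matrix.mulVec_transpose, ← Matrix.dotProduct_mulVec,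
    Matrix.mulVec_mulVec, Matrix.mul_nonsing_inv _ hu, Matrix.one_mulVec]

theorem continuousOn_det {X : Type*} [TopologicalSpace X] {A : X → Matrix ι ι ℝ} {s : Set X}
    (hA : ∀ a b, ContinuousOn (fun z ↦ A z a b) s) : ContinuousOn (fun z ↦ (A z).det) s := by
  simp only [Matrix.det_apply']
  exact continuousOn_finsetSum _ fun σ _ ↦ continuousOn_const.mul
    (continuousOn_finsetProd _ fun i _ ↦ hA _ _)

theorem continuousOn_inv_entry {X : Type*} [TopologicalSpace X] {A : X → Matrix ι ι ℝ} {s : Set X}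
    (hA : ∀ a b, ContinuousOn (fun z ↦ A z a b) s) (hs : ∀ z ∈ s, (A z).det ≠ 0) (a b : ι) :
    ContinuousOn (fun z ↦ (A z)⁻¹ a b) s := by
  simp only [Matrix.inv_def, Matrix.smul_apply, Ring.inverse_eq_inv', smul_eq_mul,
    Matrix.adjugate_apply]
  refine ((continuousOn_det hA).inv₀ hs).mul (continuousOn_det fun c d ↦ ?_)
  by_cases hc : c = b
  · subst hc
    simp [continuousOn_const]
  · simpa [Matrix.updateRow_ne hc] using hA c d

end Invariants

theorem continuousOn_mulVec_entry {ι X : Type*} [Fintype ι] [TopologicalSpace X]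
    {A : X → Matrix ι ι ℝ} {v : X → ι → ℝ} {s : Set X}
    (hA : ∀ a b, ContinuousOn (fun z ↦ A z a b) s)
    (hv : ∀ a, ContinuousOn (fun z ↦ v z a) s) (a : ι) :
    ContinuousOn (fun z ↦ (A z).mulVec (v z) a) s :=
  continuousOn_finsetSum _ fun b _ ↦ (hA a b).mul (hv b)

section Gradient

variable {n : ℕ} [NeZero n] {M : Type*} [TopologicalSpace M]
  [ChartedSpace (EuclideanHalfSpace n) M] {k r : ℕ∞}

theorem mdifferentiableAt_of_one_le {f : M → ℝ} (hr : 1 ≤ r)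
    (hf : ContMDiff (𝓡∂ n) 𝓘(ℝ, ℝ) r f) (q : M) : MDifferentiableAt (𝓡∂ n) 𝓘(ℝ, ℝ) f q :=
  hf.mdifferentiable (coe_ne_zero_of_one_le hr) q

theorem continuous_of_continuousOn_source {f : M → ℝ}
    (h : ∀ x, ContinuousOn f (extChartAt (𝓡∂ n) x).source) : Continuous f :=
  continuous_iff_continuousAt.2 fun x ↦
    (h x).continuousAt (extChartAt_source_mem_nhds (I := 𝓡∂ n) x)

variable [IsManifold (𝓡∂ n) ∞ M]

/-- The inner product `⟨df, dh⟩` of differentials with respect to the metric `g`. -/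
noncomputable def gradInner (g : Metric n M k) (f h : M → ℝ) (p : M) : ℝ :=
  diffIn f p p ⬝ᵥ (gramAt g p)⁻¹.mulVec (diffIn (n := n) h p p)

theorem gradInner_comm (g : Metric n M k) (f h : M → ℝ) (p : M) :
    gradInner g f h p = gradInner g h f p := by
  have hsymm : (gramAt g p).transpose = gramAt g p := by
    ext i j
    exact g.symm _ _ _
  rw [gradInner, gradInner, Matrix.dotProduct_mulVec, dotProduct_comm,
    ← Matrix.mulVec_transpose, Matrix.transpose_nonsing_inv, hsymm]

theorem gradInner_eq_in_chart (g : Metric n M k) (f h : M → ℝ) {x q : M}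
    (hq : q ∈ (extChartAt (𝓡∂ n) x).source) :
    gradInner g f h q = diffIn f x q ⬝ᵥ (gramIn g x q)⁻¹.mulVec (diffIn h x q) := by
  have hqq := mem_extChartAt_source (I := 𝓡∂ n) q
  rw [gramIn_eq_transition g hq hqq, diffIn_eq_transition f hq hqq,
    diffIn_eq_transition h hq hqq, dotProduct_inv_congr (isUnit_transition hq hqq)]
  rfl

theorem continuousOn_gramIn (g : Metric n M k) (x : M) (i j : Fin n) :
    ContinuousOn (fun q ↦ gramIn g x q i j) (extChartAt (𝓡∂ n) x).source :=
  (contMDiffOn_gramIn g x i j).continuousOn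

theorem continuousOn_inv_gramIn (g : Metric n M k) (x : M) (i j : Fin n) :
    ContinuousOn (fun q ↦ (gramIn g x q)⁻¹ i j) (extChartAt (𝓡∂ n) x).source :=
  continuousOn_inv_entry (continuousOn_gramIn g x) (fun _ hq ↦ (gramIn_posDef g hq).det_pos.ne') i j

theorem continuousOn_partialD {f : M → ℝ} (hr : 1 ≤ r) (hf : ContMDiff (𝓡∂ n) 𝓘(ℝ, ℝ) r f)
    (x : M) (i : Fin n) :
    ContinuousOn (partialD i (f ∘ (extChartAt (𝓡∂ n) x).symm)) (extChartAt (𝓡∂ n) x).target := by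
  intro y hy
  have hr' : (1 : WithTop ℕ∞) ≤ r := WithTop.coe_le_coe.2 hr
  have h1 : ContDiffWithinAt ℝ 1 (f ∘ (extChartAt (𝓡∂ n) x).symm) (range (𝓡∂ n)) y :=
    ((contDiffOn_comp_symm hf x y hy).of_le hr').mono_of_mem_nhdsWithin
      (extChartAt_target_mem_nhdsWithin_of_mem hy)
  have h2 := (h1.fderivWithin_right (m := 0) (𝓡∂ n).uniqueDiffOn (by simp)
    (extChartAt_target_subset_range x hy)).continuousWithinAt
  exact (h2.clm_apply continuousWithinAt_const).mono (extChartAt_target_subset_range x)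

theorem continuousOn_diffIn {f : M → ℝ} (hr : 1 ≤ r) (hf : ContMDiff (𝓡∂ n) 𝓘(ℝ, ℝ) r f)
    (x : M) (i : Fin n) :
    ContinuousOn (fun q ↦ diffIn f x q i) (extChartAt (𝓡∂ n) x).source := by
  refine ((continuousOn_partialD hr hf x i).comp (continuousOn_extChartAt x)
    (fun q hq ↦ (extChartAt (𝓡∂ n) x).map_source hq)).congr fun q hq ↦ ?_
  exact diffIn_eq_partialD hq (mdifferentiableAt_of_one_le hr hf q) i

theorem continuous_gradInner (g : Metric n M k) {f h : M → ℝ} {r' : ℕ∞} (hr : 1 ≤ r)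
    (hr' : 1 ≤ r') (hf : ContMDiff (𝓡∂ n) 𝓘(ℝ, ℝ) r f) (hh : ContMDiff (𝓡∂ n) 𝓘(ℝ, ℝ) r' h) :
    Continuous (gradInner g f h) := by
  refine continuous_of_continuousOn_source (n := n) fun x ↦ ?_
  refine ContinuousOn.congr ?_ fun q hq ↦ gradInner_eq_in_chart g f h hq
  exact continuousOn_finsetSum _ fun i _ ↦ (continuousOn_diffIn hr hf x i).mul
    (continuousOn_mulVec_entry (continuousOn_inv_gramIn g x) (continuousOn_diffIn hr' hh x) i)

/-- The Neumann condition in an arbitrary chart: the gradient has no component transversal to the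
boundary. -/
theorem inv_gramIn_mulVec_diffIn_zero (g : Metric n M k) (f : M → ℝ) {x q : M}
    (hq : q ∈ (extChartAt (𝓡∂ n) x).source) (hb : q ∈ (𝓡∂ n).boundary M)
    (hN : normalDeriv g f q = 0) : (gramIn g x q)⁻¹.mulVec (diffIn f x q) 0 = 0 := by
  have hqq := mem_extChartAt_source (I := 𝓡∂ n) q
  have h00 : 0 < (gramAt g q)⁻¹ 0 0 := (gramAt_posDef g q).inv.diag_pos
  have hq0 : (gramAt g q)⁻¹.mulVec (diffIn f q q) 0 = 0 := by
    rw [normalDeriv, outwardNormal, map_smul, map_sum, smul_eq_mul] at hN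
    simp_rw [map_smul, smul_eq_mul] at hN
    rcases mul_eq_zero.1 hN with h | h
    · exact absurd h (neg_ne_zero.2 (inv_ne_zero (Real.sqrt_pos.2 h00).ne'))
    · exact h
  have hT := isUnit_transition (n := n) hq hqq
  have hTinv : (transition (n := n) x q q)⁻¹ = transition q x q :=
    Matrix.inv_eq_left_inv (transition_mul_transition hq hqq)
  rw [gramIn_eq_transition g hq hqq, diffIn_eq_transition f hq hqq, inv_congr_mulVec hT, hTinv]
  change ∑ j, transition q x q 0 j * (gramIn g q q)⁻¹.mulVec (diffIn f q q) j = 0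
  refine Finset.sum_eq_zero fun j _ ↦ ?_
  by_cases hj : j = 0
  · subst hj
    exact mul_eq_zero_of_right _ hq0
  · rw [transition_zero_eq_zero hqq hq hb hj, zero_mul]

theorem diffIn_eq_zero_of_notMem_tsupport {f : M → ℝ} {q : M} (hq : q ∉ tsupport f) (x : M) :
    diffIn (n := n) f x q = 0 := by
  have h : f =ᶠ[𝓝 q] fun _ ↦ 0 := notMem_tsupport_iff_eventuallyEq.1 hq
  ext i
  rw [diffIn, differential, h.mfderiv_eq, mfderiv_const]
  rfl

end Gradient

section Green

variable {n : ℕ} [NeZero n] {M : Type*} [TopologicalSpace M]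
  [ChartedSpace (EuclideanHalfSpace n) M]

/-- Extension by zero from the image of a chart to the half-space. -/
theorem continuousOn_indicator_target {x : M} {K : Set (EuclideanSpace ℝ (Fin n))}
    (hK : IsClosed K) (hKt : K ⊆ (extChartAt (𝓡∂ n) x).target)
    {φ : EuclideanSpace ℝ (Fin n) → ℝ} (hφ : ContinuousOn φ (extChartAt (𝓡∂ n) x).target)
    (h0 : ∀ y ∈ (extChartAt (𝓡∂ n) x).target, y ∉ K → φ y = 0) :
    ContinuousOn ((extChartAt (𝓡∂ n) x).target.indicator φ)
      {y : EuclideanSpace ℝ (Fin n) | 0 ≤ y 0} := by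
  have hrange : {y : EuclideanSpace ℝ (Fin n) | 0 ≤ y 0} = range (𝓡∂ n) :=
    (range_modelWithCornersEuclideanHalfSpace n).symm
  rw [hrange]
  intro y hy
  by_cases hyt : y ∈ (extChartAt (𝓡∂ n) x).target
  · have h1 : ContinuousWithinAt φ (range (𝓡∂ n)) y :=
      (hφ y hyt).mono_of_mem_nhdsWithin (extChartAt_target_mem_nhdsWithin_of_mem hyt)
    refine h1.congr_of_eventuallyEq ?_ (indicator_of_mem hyt _)
    filter_upwards [extChartAt_target_mem_nhdsWithin_of_mem hyt] with z hz
    exact indicator_of_mem hz _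
  · have hyK : y ∉ K := fun h ↦ hyt (hKt h)
    have h1 : (extChartAt (𝓡∂ n) x).target.indicator φ =ᶠ[𝓝[range (𝓡∂ n)] y] fun _ ↦ 0 := by
      filter_upwards [nhdsWithin_le_nhds (hK.isOpen_compl.mem_nhds hyK)] with z hz
      by_cases hzt : z ∈ (extChartAt (𝓡∂ n) x).target
      · rw [indicator_of_mem hzt, h0 z hzt hz]
      · exact indicator_of_notMem hzt _
    exact continuousWithinAt_const.congr_of_eventuallyEq h1 (indicator_of_notMem hyt _)

variable [IsManifold (𝓡∂ n) ∞ M] {k r r' : ℕ∞} [MeasurableSpace M] [BorelSpace M] [CompactSpace M]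

theorem integrable_of_continuous [T2Space M] (g : Metric n M k) {f : M → ℝ} (hf : Continuous f) :
    Integrable f (riemannianVolume g) := by
  have := isFiniteMeasure_riemannianVolume g
  rw [← integrableOn_univ]
  exact hf.continuousOn.integrableOn_compact isCompact_univ

/-- Green's formula against a function supported in the domain of a chart: in coordinates the
integrand is the divergence of the vector field `√(det G) w G⁻¹∇f`, which is tangent to the
boundary. -/
theorem integral_gradInner_add_of_tsupport [T2Space M] (hk : 1 ≤ k) (hr : 2 ≤ r) (hr' : 1 ≤ r')
    (g : Metric n M k) {f w L : M → ℝ} (hf : ContMDiff (𝓡∂ n) 𝓘(ℝ, ℝ) r f)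
    (hw : ContMDiff (𝓡∂ n) 𝓘(ℝ, ℝ) r' w) (hL : Continuous L)
    (hfL : ∀ p, laplacian g f p = L p)
    (hN : ∀ p ∈ (𝓡∂ n).boundary M, normalDeriv g f p = 0) (x : M)
    (hwx : tsupport w ⊆ (extChartAt (𝓡∂ n) x).source) :
    ∫ p, (gradInner g f w p + L p * w p) ∂(riemannianVolume g) = 0 := by
  have hr1 : 1 ≤ r := le_trans one_le_two hr
  set T := (extChartAt (𝓡∂ n) x).target with hT
  set e := extChartAt (𝓡∂ n) x with he
  set K := e '' tsupport w with hKdef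
  have hKc : IsCompact K :=
    (isClosed_tsupport w).isCompact.image_of_continuousOn ((continuousOn_extChartAt x).mono hwx)
  have hKT : K ⊆ T := by
    rintro _ ⟨q, hq, rfl⟩
    exact e.map_source (hwx hq)
  have hsymmK : ∀ y ∈ T, y ∉ K → e.symm y ∉ tsupport w := fun y hy hyK h ↦
    hyK ⟨_, h, e.right_inv hy⟩
  have hcont : Continuous fun p ↦ gradInner g f w p + L p * w p :=
    (continuous_gradInner g hr1 hr' hf hw).add (hL.mul hw.continuous)
  have hzero : ∀ p ∉ tsupport w, gradInner g f w p + L p * w p = 0 := fun p hp ↦ by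
    rw [gradInner, diffIn_eq_zero_of_notMem_tsupport hp, image_eq_zero_of_notMem_tsupport hp]
    simp
  rw [integral_riemannianVolume_of_support g x hcont.aestronglyMeasurable
    fun p hp ↦ hzero p fun h ↦ hp (hwx h)]
  set D := T.indicator fun y ↦ √(gram g x y).det *
    (gradInner g f w (e.symm y) + L (e.symm y) * w (e.symm y)) with hD
  set φ : Fin n → EuclideanSpace ℝ (Fin n) → ℝ := fun i y ↦ √(gram g x y).det *
    ((gram g x y)⁻¹.mulVec (diffIn f x (e.symm y))) i * w (e.symm y) with hφ
  have hmaps : MapsTo e.symm T e.source := fun y hy ↦ e.map_target hy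
  have hesymm : ContinuousOn e.symm T := continuousOn_extChartAt_symm x
  have hφc : ∀ i, ContinuousOn (φ i) T := fun i ↦
    ((continuousOn_sqrt_det_gram g x).mul
      ((continuousOn_mulVec_entry (continuousOn_inv_gramIn g x)
        (continuousOn_diffIn hr1 hf x) i).comp hesymm hmaps)).mul
      (hw.continuous.comp_continuousOn hesymm)
  have hφ0 : ∀ i, ∀ y ∈ T, y ∉ K → φ i y = 0 := fun i y hy hyK ↦
    mul_eq_zero_of_right _ (image_eq_zero_of_notMem_tsupport (hsymmK y hy hyK))
  have hD0 : ∀ y ∈ T, y ∉ K → √(gram g x y).det *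
      (gradInner g f w (e.symm y) + L (e.symm y) * w (e.symm y)) = 0 := fun y hy hyK ↦
    mul_eq_zero_of_right _ (hzero _ (hsymmK y hy hyK))
  have hTH : T ⊆ {y : EuclideanSpace ℝ (Fin n) | 0 ≤ y 0} := fun y hy ↦
    mem_range_iff_nonneg.1 (extChartAt_target_subset_range x hy)
  have hind : ∫ y in T, √(gram g x y).det *
      (gradInner g f w (e.symm y) + L (e.symm y) * w (e.symm y))
      = ∫ y in {y : EuclideanSpace ℝ (Fin n) | 0 ≤ y 0}, D y := by
    rw [hD, setIntegral_indicator (measurableSet_target x), inter_eq_self_of_subset_right hTH]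
  rw [hind]
  have hnotT : ∀ y ∉ T, ∀ i, T.indicator (φ i) =ᶠ[𝓝 y] fun _ ↦ 0 := fun y hy i ↦ by
    filter_upwards [hKc.isClosed.isOpen_compl.mem_nhds fun h ↦ hy (hKT h)] with z hz
    by_cases hzT : z ∈ T
    · rw [indicator_of_mem hzT, hφ0 i z hzT hz]
    · exact indicator_of_notMem hzT _
  -- at interior points of the chart the field is the flux of the divergence form
  have hflux : ∀ y ∈ T, 0 < y 0 → ∀ i, T.indicator (φ i) =ᶠ[𝓝 y] fun z ↦ √(gram g x z).det *
      ((gram g x z)⁻¹.mulVec (coordGrad (f ∘ e.symm) z)) i * (w ∘ e.symm) z := fun y hy h0 i ↦ by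
    filter_upwards [target_mem_nhds hy h0, eventually_pos h0] with z hz hz0
    rw [indicator_of_mem hz]
    have : diffIn f x (e.symm z) = coordGrad (f ∘ e.symm) z := by
      ext j
      rw [diffIn_eq_partialD (e.map_target hz) (mdifferentiableAt_of_one_le hr1 hf _),
        e.right_inv hz, partialD_eq_coordGrad hz0]
    simp only [hφ, this, Function.comp_apply]
  have hmain : ∀ y ∈ T, 0 < y 0 → _ := fun y hy h0 ↦ sum_fderiv_flux (G := gram g x)
    (u := f ∘ e.symm) (W := w ∘ e.symm) (y := y)
    (fun a b ↦ (contDiffAt_gram g hy h0 a b).differentiableAt (coe_ne_zero_of_one_le hk))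
    (gramIn_posDef g (e.map_target hy)).det_pos
    ((contDiffAt_comp_symm hf hy h0).of_le (two_le_coe hr))
    ((contDiffAt_comp_symm hw hy h0).differentiableAt (coe_ne_zero_of_one_le hr'))
  refine setIntegral_halfSpace_divergence_eq_zero (X := fun i ↦ T.indicator (φ i)) hKc
    (fun i ↦ continuousOn_indicator_target hKc.isClosed hKT (hφc i) (hφ0 i))
    (continuousOn_indicator_target hKc.isClosed hKT
      ((continuousOn_sqrt_det_gram g x).mul (hcont.comp_continuousOn hesymm)) hD0)
    ?_ ?_ ?_ ?_ ?_
  · intro i y hy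
    by_cases hyT : y ∈ T
    · rw [indicator_of_mem hyT, hφ0 i y hyT hy]
    · exact indicator_of_notMem hyT _
  · intro y hy
    by_cases hyT : y ∈ T
    · rw [hD, indicator_of_mem hyT, hD0 y hyT hy]
    · exact indicator_of_notMem hyT _
  · intro y hy
    by_cases hyT : y ∈ T
    · have hb : e.symm y ∈ (𝓡∂ n).boundary M := by
        rw [mem_boundary_iff_eq_zero (e.map_target hyT)]
        rwa [e.right_inv hyT]
      rw [indicator_of_mem hyT]
      simp only [hφ]
      rw [gram_eq_gramIn, inv_gramIn_mulVec_diffIn_zero g f (e.map_target hyT) hb (hN _ hb)]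
      simp
    · exact indicator_of_notMem hyT _
  · intro y h0 i
    by_cases hyT : y ∈ T
    · exact (hflux y hyT h0 i).differentiableAt_iff.2 ((hmain y hyT h0).1 i)
    · exact (hnotT y hyT i).differentiableAt_iff.2 (differentiableAt_const _)
  · intro y h0
    by_cases hyT : y ∈ T
    · have h1 : ∀ i, fderiv ℝ (T.indicator (φ i)) y (stdVec i) = fderiv ℝ (fun z ↦
          √(gram g x z).det * ((gram g x z)⁻¹.mulVec (coordGrad (f ∘ e.symm) z)) i
            * (w ∘ e.symm) z) y (stdVec i) := fun i ↦ by
        rw [(hflux y hyT h0 i).fderiv_eq]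
      simp_rw [h1]
      rw [(hmain y hyT h0).2, hD, indicator_of_mem hyT,
        coordLaplacian_eq_laplacian hk hr g hf hyT h0,
        hfL]
      have hfy : coordGrad (f ∘ e.symm) y = diffIn f x (e.symm y) := by
        ext j
        rw [diffIn_eq_partialD (e.map_target hyT) (mdifferentiableAt_of_one_le hr1 hf _),
          e.right_inv hyT, partialD_eq_coordGrad h0]
      have hwy : coordGrad (w ∘ e.symm) y = diffIn w x (e.symm y) := by
        ext j
        rw [diffIn_eq_partialD (e.map_target hyT) (mdifferentiableAt_of_one_le hr' hw _),
          e.right_inv hyT, partialD_eq_coordGrad h0]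
      rw [hfy, hwy, gradInner_comm g f w, gradInner_eq_in_chart g w f (e.map_target hyT),
        gram_eq_gramIn,
        Function.comp_apply, dotProduct]
      ring
    · have h1 : ∀ i, fderiv ℝ (T.indicator (φ i)) y (stdVec i) = 0 := fun i ↦ by
        rw [(hnotT y hyT i).fderiv_eq]
        simp
      simp_rw [h1]
      rw [hD, indicator_of_notMem hyT]
      simp

end Green

/-! ### From charts to the manifold -/

section Linearity

variable {n : ℕ} [NeZero n] {M : Type*} [TopologicalSpace M]
  [ChartedSpace (EuclideanHalfSpace n) M] [IsManifold (𝓡∂ n) ∞ M]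

theorem diffIn_add {f h : M → ℝ} {q : M} (hf : MDifferentiableAt (𝓡∂ n) 𝓘(ℝ, ℝ) f q)
    (hh : MDifferentiableAt (𝓡∂ n) 𝓘(ℝ, ℝ) h q) (x : M) :
    diffIn (n := n) (fun p ↦ f p + h p) x q = diffIn f x q + diffIn h x q := by
  ext i
  change mfderiv (𝓡∂ n) 𝓘(ℝ, ℝ) (f + h) q (coordVec x q i) = _
  rw [mfderiv_add hf hh]
  rfl

theorem diffIn_sub {f h : M → ℝ} {q : M} (hf : MDifferentiableAt (𝓡∂ n) 𝓘(ℝ, ℝ) f q)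
    (hh : MDifferentiableAt (𝓡∂ n) 𝓘(ℝ, ℝ) h q) (x : M) :
    diffIn (n := n) (fun p ↦ f p - h p) x q = diffIn f x q - diffIn h x q := by
  ext i
  change mfderiv (𝓡∂ n) 𝓘(ℝ, ℝ) (f - h) q (coordVec x q i) = _
  rw [(hf.hasMFDerivAt.sub hh.hasMFDerivAt).mfderiv]
  rfl

theorem diffIn_sum {κ : Type*} (s : Finset κ) {f : κ → M → ℝ} {q : M}
    (hf : ∀ a, MDifferentiableAt (𝓡∂ n) 𝓘(ℝ, ℝ) (f a) q) (x : M) :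
    MDifferentiableAt (𝓡∂ n) 𝓘(ℝ, ℝ) (fun p ↦ ∑ a ∈ s, f a p) q ∧
      diffIn (n := n) (fun p ↦ ∑ a ∈ s, f a p) x q = ∑ a ∈ s, diffIn (f a) x q := by
  classical
  induction s using Finset.induction_on with
  | empty =>
    simp only [Finset.sum_empty]
    refine ⟨mdifferentiableAt_const, ?_⟩
    ext i
    rw [diffIn, differential, mfderiv_const]
    rfl
  | insert a s ha ih =>
    simp only [Finset.sum_insert ha]
    exact ⟨(hf a).add ih.1, by rw [diffIn_add (hf a) ih.1, ih.2]⟩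

variable {k : ℕ∞}

theorem gradInner_sub_left (g : Metric n M k) {f f' : M → ℝ} (h : M → ℝ) {q : M}
    (hf : MDifferentiableAt (𝓡∂ n) 𝓘(ℝ, ℝ) f q) (hf' : MDifferentiableAt (𝓡∂ n) 𝓘(ℝ, ℝ) f' q) :
    gradInner g (fun p ↦ f p - f' p) h q = gradInner g f h q - gradInner g f' h q := by
  rw [gradInner, diffIn_sub hf hf', sub_dotProduct]
  rfl

theorem gradInner_sub_right (g : Metric n M k) {f f' : M → ℝ} (h : M → ℝ) {q : M}
    (hf : MDifferentiableAt (𝓡∂ n) 𝓘(ℝ, ℝ) f q) (hf' : MDifferentiableAt (𝓡∂ n) 𝓘(ℝ, ℝ) f' q) :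
    gradInner g h (fun p ↦ f p - f' p) q = gradInner g h f q - gradInner g h f' q := by
  rw [gradInner_comm, gradInner_sub_left g h hf hf', gradInner_comm g f, gradInner_comm g f']

theorem gradInner_sum_right (g : Metric n M k) {κ : Type*} (s : Finset κ) {f : κ → M → ℝ}
    (h : M → ℝ) {q : M} (hf : ∀ a, MDifferentiableAt (𝓡∂ n) 𝓘(ℝ, ℝ) (f a) q) :
    gradInner g h (fun p ↦ ∑ a ∈ s, f a p) q = ∑ a ∈ s, gradInner g h (f a) q := by
  rw [gradInner, (diffIn_sum s hf q).2, Matrix.mulVec_sum, dotProduct_sum]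
  rfl

end Linearity

section Density

variable {n : ℕ} [NeZero n] {M : Type*} [TopologicalSpace M]
  [ChartedSpace (EuclideanHalfSpace n) M] [IsManifold (𝓡∂ n) ∞ M] {k : ℕ∞}

/-- The density of the Riemannian measure of `g` with respect to the one of `g₀`. Computed in the
chart centred at `p`, but the quotient is the same in every chart. -/
noncomputable def volumeRatio (g₀ g : Metric n M k) (p : M) : ℝ :=
  √(gramAt g p).det / √(gramAt g₀ p).det

theorem volumeRatio_eq_in_chart (g₀ g : Metric n M k) {x q : M}
    (hq : q ∈ (extChartAt (𝓡∂ n) x).source) :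
    volumeRatio g₀ g q = √(gramIn g x q).det / √(gramIn g₀ x q).det := by
  have hqq := mem_extChartAt_source (I := 𝓡∂ n) q
  have hu := (Matrix.isUnit_iff_isUnit_det _).1 (isUnit_transition (n := n) hq hqq)
  rw [sqrt_det_gramIn_eq g hq hqq, sqrt_det_gramIn_eq g₀ hq hqq,
    mul_div_mul_left _ _ (abs_ne_zero.2 hu.ne_zero)]
  rfl

theorem continuous_volumeRatio (g₀ g : Metric n M k) : Continuous (volumeRatio g₀ g) := by
  refine continuous_of_continuousOn_source (n := n) fun x ↦ ?_
  refine ContinuousOn.congr ?_ fun q hq ↦ volumeRatio_eq_in_chart g₀ g hq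
  exact (continuousOn_det (continuousOn_gramIn g x)).sqrt.div
    (continuousOn_det (continuousOn_gramIn g₀ x)).sqrt
    fun q hq ↦ (Real.sqrt_pos.2 (gramIn_posDef g₀ hq).det_pos).ne'

end Density

section Global

variable {n : ℕ} [NeZero n] {M : Type*} [TopologicalSpace M]
  [ChartedSpace (EuclideanHalfSpace n) M] [IsManifold (𝓡∂ n) ∞ M] [CompactSpace M] [T2Space M]

variable (n M) in
/-- A compact manifold has a finite smooth partition of unity subordinate to chart domains. -/
theorem exists_finite_partition : ∃ (t : Finset M) (χ : t → M → ℝ),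
    (∀ a, ContMDiff (𝓡∂ n) 𝓘(ℝ, ℝ) ∞ (χ a)) ∧
    (∀ a, tsupport (χ a) ⊆ (extChartAt (𝓡∂ n) (a : M)).source) ∧ ∀ p, ∑ a, χ a p = 1 := by
  obtain ⟨t, ht⟩ := CompactSpace.elim_nhds_subcover (fun x : M ↦ (extChartAt (𝓡∂ n) x).source)
    (fun x : M ↦ extChartAt_source_mem_nhds (I := 𝓡∂ n) x)
  obtain ⟨χ, hχ⟩ := SmoothPartitionOfUnity.exists_isSubordinate (𝓡∂ n) isClosed_univ
    (fun a : t ↦ (extChartAt (𝓡∂ n) (a : M)).source)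
    (fun a ↦ isOpen_extChartAt_source _) (by
      rw [← top_eq_univ, ← ht]
      exact iUnion₂_subset fun a ha ↦ subset_iUnion_of_subset ⟨a, ha⟩ subset_rfl)
  refine ⟨t, fun a ↦ χ a, fun a ↦ (χ a).contMDiff, hχ, fun p ↦ ?_⟩
  rw [← finsum_eq_sum_of_fintype]
  exact χ.sum_eq_one (mem_univ p)

variable {k r r' : ℕ∞} [MeasurableSpace M] [BorelSpace M]

/-- Green's formula for a function with vanishing normal derivative. -/
theorem integral_gradInner (hk : 1 ≤ k) (hr : 2 ≤ r) (hr' : 1 ≤ r')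
    (g : Metric n M k) {f w L : M → ℝ} (hf : ContMDiff (𝓡∂ n) 𝓘(ℝ, ℝ) r f)
    (hw : ContMDiff (𝓡∂ n) 𝓘(ℝ, ℝ) r' w) (hL : Continuous L)
    (hfL : ∀ p, laplacian g f p = L p)
    (hN : ∀ p ∈ (𝓡∂ n).boundary M, normalDeriv g f p = 0) :
    ∫ p, gradInner g f w p ∂(riemannianVolume g) = -∫ p, L p * w p ∂(riemannianVolume g) := by
  obtain ⟨t, χ, hχ, hsupp, hsum⟩ := exists_finite_partition n M
  have hr1 : 1 ≤ r := le_trans one_le_two hr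
  have hprod : ∀ a, ContMDiff (𝓡∂ n) 𝓘(ℝ, ℝ) r' (fun p ↦ χ a p * w p) := fun a ↦
    ((hχ a).of_le (by exact_mod_cast le_top)).mul hw
  have hloc : ∀ a, ∫ p, (gradInner g f (fun p ↦ χ a p * w p) p + L p * (χ a p * w p))
      ∂(riemannianVolume g) = 0 := fun a ↦
    integral_gradInner_add_of_tsupport hk hr hr' g hf (hprod a) hL hfL hN a
      ((tsupport_mul_subset_left).trans (hsupp a))
  have hw' : w = fun p ↦ ∑ a, χ a p * w p := by
    ext p
    rw [← Finset.sum_mul, hsum, one_mul]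
  rw [← sub_eq_zero, sub_neg_eq_add, ← integral_add
    (integrable_of_continuous g (continuous_gradInner g hr1 hr' hf hw))
    (integrable_of_continuous g (f := fun p ↦ L p * w p) (hL.mul hw.continuous))]
  have hpt : ∀ p, gradInner g f w p + L p * w p
      = ∑ a, (gradInner g f (fun p ↦ χ a p * w p) p + L p * (χ a p * w p)) := fun p ↦ by
    rw [Finset.sum_add_distrib, ← Finset.mul_sum, ← Finset.sum_mul, hsum, one_mul,
      ← gradInner_sum_right g _ f (fun a ↦ mdifferentiableAt_of_one_le hr' (hprod a) p), ← hw']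
  simp_rw [hpt]
  rw [integral_finsetSum]
  · exact Finset.sum_eq_zero fun a _ ↦ hloc a
  · exact fun a _ ↦ integrable_of_continuous g ((continuous_gradInner g hr1 hr' hf (hprod a)).add
      (hL.mul (hprod a).continuous))

theorem integral_riemannianVolume_eq (g₀ g : Metric n M k) {f : M → ℝ} (hf : Continuous f) :
    ∫ p, f p ∂(riemannianVolume g) = ∫ p, volumeRatio g₀ g p * f p ∂(riemannianVolume g₀) := by
  obtain ⟨t, χ, hχ, hsupp, hsum⟩ := exists_finite_partition n M
  have hpt : ∀ p, f p = ∑ a, χ a p * f p := fun p ↦ by rw [← Finset.sum_mul, hsum, one_mul]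
  have hc : ∀ a, Continuous fun p ↦ χ a p * f p := fun a ↦ (hχ a).continuous.mul hf
  have hc' : ∀ a, Continuous fun p ↦ volumeRatio g₀ g p * (χ a p * f p) := fun a ↦
    (continuous_volumeRatio g₀ g).mul (hc a)
  have h0 : ∀ a : t, ∀ p ∉ (extChartAt (𝓡∂ n) (a : M)).source, χ a p = 0 := fun a p hp ↦
    image_eq_zero_of_notMem_tsupport fun h ↦ hp (hsupp a h)
  calc ∫ p, f p ∂(riemannianVolume g)
      = ∑ a, ∫ p, χ a p * f p ∂(riemannianVolume g) := by
        rw [← integral_finsetSum _ fun a _ ↦ integrable_of_continuous g (hc a)]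
        exact integral_congr_ae (Eventually.of_forall hpt)
    _ = ∑ a, ∫ p, volumeRatio g₀ g p * (χ a p * f p) ∂(riemannianVolume g₀) := by
        refine Finset.sum_congr rfl fun a _ ↦ ?_
        rw [integral_riemannianVolume_of_support g (a : M) (hc a).aestronglyMeasurable
            fun p hp ↦ by rw [h0 a p hp, zero_mul],
          integral_riemannianVolume_of_support g₀ (a : M) (hc' a).aestronglyMeasurable
            fun p hp ↦ by rw [h0 a p hp, zero_mul, mul_zero]]
        refine setIntegral_congr_fun (measurableSet_target _) fun y hy ↦ ?_
        have hy' := (extChartAt (𝓡∂ n) (a : M)).map_target hy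
        have hne : √(gram g₀ a y).det ≠ 0 := (Real.sqrt_pos.2 (gramIn_posDef g₀ hy').det_pos).ne'
        rw [volumeRatio_eq_in_chart g₀ g hy', ← gram_eq_gramIn, ← gram_eq_gramIn]
        field_simp
    _ = _ := by
        rw [← integral_finsetSum _ fun a _ ↦ integrable_of_continuous g₀ (hc' a)]
        refine integral_congr_ae (Eventually.of_forall fun p ↦ ?_)
        simp only
        rw [← Finset.mul_sum, ← hpt]

end Global

/-! ### The Laplacian of a product -/

section Product

variable {n : ℕ} [NeZero n]

theorem partialD_mul {u v : EuclideanSpace ℝ (Fin n) → ℝ} {y : EuclideanSpace ℝ (Fin n)}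
    (hu : DifferentiableWithinAt ℝ u (range (𝓡∂ n)) y)
    (hv : DifferentiableWithinAt ℝ v (range (𝓡∂ n)) y) (hy : y ∈ range (𝓡∂ n)) (i : Fin n) :
    partialD i (fun z ↦ u z * v z) y = u y * partialD i v y + v y * partialD i u y := by
  rw [partialD, fderivWithin_fun_mul ((𝓡∂ n).uniqueDiffOn y hy) hu hv]
  rfl

theorem partialD_partialD_mul {u v : EuclideanSpace ℝ (Fin n) → ℝ} {y : EuclideanSpace ℝ (Fin n)}
    (hu : ContDiffWithinAt ℝ 2 u (range (𝓡∂ n)) y) (hv : ContDiffWithinAt ℝ 2 v (range (𝓡∂ n)) y)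
    (hy : y ∈ range (𝓡∂ n)) (i j : Fin n) :
    partialD i (partialD j fun z ↦ u z * v z) y
      = u y * partialD i (partialD j v) y + v y * partialD i (partialD j u) y
        + (partialD i u y * partialD j v y + partialD i v y * partialD j u y) := by
  have hev : ∀ {u : EuclideanSpace ℝ (Fin n) → ℝ}, ContDiffWithinAt ℝ 2 u (range (𝓡∂ n)) y →
      ∀ᶠ z in 𝓝[range (𝓡∂ n)] y, DifferentiableWithinAt ℝ u (range (𝓡∂ n)) z := fun h ↦ by
    have := h.eventually (by simp)
    rw [insert_eq_of_mem hy] at this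
    filter_upwards [this] with z hz
    exact hz.differentiableWithinAt two_ne_zero
  have hd : ∀ {u : EuclideanSpace ℝ (Fin n) → ℝ}, ContDiffWithinAt ℝ 2 u (range (𝓡∂ n)) y →
      DifferentiableWithinAt ℝ u (range (𝓡∂ n)) y ∧
      ∀ j, DifferentiableWithinAt ℝ (partialD j u) (range (𝓡∂ n)) y := fun h ↦
    ⟨h.differentiableWithinAt two_ne_zero, fun j ↦
      ((h.fderivWithin_right (m := 1) (𝓡∂ n).uniqueDiffOn (by norm_num) hy).differentiableWithinAt
        one_ne_zero).clm_apply (differentiableWithinAt_const _)⟩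
  have h1 : partialD j (fun z ↦ u z * v z) =ᶠ[𝓝[range (𝓡∂ n)] y]
      fun z ↦ u z * partialD j v z + v z * partialD j u z := by
    filter_upwards [hev hu, hev hv, self_mem_nhdsWithin] with z h1 h2 h3
    exact partialD_mul h1 h2 h3 j
  have hU := (𝓡∂ n).uniqueDiffOn y hy
  rw [partialD, h1.fderivWithin_eq (partialD_mul (hd hu).1 (hd hv).1 hy j),
    fderivWithin_fun_add (f := fun z ↦ u z * partialD j v z)
      (g := fun z ↦ v z * partialD j u z) hU ((hd hu).1.mul ((hd hv).2 j))
      ((hd hv).1.mul ((hd hu).2 j)),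
    fderivWithin_fun_mul hU (hd hu).1 ((hd hv).2 j),
    fderivWithin_fun_mul hU (hd hv).1 ((hd hu).2 j)]
  simp only [partialD, FunLike.coe_add, FunLike.coe_smul, Pi.add_apply, Pi.smul_apply, smul_eq_mul]
  ring

variable {M : Type*} [TopologicalSpace M]
  [ChartedSpace (EuclideanHalfSpace n) M] [IsManifold (𝓡∂ n) ∞ M] {k r : ℕ∞}

/-- The product rule `Δ(fh) = f Δh + h Δf + 2⟨df, dh⟩`, up to the boundary. -/
theorem laplacian_mul (hr : 2 ≤ r) (g : Metric n M k) {f h : M → ℝ}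
    (hf : ContMDiff (𝓡∂ n) 𝓘(ℝ, ℝ) r f) (hh : ContMDiff (𝓡∂ n) 𝓘(ℝ, ℝ) r h) (p : M) :
    laplacian g (fun q ↦ f q * h q) p
      = f p * laplacian g h p + h p * laplacian g f p + 2 * gradInner g f h p := by
  have hp := mem_extChartAt_source (I := 𝓡∂ n) p
  set e := extChartAt (𝓡∂ n) p with he
  set y := e p with hy
  have hyT : y ∈ e.target := e.map_source hp
  have hyR : y ∈ range (𝓡∂ n) := extChartAt_target_subset_range p hyT
  have hr1 : 1 ≤ r := le_trans one_le_two hr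
  have hc : ∀ {f : M → ℝ}, ContMDiff (𝓡∂ n) 𝓘(ℝ, ℝ) r f →
      ContDiffWithinAt ℝ 2 (f ∘ e.symm) (range (𝓡∂ n)) y := fun hf ↦
    ((contDiffOn_comp_symm hf p y hyT).of_le (two_le_coe hr)).mono_of_mem_nhdsWithin
      (extChartAt_target_mem_nhdsWithin_of_mem hyT)
  have hfy : (f ∘ e.symm) y = f p := congrArg f (e.left_inv hp)
  have hhy : (h ∘ e.symm) y = h p := congrArg h (e.left_inv hp)
  have hfd : ∀ i, partialD i (f ∘ e.symm) y = diffIn f p p i := fun i ↦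
    (diffIn_eq_partialD hp (mdifferentiableAt_of_one_le hr1 hf p) i).symm
  have hhd : ∀ i, partialD i (h ∘ e.symm) y = diffIn h p p i := fun i ↦
    (diffIn_eq_partialD hp (mdifferentiableAt_of_one_le hr1 hh p) i).symm
  have hG : gram g p y = gramAt g p := by
    rw [gram_eq_gramIn, gramAt_eq_gramIn, ← he, hy, e.left_inv hp]
  have hess : ∀ i j, hessian g (fun q ↦ f q * h q) p i j y = f p * hessian g h p i j y
      + h p * hessian g f p i j y
      + (diffIn f p p i * diffIn h p p j + diffIn h p p i * diffIn f p p j) := fun i j ↦ by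
    have h1 := partialD_partialD_mul (hc hf) (hc hh) hyR i j
    have h2 : ∀ c, partialD c (fun z ↦ (f ∘ e.symm) z * (h ∘ e.symm) z) y = _ := fun c ↦
      partialD_mul ((hc hf).differentiableWithinAt two_ne_zero)
        ((hc hh).differentiableWithinAt two_ne_zero) hyR c
    rw [hfy, hhy, hfd, hhd, hfd, hhd] at h1
    rw [hfy, hhy] at h2
    change partialD i (partialD j fun z ↦ (f ∘ e.symm) z * (h ∘ e.symm) z) y
      - ∑ c, christoffel g p c i j y * partialD c (fun z ↦ (f ∘ e.symm) z * (h ∘ e.symm) z) y = _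
    simp_rw [h1, h2, hessian, mul_add, Finset.sum_add_distrib, mul_left_comm _ (f p),
      mul_left_comm _ (h p), ← Finset.mul_sum]
    ring
  have h1 : gradInner g f h p
      = ∑ i, ∑ j, (gramAt g p)⁻¹ i j * (diffIn f p p i * diffIn h p p j) := by
    change ∑ i, diffIn f p p i * ∑ j, (gramAt g p)⁻¹ i j * diffIn h p p j = _
    simp_rw [Finset.mul_sum]
    exact Finset.sum_congr rfl fun i _ ↦ Finset.sum_congr rfl fun j _ ↦ by ring
  have h2 : gradInner g f h p
      = ∑ i, ∑ j, (gramAt g p)⁻¹ i j * (diffIn h p p i * diffIn f p p j) := by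
    rw [gradInner_comm]
    change ∑ i, diffIn h p p i * ∑ j, (gramAt g p)⁻¹ i j * diffIn f p p j = _
    simp_rw [Finset.mul_sum]
    exact Finset.sum_congr rfl fun i _ ↦ Finset.sum_congr rfl fun j _ ↦ by ring
  rw [two_mul]
  nth_rewrite 1 [h1]
  rw [h2]
  simp only [laplacian]
  rw [← he, ← hy, hG]
  simp_rw [hess, mul_add, Finset.sum_add_distrib, mul_left_comm _ (f p),
      mul_left_comm _ (h p), ← Finset.mul_sum]

end Product

/-! ### Orthonormal frames -/

section Frame

open scoped MatrixOrder Matrix.Norms.L2Operator in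
/-- A positive definite matrix is congruent to the identity. -/
theorem exists_congr_eq_one {ι : Type*} [Fintype ι] [DecidableEq ι] {G : Matrix ι ι ℝ}
    (hG : G.PosDef) : ∃ P : Matrix ι ι ℝ, IsUnit P ∧ P.transpose * G * P = 1 := by
  obtain ⟨B, hB⟩ := CStarAlgebra.nonneg_iff_eq_star_mul_self.1 hG.posSemidef.nonneg
  have hB' : G = B.transpose * B := hB
  have hu : IsUnit B.det := by
    have h := hG.det_pos
    rw [hB', Matrix.det_mul, Matrix.det_transpose] at h
    exact isUnit_iff_ne_zero.2 (left_ne_zero_of_mul h.ne')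
  refine ⟨B⁻¹, (Matrix.isUnit_nonsing_inv_iff).2 ((Matrix.isUnit_iff_isUnit_det _).2 hu), ?_⟩
  rw [hB', mul_assoc, mul_assoc, Matrix.mul_nonsing_inv _ hu, mul_one, ← Matrix.transpose_mul,
    Matrix.mul_nonsing_inv _ hu, Matrix.transpose_one]

variable {n : ℕ} [NeZero n] {M : Type*} [TopologicalSpace M]
  [ChartedSpace (EuclideanHalfSpace n) M] [IsManifold (𝓡∂ n) ∞ M] {k : ℕ∞}

/-- The vectors at `p` whose components in the chart centred at `p` are the columns of `P`. -/
noncomputable def frameVec (p : M) (P : Matrix (Fin n) (Fin n) ℝ) (a : Fin n) :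
    TangentSpace (𝓡∂ n) p :=
  ∑ i, P i a • coordVec p p i

/-- The Gram matrix of a bilinear form in the frame `frameVec p P`. -/
noncomputable def frameMatrix (p : M) (B : CovTwoTensor (n := n) p)
    (P : Matrix (Fin n) (Fin n) ℝ) : Matrix (Fin n) (Fin n) ℝ :=
  Matrix.of fun a b ↦ B (frameVec p P a) (frameVec p P b)

theorem frameMatrix_eq (p : M) (B : CovTwoTensor (n := n) p) (P : Matrix (Fin n) (Fin n) ℝ) :
    frameMatrix p B P
      = P.transpose * (Matrix.of fun i j ↦ B (coordVec p p i) (coordVec p p j)) * P := by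
  ext a b
  rw [frameMatrix, Matrix.of_apply, frameVec, frameVec, clm_sum_smul_sum_smul, Matrix.mul_apply]
  simp_rw [Matrix.mul_apply, Finset.sum_mul]
  rw [Finset.sum_comm]
  exact Finset.sum_congr rfl fun _ _ ↦ Finset.sum_congr rfl fun _ _ ↦ by
    simp only [Matrix.transpose_apply, Matrix.of_apply]
    ring

/-- Every tangent space has an orthonormal basis. -/
theorem exists_frameMatrix_eq_one (g : Metric n M k) (p : M) :
    ∃ P, IsUnit P ∧ frameMatrix p (g.inner p) P = 1 := by
  obtain ⟨P, hP, h⟩ := exists_congr_eq_one (gramAt_posDef g p)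
  exact ⟨P, hP, (frameMatrix_eq p _ P).trans h⟩

/-- The components of `df` in the frame `frameVec p P`. -/
noncomputable def frameDiff (p : M) (f : M → ℝ) (P : Matrix (Fin n) (Fin n) ℝ) : Fin n → ℝ :=
  fun a ↦ differential f p (frameVec p P a)

theorem frameDiff_eq (p : M) (f : M → ℝ) (P : Matrix (Fin n) (Fin n) ℝ) :
    frameDiff p f P = P.transpose.mulVec (diffIn f p p) := by
  ext a
  rw [frameDiff, frameVec, map_sum]
  simp_rw [map_smul]
  rfl

theorem gradInner_eq_in_frame (g : Metric n M k) (f h : M → ℝ) (p : M)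
    {P : Matrix (Fin n) (Fin n) ℝ} (hP : IsUnit P) :
    gradInner g f h p
      = frameDiff p f P ⬝ᵥ (frameMatrix p (g.inner p) P)⁻¹.mulVec (frameDiff p h P) := by
  rw [frameDiff_eq, frameDiff_eq, frameMatrix_eq, dotProduct_inv_congr hP]
  rfl

theorem gradInner_eq_dotProduct (g : Metric n M k) (f h : M → ℝ) (p : M)
    {P : Matrix (Fin n) (Fin n) ℝ} (hP : IsUnit P) (h1 : frameMatrix p (g.inner p) P = 1) :
    gradInner g f h p = frameDiff p f P ⬝ᵥ frameDiff p h P := by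
  rw [gradInner_eq_in_frame g f h p hP, h1, inv_one, Matrix.one_mulVec]

theorem volumeRatio_eq_in_frame (g₀ g : Metric n M k) (p : M)
    {P : Matrix (Fin n) (Fin n) ℝ} (hP : IsUnit P) (h1 : frameMatrix p (g₀.inner p) P = 1) :
    volumeRatio g₀ g p = √(frameMatrix p (g.inner p) P).det := by
  have hu := (Matrix.isUnit_iff_isUnit_det _).1 hP
  have key : ∀ g : Metric n M k, √(frameMatrix p (g.inner p) P).det
      = |P.det| * √(gramAt g p).det := fun g ↦ by
    rw [frameMatrix_eq, Matrix.det_mul, Matrix.det_mul, Matrix.det_transpose,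
      mul_right_comm, Real.sqrt_mul (mul_self_nonneg _), Real.sqrt_mul_self_eq_abs]
    rfl
  have h2 := key g₀
  rw [h1, Matrix.det_one, Real.sqrt_one] at h2
  have h3 : √(gramAt g₀ p).det ≠ 0 := right_ne_zero_of_mul (h2 ▸ one_ne_zero)
  rw [key, volumeRatio, div_eq_iff h3, mul_right_comm, ← h2, one_mul]

theorem tensorInner_eq_in_frame (g : Metric n M k) (p : M) (T S : CovTwoTensor (n := n) p)
    {P : Matrix (Fin n) (Fin n) ℝ} (hP : IsUnit P) (h1 : frameMatrix p (g.inner p) P = 1) :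
    tensorInner g p T S = ∑ a, ∑ b, frameMatrix p T P a b * frameMatrix p S P a b := by
  have hu := (Matrix.isUnit_iff_isUnit_det _).1 hP
  have hinv : (gramAt g p)⁻¹ = P * P.transpose := by
    refine Matrix.inv_eq_left_inv ?_
    rw [frameMatrix_eq] at h1
    change P.transpose * gramAt g p * P = 1 at h1
    have h2 := mul_eq_one_comm.1 h1
    rwa [← mul_assoc] at h2
  -- both sides are the trace of `T (P Pᵀ) Sᵀ (P Pᵀ)`
  set T' : Matrix (Fin n) (Fin n) ℝ := Matrix.of fun i j ↦ T (coordVec p p i) (coordVec p p j)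
    with hT'
  set S' : Matrix (Fin n) (Fin n) ℝ := Matrix.of fun i j ↦ S (coordVec p p i) (coordVec p p j)
    with hS'
  have htr : ∀ A B : Matrix (Fin n) (Fin n) ℝ,
      ∑ a, ∑ b, A a b * B a b = (A * B.transpose).trace := fun A B ↦ rfl
  have hl : tensorInner g p T S = ∑ i, ∑ j,
      T' i j * ((gramAt g p)⁻¹ * S' * (gramAt g p)⁻¹.transpose) i j := by
    refine Finset.sum_congr rfl fun i _ ↦ Finset.sum_congr rfl fun j _ ↦ ?_
    rw [Matrix.mul_apply]
    simp_rw [Matrix.mul_apply, Finset.sum_mul, Finset.mul_sum]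
    rw [Finset.sum_comm]
    exact Finset.sum_congr rfl fun a _ ↦ Finset.sum_congr rfl fun b _ ↦ by
      simp only [Matrix.transpose_apply, hT', hS', Matrix.of_apply]
      ring
  rw [hl, htr, htr, frameMatrix_eq, frameMatrix_eq, hinv, ← hT', ← hS']
  simp only [Matrix.transpose_mul, Matrix.transpose_transpose, mul_assoc]
  rw [Matrix.trace_mul_comm P.transpose]
  simp only [mul_assoc]

theorem tensorInner_metric (g : Metric n M k) (p : M) (S : CovTwoTensor (n := n) p)
    {P : Matrix (Fin n) (Fin n) ℝ} (hP : IsUnit P) (h1 : frameMatrix p (g.inner p) P = 1) :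
    tensorInner g p (g.inner p) S = (frameMatrix p S P).trace := by
  rw [tensorInner_eq_in_frame g p _ S hP h1, h1]
  refine Finset.sum_congr rfl fun a _ ↦ ?_
  simp [Matrix.one_apply]

theorem tensorInner_diffTensor (g : Metric n M k) (p : M) (f h : M → ℝ)
    (S : CovTwoTensor (n := n) p)
    {P : Matrix (Fin n) (Fin n) ℝ} (hP : IsUnit P) (h1 : frameMatrix p (g.inner p) P = 1) :
    tensorInner g p (diffTensor f h p) S
      = ∑ a, ∑ b, frameMatrix p S P a b * (frameDiff p f P a * frameDiff p h P b) := by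
  rw [tensorInner_eq_in_frame g p _ S hP h1]
  exact Finset.sum_congr rfl fun a _ ↦ Finset.sum_congr rfl fun b _ ↦ mul_comm _ _

theorem tensorInner_smul_sub (g : Metric n M k) (p : M) (c : ℝ) (T T' S : CovTwoTensor (n := n) p) :
    tensorInner g p (c • T - T') S = c * tensorInner g p T S - tensorInner g p T' S := by
  simp only [tensorInner, Finset.mul_sum, ← Finset.sum_sub_distrib, FunLike.coe_sub,
    FunLike.coe_smul, Pi.sub_apply, Pi.smul_apply, smul_eq_mul]
  refine Finset.sum_congr rfl fun i _ ↦ Finset.sum_congr rfl fun j _ ↦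
    Finset.sum_congr rfl fun a _ ↦ Finset.sum_congr rfl fun b _ ↦ ?_
  ring

end Frame

/-! ### First variation of the volume and of the Dirichlet integrand -/

section Bounds

variable {ι : Type*} [Fintype ι]

theorem trace_inv_congr [DecidableEq ι] {T : Matrix ι ι ℝ} (hT : IsUnit T) (G₀ G : Matrix ι ι ℝ) :
    ((T.transpose * G₀ * T)⁻¹ * (T.transpose * G * T)).trace = (G₀⁻¹ * G).trace := by
  have hu := (Matrix.isUnit_iff_isUnit_det _).1 hT
  have h : (T.transpose)⁻¹ * T.transpose = 1 :=
    Matrix.nonsing_inv_mul _ (by rwa [Matrix.det_transpose])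
  have h2 : (T.transpose * G₀ * T)⁻¹ * (T.transpose * G * T) = T⁻¹ * (G₀⁻¹ * G * T) := by
    rw [Matrix.mul_inv_rev, Matrix.mul_inv_rev]
    calc _ = T⁻¹ * (G₀⁻¹ * (((T.transpose)⁻¹ * T.transpose) * (G * T))) := by
          simp only [mul_assoc]
      _ = _ := by rw [h, one_mul, mul_assoc]
  rw [h2, Matrix.trace_mul_comm, mul_assoc, Matrix.mul_nonsing_inv _ hu, mul_one]

theorem abs_sum_sum_mul_le {X : Matrix ι ι ℝ} {c : ℝ} (hc : 0 ≤ c) (hX : ∀ a b, |X a b| ≤ c)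
    (α β : ι → ℝ) : |∑ a, ∑ b, X a b * (α a * β b)|
      ≤ (Fintype.card ι : ℝ) ^ 2 * c * (√(α ⬝ᵥ α) * √(β ⬝ᵥ β)) := by
  have hle : ∀ (α : ι → ℝ) a, |α a| ≤ √(α ⬝ᵥ α) := fun α a ↦ by
    refine Real.abs_le_sqrt ?_
    rw [sq]
    exact Finset.single_le_sum (f := fun i ↦ α i * α i) (fun i _ ↦ mul_self_nonneg _)
      (Finset.mem_univ a)
  calc |∑ a, ∑ b, X a b * (α a * β b)| ≤ ∑ a, ∑ b, |X a b * (α a * β b)| :=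
        (Finset.abs_sum_le_sum_abs _ _).trans
          (Finset.sum_le_sum fun a _ ↦ Finset.abs_sum_le_sum_abs _ _)
    _ ≤ ∑ _a : ι, ∑ _b : ι, c * (√(α ⬝ᵥ α) * √(β ⬝ᵥ β)) := by
        refine Finset.sum_le_sum fun a _ ↦ Finset.sum_le_sum fun b _ ↦ ?_
        rw [abs_mul, abs_mul]
        exact mul_le_mul (hX a b) (mul_le_mul (hle α a) (hle β b) (abs_nonneg _)
          (Real.sqrt_nonneg _)) (by positivity) hc
    _ = _ := by
        simp only [Finset.sum_const, Finset.card_univ, nsmul_eq_mul]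
        ring

theorem abs_trace_le {h : Matrix ι ι ℝ} {C : ℝ} (hC : ∀ a b, |h a b| ≤ C) :
    |h.trace| ≤ Fintype.card ι * C := by
  calc |h.trace| ≤ ∑ a, |h a a| := Finset.abs_sum_le_sum_abs _ _
    _ ≤ ∑ _a : ι, C := Finset.sum_le_sum fun a _ ↦ hC a a
    _ = _ := by simp

theorem continuous_of_forall_exists_near {X : Type*} [TopologicalSpace X] {f : X → ℝ}
    (h : ∀ η > 0, ∃ F : X → ℝ, Continuous F ∧ ∀ p, |f p - F p| ≤ η) : Continuous f := by
  refine continuous_of_uniform_approx_of_continuous fun u hu ↦ ?_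
  obtain ⟨η, hη, hu⟩ := Metric.mem_uniformity_dist.1 hu
  obtain ⟨F, hF, hd⟩ := h (η / 2) (half_pos hη)
  exact ⟨F, hF, fun p ↦ hu (lt_of_le_of_lt (hd p) (half_lt_self hη))⟩

end Bounds

section FirstVariation

variable {n : ℕ} [NeZero n] {M : Type*} [TopologicalSpace M]
  [ChartedSpace (EuclideanHalfSpace n) M] [IsManifold (𝓡∂ n) ∞ M] {k r r' : ℕ∞}

/-- Half the trace of `H` with respect to `g`: the first variation of the volume density. -/
noncomputable def halfTrace (g : Metric n M k) (H : ∀ p : M, CovTwoTensor (n := n) p) (p : M) : ℝ :=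
  1 / 2 * tensorInner g p (g.inner p) (H p)

/-- The first variation `⟨½ ⟨df, dh⟩ g - df ⊗ dh, H⟩` of the Dirichlet integrand `⟨df, dh⟩ dM`
when `g` varies with velocity `H`. -/
noncomputable def dirichletVar (g : Metric n M k) (H : ∀ p : M, CovTwoTensor (n := n) p)
    (f h : M → ℝ) (p : M) : ℝ :=
  halfTrace g H p * gradInner g f h p - tensorInner g p (diffTensor f h p) (H p)

theorem abs_inner_le (g : Metric n M k) (p : M) (v w : TangentSpace (𝓡∂ n) p) :
    |g.inner p v w| ≤ (g.inner p v v + g.inner p w w) / 2 := by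
  have h0 : ∀ v : TangentSpace (𝓡∂ n) p, 0 ≤ g.inner p v v := fun v ↦ by
    by_cases hv : v = 0
    · simp [hv]
    · exact (g.pos p v hv).le
  have h1 := h0 (v + w)
  have h2 := h0 (v - w)
  simp only [map_add, map_sub, FunLike.coe_add, FunLike.coe_sub, Pi.add_apply, Pi.sub_apply,
    g.symm p w v] at h1 h2
  rw [abs_le]
  constructor <;> linarith

/-- On a compact manifold the components of `g` in `g₀`-orthonormal frames are bounded, namely by
the trace of `g` with respect to `g₀`, which is continuous. -/
theorem exists_forall_abs_frameMatrix_le [CompactSpace M] (g₀ g : Metric n M k) :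
    ∃ C, ∀ p, ∀ P : Matrix (Fin n) (Fin n) ℝ, IsUnit P → frameMatrix p (g₀.inner p) P = 1 →
      ∀ a b, |frameMatrix p (g.inner p) P a b| ≤ C := by
  have hcont : Continuous fun p : M ↦ ((gramAt g₀ p)⁻¹ * gramAt g p).trace := by
    refine continuous_of_continuousOn_source (n := n) fun x ↦ ?_
    have h : ContinuousOn (fun q ↦ ∑ a, ∑ b, (gramIn g₀ x q)⁻¹ a b * gramIn g x q b a)
        (extChartAt (𝓡∂ n) x).source :=
      continuousOn_finsetSum _ fun a _ ↦ continuousOn_finsetSum _ fun b _ ↦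
        (continuousOn_inv_gramIn g₀ x a b).mul (continuousOn_gramIn g x b a)
    refine h.congr fun q hq ↦ ?_
    have hqq := mem_extChartAt_source (I := 𝓡∂ n) q
    change _ = ((gramIn g₀ x q)⁻¹ * gramIn g x q).trace
    rw [gramIn_eq_transition g hq hqq, gramIn_eq_transition g₀ hq hqq,
      trace_inv_congr (isUnit_transition hq hqq)]
    rfl
  obtain ⟨C, hC⟩ := isCompact_univ.exists_bound_of_continuousOn hcont.continuousOn
  refine ⟨C, fun p P hP h1 a b ↦ ?_⟩
  have htr : (frameMatrix p (g.inner p) P).trace = ((gramAt g₀ p)⁻¹ * gramAt g p).trace := by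
    rw [← trace_inv_congr hP]
    have : P.transpose * gramAt g₀ p * P = 1 := (frameMatrix_eq p _ P).symm.trans h1
    rw [this, inv_one, one_mul, frameMatrix_eq]
    rfl
  have h0 : ∀ a, 0 ≤ frameMatrix p (g.inner p) P a a := fun a ↦ by
    have := abs_inner_le g p (frameVec p P a) (frameVec p P a)
    have h2 := (abs_nonneg _).trans this
    change 0 ≤ g.inner p _ _
    linarith
  have hle : ∀ a, frameMatrix p (g.inner p) P a a ≤ C := fun a ↦
    (Finset.single_le_sum (f := fun a ↦ frameMatrix p (g.inner p) P a a) (fun a _ ↦ h0 a)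
      (Finset.mem_univ a)).trans (htr.le.trans ((le_abs_self _).trans (hC p (mem_univ p))))
  have := abs_inner_le g p (frameVec p P a) (frameVec p P b)
  have ha := hle a
  have hb := hle b
  simp only [frameMatrix, Matrix.of_apply] at ha hb ⊢
  linarith

/-- The derivative of the metrics, in terms of the matrices in `g 0`-orthonormal frames. -/
theorem HasMetricDerivAt.eventually_frameMatrix {g : ℝ → Metric n M k}
    {H : ∀ p : M, CovTwoTensor (n := n) p} (hg : HasMetricDerivAt g H 0) {c : ℝ} (hc : 0 < c) :
    ∀ᶠ t in 𝓝 0, ∀ p, ∀ P : Matrix (Fin n) (Fin n) ℝ, frameMatrix p ((g 0).inner p) P = 1 →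
      ∀ a b, |frameMatrix p ((g t).inner p) P a b - (1 : Matrix (Fin n) (Fin n) ℝ) a b
        - t * frameMatrix p (H p) P a b| ≤ c * |t| := by
  filter_upwards [hg c hc] with t ht p P h1 a b
  have h := ht p (frameVec p P a) (frameVec p P b)
  have hone : ∀ a, (g 0).inner p (frameVec p P a) (frameVec p P a) = 1 := fun a ↦ by
    have := congrFun (congrFun h1 a) a
    rwa [Matrix.one_apply_eq] at this
  rw [hone, hone, Real.sqrt_one, mul_one, mul_one, sub_zero] at h
  rw [← h1]
  exact h

/-- `H` is bounded: it is within bounded distance of a single difference quotient of the metrics. -/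
theorem HasMetricDerivAt.exists_forall_abs_le [CompactSpace M] {g : ℝ → Metric n M k}
    {H : ∀ p : M, CovTwoTensor (n := n) p} (hg : HasMetricDerivAt g H 0) :
    ∃ C, 0 ≤ C ∧ ∀ p, ∀ P : Matrix (Fin n) (Fin n) ℝ, IsUnit P →
      frameMatrix p ((g 0).inner p) P = 1 → ∀ a b, |frameMatrix p (H p) P a b| ≤ C := by
  have hne : ∀ᶠ t in 𝓝[≠] (0 : ℝ), t ≠ 0 := self_mem_nhdsWithin
  obtain ⟨s, hs, hs0⟩ :=
    (((hg.eventually_frameMatrix one_pos).filter_mono nhdsWithin_le_nhds).and hne).exists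
  obtain ⟨C, hC⟩ := exists_forall_abs_frameMatrix_le (g 0) (g s)
  have hs0' : 0 < |s| := abs_pos.2 hs0
  refine ⟨(|C| + 1 + |s|) / |s|, by positivity, fun p P hP h1 a b ↦ ?_⟩
  have h2 := hs p P h1 a b
  have h3 := (hC p P hP h1 a b).trans (le_abs_self C)
  have h4 : |(1 : Matrix (Fin n) (Fin n) ℝ) a b| ≤ 1 := by
    rw [Matrix.one_apply]
    split_ifs <;> simp
  rw [le_div_iff₀ hs0', mul_comm, ← abs_mul]
  rw [abs_le] at h2 h3 h4 ⊢
  constructor <;> linarith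

theorem gradInner_self_eq (g : Metric n M k) (f : M → ℝ) (p : M)
    {P : Matrix (Fin n) (Fin n) ℝ} (hP : IsUnit P) (h1 : frameMatrix p (g.inner p) P = 1) :
    frameDiff p f P ⬝ᵥ frameDiff p f P = gradInner g f f p :=
  (gradInner_eq_dotProduct g f f p hP h1).symm

theorem sum_sum_one_mul {ι : Type*} [Fintype ι] [DecidableEq ι] (α β : ι → ℝ) :
    ∑ a, ∑ b, (1 : Matrix ι ι ℝ) a b * (α a * β b) = α ⬝ᵥ β := by
  refine Finset.sum_congr rfl fun a _ ↦ ?_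
  simp [Matrix.one_apply]

theorem dirichletVar_eq_in_frame (g : Metric n M k) (H : ∀ p : M, CovTwoTensor (n := n) p)
    (f h : M → ℝ) (p : M) {P : Matrix (Fin n) (Fin n) ℝ} (hP : IsUnit P)
    (h1 : frameMatrix p (g.inner p) P = 1) :
    dirichletVar g H f h p = ∑ a, ∑ b, (1 / 2 * (frameMatrix p (H p) P).trace
        * (1 : Matrix (Fin n) (Fin n) ℝ) a b - frameMatrix p (H p) P a b)
          * (frameDiff p f P a * frameDiff p h P b) := by
  rw [dirichletVar, halfTrace, tensorInner_metric g p _ hP h1,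
    tensorInner_diffTensor g p f h _ hP h1, gradInner_eq_dotProduct g f h p hP h1,
    ← sum_sum_one_mul]
  simp_rw [sub_mul, Finset.sum_sub_distrib, mul_assoc, Finset.mul_sum]

/-- The first order expansion of the density of the Riemannian measure and of the Dirichlet
integrand, uniformly on the manifold. -/
theorem HasMetricDerivAt.eventually_expansion [CompactSpace M] {g : ℝ → Metric n M k}
    {H : ∀ p : M, CovTwoTensor (n := n) p} (hg : HasMetricDerivAt g H 0) {η : ℝ} (hη : 0 < η) :
    ∀ᶠ t in 𝓝 0, ∀ p, |volumeRatio (g 0) (g t) p - 1 - t * halfTrace (g 0) H p| ≤ η * |t| ∧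
      ∀ f h : M → ℝ, |volumeRatio (g 0) (g t) p * gradInner (g t) f h p - gradInner (g 0) f h p
        - t * dirichletVar (g 0) H f h p|
          ≤ η * |t| * (√(gradInner (g 0) f f p) * √(gradInner (g 0) h h p)) := by
  obtain ⟨C, -, hC⟩ := hg.exists_forall_abs_le
  set η' := η / ((Fintype.card (Fin n) : ℝ) ^ 2 + 1) with hη'
  have hη'0 : 0 < η' := by positivity
  have hη'1 : η' ≤ η := div_le_self hη.le (by nlinarith [sq_nonneg (Fintype.card (Fin n) : ℝ)])
  have hη'2 : (Fintype.card (Fin n) : ℝ) ^ 2 * η' ≤ η := by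
    rw [hη', mul_div_assoc', div_le_iff₀ (by positivity)]
    nlinarith
  obtain ⟨c, hc, δ, hδ, hexp⟩ := exists_expansion_sqrt_det (ι := Fin n) C hη'0
  have hball : ∀ᶠ t : ℝ in 𝓝 0, |t| < δ := by
    filter_upwards [Metric.ball_mem_nhds (0 : ℝ) hδ] with t ht
    simpa using ht
  filter_upwards [hball, hg.eventually_frameMatrix hc] with t ht hA p
  obtain ⟨P, hP, h1⟩ := exists_frameMatrix_eq_one (g 0) p
  obtain ⟨h2, h3⟩ := hexp t ht _ _ (hC p P hP h1) (hA p P h1)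
  refine ⟨?_, fun f h ↦ ?_⟩
  · rw [volumeRatio_eq_in_frame (g 0) (g t) p hP h1, halfTrace, tensorInner_metric _ _ _ hP h1]
    exact h2.trans (by gcongr)
  · rw [volumeRatio_eq_in_frame (g 0) (g t) p hP h1, gradInner_eq_in_frame (g t) f h p hP,
      gradInner_eq_dotProduct (g 0) f h p hP h1, dirichletVar_eq_in_frame (g 0) H f h p hP h1,
      ← gradInner_self_eq (g 0) f p hP h1, ← gradInner_self_eq (g 0) h p hP h1]
    set A := frameMatrix p ((g t).inner p) P
    set α := frameDiff p f P
    set β := frameDiff p h P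
    have hsum : √A.det * (α ⬝ᵥ A⁻¹.mulVec β) = ∑ a, ∑ b, √A.det * A⁻¹ a b * (α a * β b) := by
      change √A.det * ∑ a, α a * ∑ b, A⁻¹ a b * β b = _
      simp_rw [Finset.mul_sum]
      exact Finset.sum_congr rfl fun a _ ↦ Finset.sum_congr rfl fun b _ ↦ by ring
    rw [hsum, ← sum_sum_one_mul, Finset.mul_sum]
    simp_rw [Finset.mul_sum, ← Finset.sum_sub_distrib, ← mul_assoc t, ← sub_mul]
    refine (abs_sum_sum_mul_le (c := η' * |t|)
      (X := Matrix.of fun a b ↦ √A.det * A⁻¹ a b - (1 : Matrix (Fin n) (Fin n) ℝ) a b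
        - t * (1 / 2 * (frameMatrix p (H p) P).trace * (1 : Matrix (Fin n) (Fin n) ℝ) a b
          - frameMatrix p (H p) P a b)) (by positivity) h3 α β).trans ?_
    refine mul_le_mul_of_nonneg_right ?_ (by positivity)
    rw [← mul_assoc]
    gcongr

theorem HasMetricDerivAt.exists_bound [CompactSpace M] {g : ℝ → Metric n M k}
    {H : ∀ p : M, CovTwoTensor (n := n) p} (hg : HasMetricDerivAt g H 0) :
    ∃ C, 0 ≤ C ∧ ∀ p, |halfTrace (g 0) H p| ≤ C ∧ ∀ f h : M → ℝ, |dirichletVar (g 0) H f h p|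
      ≤ C * (√(gradInner (g 0) f f p) * √(gradInner (g 0) h h p)) := by
  obtain ⟨C, hC0, hC⟩ := hg.exists_forall_abs_le
  set N : ℝ := (Fintype.card (Fin n) : ℝ) with hN
  have hN0 : 0 ≤ N := by positivity
  refine ⟨N * C + N ^ 2 * (N * C + C), by positivity, fun p ↦ ?_⟩
  obtain ⟨P, hP, h1⟩ := exists_frameMatrix_eq_one (g 0) p
  have htr := abs_trace_le (hC p P hP h1)
  have hhalf : |halfTrace (g 0) H p| ≤ N * C := by
    rw [halfTrace, tensorInner_metric _ _ _ hP h1, abs_mul, abs_of_pos one_half_pos]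
    linarith [abs_nonneg (frameMatrix p (H p) P).trace]
  refine ⟨hhalf.trans (le_add_of_nonneg_right (by positivity)), fun f h ↦ ?_⟩
  rw [dirichletVar_eq_in_frame (g 0) H f h p hP h1,
      ← gradInner_self_eq (g 0) f p hP h1, ← gradInner_self_eq (g 0) h p hP h1]
  refine (abs_sum_sum_mul_le (c := N * C + C)
      (X := Matrix.of fun a b ↦ 1 / 2 * (frameMatrix p (H p) P).trace
        * (1 : Matrix (Fin n) (Fin n) ℝ) a b - frameMatrix p (H p) P a b) (by positivity)
      (fun a b ↦ ?_) _ _).trans ?_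
  · have h3 := hC p P hP h1 a b
    have h4 : |(1 : Matrix (Fin n) (Fin n) ℝ) a b| ≤ 1 := by
      rw [Matrix.one_apply]
      split_ifs <;> simp
    rw [Matrix.of_apply]
    refine (abs_sub _ _).trans (add_le_add ?_ h3)
    rw [abs_mul, abs_mul, abs_of_pos one_half_pos]
    nlinarith [abs_nonneg (frameMatrix p (H p) P).trace,
      abs_nonneg ((1 : Matrix (Fin n) (Fin n) ℝ) a b)]
  · gcongr
    exact le_add_of_nonneg_left (by positivity)

theorem dirichletVar_sub_left (g : Metric n M k) (H : ∀ p : M, CovTwoTensor (n := n) p)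
    {f f' : M → ℝ} (h : M → ℝ) {p : M} (hf : MDifferentiableAt (𝓡∂ n) 𝓘(ℝ, ℝ) f p)
    (hf' : MDifferentiableAt (𝓡∂ n) 𝓘(ℝ, ℝ) f' p) :
    dirichletVar g H (fun q ↦ f q - f' q) h p
      = dirichletVar g H f h p - dirichletVar g H f' h p := by
  obtain ⟨P, hP, h1⟩ := exists_frameMatrix_eq_one g p
  simp_rw [dirichletVar_eq_in_frame g H _ h p hP h1, ← Finset.sum_sub_distrib, ← mul_sub,
    ← sub_mul, frameDiff_eq, diffIn_sub hf hf', Matrix.mulVec_sub, Pi.sub_apply]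

/-- `½ tr H` is a uniform limit of difference quotients of the densities, hence continuous. -/
theorem HasMetricDerivAt.continuous_halfTrace [CompactSpace M] {g : ℝ → Metric n M k}
    {H : ∀ p : M, CovTwoTensor (n := n) p} (hg : HasMetricDerivAt g H 0) :
    Continuous (halfTrace (g 0) H) := by
  refine continuous_of_forall_exists_near fun η hη ↦ ?_
  have hne : ∀ᶠ t in 𝓝[≠] (0 : ℝ), t ≠ 0 := self_mem_nhdsWithin
  obtain ⟨t, ht, ht0⟩ :=
    (((hg.eventually_expansion hη).filter_mono nhdsWithin_le_nhds).and hne).exists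
  refine ⟨fun p ↦ (volumeRatio (g 0) (g t) p - 1) / t,
    ((continuous_volumeRatio _ _).sub continuous_const).div_const _, fun p ↦ ?_⟩
  have h := (ht p).1
  rw [abs_sub_comm, div_sub' ht0, abs_div, div_le_iff₀ (abs_pos.2 ht0)]
  exact h

theorem HasMetricDerivAt.continuous_dirichletVar [CompactSpace M] {g : ℝ → Metric n M k}
    {H : ∀ p : M, CovTwoTensor (n := n) p} (hg : HasMetricDerivAt g H 0) {f h : M → ℝ}
    (hr : 1 ≤ r) (hr' : 1 ≤ r') (hf : ContMDiff (𝓡∂ n) 𝓘(ℝ, ℝ) r f)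
    (hh : ContMDiff (𝓡∂ n) 𝓘(ℝ, ℝ) r' h) : Continuous (dirichletVar (g 0) H f h) := by
  have hB : Continuous fun p ↦ √(gradInner (g 0) f f p) * √(gradInner (g 0) h h p) :=
    (continuous_gradInner _ hr hr hf hf).sqrt.mul (continuous_gradInner _ hr' hr' hh hh).sqrt
  obtain ⟨B, hB⟩ := isCompact_univ.exists_bound_of_continuousOn hB.continuousOn
  refine continuous_of_forall_exists_near fun η hη ↦ ?_
  have hne : ∀ᶠ t in 𝓝[≠] (0 : ℝ), t ≠ 0 := self_mem_nhdsWithin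
  have hη' : 0 < η / (|B| + 1) := by positivity
  obtain ⟨t, ht, ht0⟩ :=
    (((hg.eventually_expansion hη').filter_mono nhdsWithin_le_nhds).and hne).exists
  refine ⟨fun p ↦ (volumeRatio (g 0) (g t) p * gradInner (g t) f h p - gradInner (g 0) f h p) / t,
    (((continuous_volumeRatio _ _).mul (continuous_gradInner _ hr hr' hf hh)).sub
      (continuous_gradInner _ hr hr' hf hh)).div_const _, fun p ↦ ?_⟩
  have h1 := (ht p).2 f h
  have h2 := (le_abs_self _).trans ((hB p (mem_univ p)).trans (le_abs_self B))
  rw [abs_sub_comm, div_sub' ht0, abs_div, div_le_iff₀ (abs_pos.2 ht0)]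
  refine h1.trans ?_
  have h3 : η / (|B| + 1) * (√(gradInner (g 0) f f p) * √(gradInner (g 0) h h p)) ≤ η := by
    rw [div_mul_eq_mul_div, div_le_iff₀ (by positivity)]
    exact mul_le_mul_of_nonneg_left (h2.trans (by linarith)) hη.le
  calc _ = η / (|B| + 1) * (√(gradInner (g 0) f f p) * √(gradInner (g 0) h h p)) * |t| := by ring
    _ ≤ _ := by gcongr

end FirstVariation

/-! ### Convergence of energies and of difference quotients -/

theorem tendsto_of_forall_eventually_abs_sub_le {X : Type*} {l : Filter X} {f : X → ℝ} {a B : ℝ}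
    (h : ∀ η > 0, ∀ᶠ x in l, |f x - a| ≤ η * B) : Tendsto f l (𝓝 a) := by
  refine Metric.tendsto_nhds.2 fun ε hε ↦ ?_
  filter_upwards [h (ε / (|B| + 1)) (by positivity)] with x hx
  rw [Real.dist_eq]
  refine hx.trans_lt ?_
  rw [div_mul_eq_mul_div, div_lt_iff₀ (by positivity)]
  exact mul_lt_mul_of_pos_left (by linarith [le_abs_self B]) hε

theorem sqrt_mul_sqrt_le {a b s : ℝ} (ha : 0 ≤ a) (hb : 0 ≤ b) (hs : 0 < s) :
    √a * √b ≤ (a / s + s * b) / 2 := by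
  have h := sq_nonneg (√a - s * √b)
  rw [sub_sq, mul_pow, Real.sq_sqrt ha, Real.sq_sqrt hb] at h
  rw [div_add' _ _ _ hs.ne', div_div, le_div_iff₀ (by positivity)]
  linarith

theorem abs_integral_sub_sub_le {X : Type*} [MeasurableSpace X] {μ : Measure X}
    {f₁ f₂ f₃ b : X → ℝ} (h₁ : Integrable f₁ μ) (h₂ : Integrable f₂ μ) (h₃ : Integrable f₃ μ)
    (hb : Integrable b μ) (t : ℝ) (h : ∀ p, |f₁ p - f₂ p - t * f₃ p| ≤ b p) :
    |∫ p, f₁ p ∂μ - ∫ p, f₂ p ∂μ - t * ∫ p, f₃ p ∂μ| ≤ ∫ p, b p ∂μ := by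
  have h12 : Integrable (fun p ↦ f₁ p - f₂ p) μ := h₁.sub h₂
  rw [← integral_const_mul, ← integral_sub h₁ h₂, ← integral_sub h12 (h₃.const_mul t),
    ← Real.norm_eq_abs]
  exact norm_integral_le_of_norm_le hb (Eventually.of_forall h)

theorem tendsto_integral_sqrt_mul_sqrt {X T : Type*} [MeasurableSpace X] {μ : Measure X}
    {l : Filter T} {a : T → X → ℝ} {b : X → ℝ} (ha : ∀ t p, 0 ≤ a t p) (hb : ∀ p, 0 ≤ b p)
    (hai : ∀ t, Integrable (a t) μ) (hbi : Integrable b μ)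
    (hab : ∀ t, Integrable (fun p ↦ √(a t p) * √(b p)) μ)
    (hlim : Tendsto (fun t ↦ ∫ p, a t p ∂μ) l (𝓝 0)) :
    Tendsto (fun t ↦ ∫ p, √(a t p) * √(b p) ∂μ) l (𝓝 0) := by
  refine tendsto_of_forall_eventually_abs_sub_le (B := (1 + ∫ p, b p ∂μ) / 2) fun s hs ↦ ?_
  -- the weight `s` in Young's inequality is the desired bound
  have hs2 : 0 < s * s := by positivity
  filter_upwards [hlim.eventually_le_const hs2] with t ht
  have h0 : 0 ≤ ∫ p, √(a t p) * √(b p) ∂μ := integral_nonneg fun p ↦ by positivity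
  rw [sub_zero, abs_of_nonneg h0]
  calc ∫ p, √(a t p) * √(b p) ∂μ ≤ ∫ p, (a t p / s + s * b p) / 2 ∂μ :=
        integral_mono (hab t) ((((hai t).div_const s).add (hbi.const_mul s)).div_const 2)
          fun p ↦ sqrt_mul_sqrt_le (ha t p) (hb p) hs
    _ = ((∫ p, a t p ∂μ) / s + s * ∫ p, b p ∂μ) / 2 := by
        rw [integral_div, integral_add ((hai t).div_const s) (hbi.const_mul s), integral_div,
          integral_const_mul]
    _ ≤ (s + s * ∫ p, b p ∂μ) / 2 := by
        gcongr
        rwa [div_le_iff₀ hs]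
    _ = _ := by ring

section Convergence

variable {n : ℕ} [NeZero n] {M : Type*} [TopologicalSpace M]
  [ChartedSpace (EuclideanHalfSpace n) M] [IsManifold (𝓡∂ n) ∞ M] {k r r' : ℕ∞}

theorem gradInner_self_nonneg (g : Metric n M k) (f : M → ℝ) (p : M) : 0 ≤ gradInner g f f p := by
  obtain ⟨P, hP, h1⟩ := exists_frameMatrix_eq_one g p
  rw [gradInner_eq_dotProduct g f f p hP h1]
  exact Finset.sum_nonneg fun a _ ↦ mul_self_nonneg _

variable [T2Space M] [CompactSpace M] [MeasurableSpace M] [BorelSpace M]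

/-- The weak form of the Neumann eigenvalue problem. -/
theorem integral_gradInner_eigenfunction (hk : 1 ≤ k) (hr : 2 ≤ r) (hr' : 1 ≤ r')
    (g : Metric n M k) {f w : M → ℝ} (hf : ContMDiff (𝓡∂ n) 𝓘(ℝ, ℝ) r f)
    (hw : ContMDiff (𝓡∂ n) 𝓘(ℝ, ℝ) r' w) {c : ℝ} (hfc : ∀ p, -laplacian g f p = c * f p)
    (hN : ∀ p ∈ (𝓡∂ n).boundary M, normalDeriv g f p = 0) :
    ∫ p, gradInner g f w p ∂(riemannianVolume g) = c * ∫ p, f p * w p ∂(riemannianVolume g) := by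
  rw [integral_gradInner hk hr hr' g hf hw (L := fun p ↦ -(c * f p))
    (continuous_const.mul hf.continuous).neg (fun p ↦ neg_eq_iff_eq_neg.1 (hfc p)) hN,
    ← integral_const_mul, ← integral_neg]
  exact integral_congr_ae (Eventually.of_forall fun p ↦ by
    simp only
    ring)

section Energy

variable {g : ℝ → Metric n M k} {H : ∀ p : M, CovTwoTensor (n := n) p} {u : ℝ → M → ℝ}

/-- If the Dirichlet energies of `u t` for `g t` converge, those for `g 0` converge to the same
limit. No bound on the latter is needed in advance: the two energies differ by at most
`O(t)` times the energy for `g 0`. -/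
theorem HasMetricDerivAt.tendsto_energy (hg : HasMetricDerivAt g H 0) (hr : 1 ≤ r)
    (hu : ∀ t, ContMDiff (𝓡∂ n) 𝓘(ℝ, ℝ) r (u t)) {c : ℝ}
    (hlim : Tendsto (fun t ↦ ∫ p, volumeRatio (g 0) (g t) p * gradInner (g t) (u t) (u t) p
      ∂(riemannianVolume (g 0))) (𝓝 0) (𝓝 c)) :
    Tendsto (fun t ↦ ∫ p, gradInner (g 0) (u t) (u t) p ∂(riemannianVolume (g 0))) (𝓝 0)
      (𝓝 c) := by
  obtain ⟨C, hC0, hC⟩ := hg.exists_bound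
  set E := fun t ↦ ∫ p, gradInner (g 0) (u t) (u t) p ∂(riemannianVolume (g 0)) with hE
  set F := fun t ↦ ∫ p, volumeRatio (g 0) (g t) p * gradInner (g t) (u t) (u t) p
      ∂(riemannianVolume (g 0)) with hF
  have hE0 : ∀ t, 0 ≤ E t := fun t ↦ integral_nonneg fun p ↦ gradInner_self_nonneg _ _ _
  have hEi : ∀ t, Integrable (gradInner (g 0) (u t) (u t)) (riemannianVolume (g 0)) := fun t ↦
    integrable_of_continuous _ (continuous_gradInner _ hr hr (hu t) (hu t))
  have hFi : ∀ t, Integrable (fun p ↦ volumeRatio (g 0) (g t) p * gradInner (g t) (u t) (u t) p)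
      (riemannianVolume (g 0)) := fun t ↦
    integrable_of_continuous _ ((continuous_volumeRatio _ _).mul
      (continuous_gradInner _ hr hr (hu t) (hu t)))
  have hdiff : ∀ᶠ t in 𝓝 0, |F t - E t| ≤ (1 + C) * |t| * E t := by
    filter_upwards [hg.eventually_expansion one_pos] with t ht
    rw [hF, hE, ← integral_sub (hFi t) (hEi t), ← integral_const_mul, ← Real.norm_eq_abs]
    refine norm_integral_le_of_norm_le ((hEi t).const_mul _) (Eventually.of_forall fun p ↦ ?_)
    have h1 := (ht p).2 (u t) (u t)
    have h2 := (hC p).2 (u t) (u t)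
    rw [Real.mul_self_sqrt (gradInner_self_nonneg _ _ _)] at h1 h2
    have h3 := mul_le_mul_of_nonneg_left h2 (abs_nonneg t)
    rw [← abs_mul] at h3
    rw [Real.norm_eq_abs]
    refine (sub_le_iff_le_add'.1 (abs_sub_abs_le_abs_sub _
      (t * dirichletVar (g 0) H (u t) (u t) p))).trans ?_
    refine (add_le_add h3 h1).trans_eq ?_
    ring
  have hbound : ∀ᶠ t in 𝓝 0, E t ≤ 2 * (c + 1) := by
    have hsmall : Tendsto (fun t : ℝ ↦ (1 + C) * |t|) (𝓝 0) (𝓝 0) := by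
      have : Continuous fun t : ℝ ↦ (1 + C) * |t| := by fun_prop
      simpa using this.tendsto 0
    filter_upwards [hdiff, hsmall.eventually_le_const (show (0 : ℝ) < 1 / 2 by norm_num),
      hlim.eventually_le_const (show c < c + 1 by linarith)] with t h1 h2 h3
    have h4 := mul_le_mul_of_nonneg_right h2 (hE0 t)
    have h5 := (abs_le.1 h1).1
    change F t ≤ c + 1 at h3
    linarith
  have hzero : Tendsto (fun t ↦ F t - E t) (𝓝 0) (𝓝 0) := by
    have h0 : Tendsto (fun t : ℝ ↦ (1 + C) * |t| * (2 * (c + 1))) (𝓝 0) (𝓝 0) := by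
      have : Continuous fun t : ℝ ↦ (1 + C) * |t| * (2 * (c + 1)) := by fun_prop
      simpa using this.tendsto 0
    refine squeeze_zero_norm' ?_ h0
    filter_upwards [hdiff, hbound] with t h1 h2
    exact h1.trans (by gcongr)
  simpa using hlim.sub hzero

/-- If the energies converge and the family converges weakly, it converges strongly. -/
theorem tendsto_energy_sub (g₀ : Metric n M k) (hr : 1 ≤ r)
    (hu : ∀ t, ContMDiff (𝓡∂ n) 𝓘(ℝ, ℝ) r (u t)) {c : ℝ}
    (hlim : Tendsto (fun t ↦ ∫ p, gradInner g₀ (u t) (u t) p ∂(riemannianVolume g₀)) (𝓝 0) (𝓝 c))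
    (hlim' : Tendsto (fun t ↦ ∫ p, gradInner g₀ (u t) (u 0) p ∂(riemannianVolume g₀)) (𝓝 0) (𝓝 c))
    (h0 : ∫ p, gradInner g₀ (u 0) (u 0) p ∂(riemannianVolume g₀) = c) :
    Tendsto (fun t ↦ ∫ p, gradInner g₀ (fun q ↦ u t q - u 0 q) (fun q ↦ u t q - u 0 q) p
      ∂(riemannianVolume g₀)) (𝓝 0) (𝓝 0) := by
  have hi : ∀ t s, Integrable (gradInner g₀ (u t) (u s)) (riemannianVolume g₀) := fun t s ↦
    integrable_of_continuous _ (continuous_gradInner _ hr hr (hu t) (hu s))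
  have hd : ∀ t p, MDifferentiableAt (𝓡∂ n) 𝓘(ℝ, ℝ) (u t) p := fun t p ↦
    mdifferentiableAt_of_one_le hr (hu t) p
  have heq : ∀ t, ∫ p, gradInner g₀ (fun q ↦ u t q - u 0 q) (fun q ↦ u t q - u 0 q) p
      ∂(riemannianVolume g₀) = ∫ p, gradInner g₀ (u t) (u t) p ∂(riemannianVolume g₀)
        - ∫ p, gradInner g₀ (u t) (u 0) p ∂(riemannianVolume g₀)
        - (∫ p, gradInner g₀ (u t) (u 0) p ∂(riemannianVolume g₀) - c) := fun t ↦ by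
    rw [← h0, ← integral_sub (hi t t) (hi t 0), ← integral_sub (hi t 0) (hi 0 0),
      ← integral_sub (f := fun p ↦ _ - _) (g := fun p ↦ _ - _) ((hi t t).sub (hi t 0))
        ((hi t 0).sub (hi 0 0))]
    refine integral_congr_ae (Eventually.of_forall fun p ↦ ?_)
    simp only
    rw [gradInner_sub_left _ _ (hd t p) (hd 0 p), gradInner_sub_right _ _ (hd t p) (hd 0 p),
      gradInner_sub_right _ _ (hd t p) (hd 0 p), gradInner_comm g₀ (u 0) (u t)]
  simp_rw [heq]
  simpa using (hlim.sub hlim').sub (hlim'.sub_const c)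

/-- The derivative of the Dirichlet form with respect to the metric, along a strongly convergent
family of functions. -/
theorem HasMetricDerivAt.tendsto_dirichlet_quotient (hg : HasMetricDerivAt g H 0) (hr : 1 ≤ r)
    (hr' : 1 ≤ r') (hu : ∀ t, ContMDiff (𝓡∂ n) 𝓘(ℝ, ℝ) r (u t)) {w : M → ℝ}
    (hw : ContMDiff (𝓡∂ n) 𝓘(ℝ, ℝ) r' w) {B : ℝ}
    (hB : ∀ᶠ t in 𝓝 0, ∫ p, gradInner (g 0) (u t) (u t) p ∂(riemannianVolume (g 0)) ≤ B)
    (hlim : Tendsto (fun t ↦ ∫ p, gradInner (g 0) (fun q ↦ u t q - u 0 q)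
      (fun q ↦ u t q - u 0 q) p ∂(riemannianVolume (g 0))) (𝓝 0) (𝓝 0)) :
    Tendsto (fun t ↦ (∫ p, volumeRatio (g 0) (g t) p * gradInner (g t) (u t) w p
        ∂(riemannianVolume (g 0)) - ∫ p, gradInner (g 0) (u t) w p ∂(riemannianVolume (g 0))) / t)
      (𝓝[≠] 0) (𝓝 (∫ p, dirichletVar (g 0) H (u 0) w p ∂(riemannianVolume (g 0)))) := by
  set V := riemannianVolume (g 0) with hV
  obtain ⟨C, hC0, hC⟩ := hg.exists_bound
  have hint : ∀ {f : M → ℝ}, Continuous f → Integrable f V := fun hf ↦ integrable_of_continuous _ hf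
  have hcs : ∀ {f h : M → ℝ} {r r' : ℕ∞}, 1 ≤ r → 1 ≤ r' → ContMDiff (𝓡∂ n) 𝓘(ℝ, ℝ) r f →
      ContMDiff (𝓡∂ n) 𝓘(ℝ, ℝ) r' h →
      Continuous fun p ↦ √(gradInner (g 0) f f p) * √(gradInner (g 0) h h p) :=
    fun h1 h2 hf hh ↦ (continuous_gradInner _ h1 h1 hf hf).sqrt.mul
      (continuous_gradInner _ h2 h2 hh hh).sqrt
  have hK : ∀ t, Integrable (dirichletVar (g 0) H (u t) w) V := fun t ↦
    hint (hg.continuous_dirichletVar hr hr' (hu t) hw)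
  have hud : ∀ t, ContMDiff (𝓡∂ n) 𝓘(ℝ, ℝ) r (fun q ↦ u t q - u 0 q) := fun t ↦ (hu t).sub (hu 0)
  have h1 : Tendsto (fun t ↦ ∫ p, dirichletVar (g 0) H (u t) w p ∂V) (𝓝 0)
      (𝓝 (∫ p, dirichletVar (g 0) H (u 0) w p ∂V)) := by
    have hS := tendsto_integral_sqrt_mul_sqrt (μ := V) (l := 𝓝 (0 : ℝ))
      (a := fun t ↦ gradInner (g 0) (fun q ↦ u t q - u 0 q) (fun q ↦ u t q - u 0 q))
      (b := gradInner (g 0) w w) (fun t p ↦ gradInner_self_nonneg _ _ _)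
      (fun p ↦ gradInner_self_nonneg _ _ _)
      (fun t ↦ hint (continuous_gradInner _ hr hr (hud t) (hud t)))
      (hint (continuous_gradInner _ hr' hr' hw hw)) (fun t ↦ hint (hcs hr hr' (hud t) hw)) hlim
    rw [tendsto_iff_norm_sub_tendsto_zero]
    refine squeeze_zero (fun t ↦ norm_nonneg _) (fun t ↦ ?_) (by simpa using hS.const_mul C)
    rw [← integral_sub (hK t) (hK 0), ← integral_const_mul]
    refine norm_integral_le_of_norm_le ((hint (hcs hr hr' (hud t) hw)).const_mul _)
      (Eventually.of_forall fun p ↦ ?_)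
    rw [← dirichletVar_sub_left _ _ _ (mdifferentiableAt_of_one_le hr (hu t) p)
      (mdifferentiableAt_of_one_le hr (hu 0) p)]
    exact (hC p).2 _ _
  have h2 : Tendsto (fun t ↦ (∫ p, volumeRatio (g 0) (g t) p * gradInner (g t) (u t) w p ∂V
      - ∫ p, gradInner (g 0) (u t) w p ∂V) / t - ∫ p, dirichletVar (g 0) H (u t) w p ∂V)
      (𝓝[≠] 0) (𝓝 0) := by
    refine tendsto_of_forall_eventually_abs_sub_le
      (B := (B + ∫ p, gradInner (g 0) w w p ∂V) / 2) fun η hη ↦ ?_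
    have hne : ∀ᶠ t in 𝓝[≠] (0 : ℝ), t ≠ 0 := self_mem_nhdsWithin
    filter_upwards [(hg.eventually_expansion hη).filter_mono nhdsWithin_le_nhds,
      hB.filter_mono nhdsWithin_le_nhds, hne] with t ht hBt ht0
    have i1 : Integrable (fun p ↦ volumeRatio (g 0) (g t) p * gradInner (g t) (u t) w p) V :=
      hint ((continuous_volumeRatio (g 0) (g t)).mul (continuous_gradInner (g t) hr hr' (hu t) hw))
    have i2 := hint (continuous_gradInner (g 0) hr hr' (hu t) hw)
    have i3 := hint (hcs hr hr' (hu t) hw)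
    have i4 := hint (continuous_gradInner (g 0) hr hr (hu t) (hu t))
    have i5 := hint (continuous_gradInner (g 0) hr' hr' hw hw)
    rw [sub_zero, div_sub' ht0, abs_div, div_le_iff₀ (abs_pos.2 ht0)]
    calc _ ≤ ∫ p, η * |t| * (√(gradInner (g 0) (u t) (u t) p) * √(gradInner (g 0) w w p)) ∂V :=
          abs_integral_sub_sub_le i1 i2 (hK t) (i3.const_mul _) t fun p ↦ (ht p).2 (u t) w
      _ = η * |t| * ∫ p, √(gradInner (g 0) (u t) (u t) p) * √(gradInner (g 0) w w p) ∂V :=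
          integral_const_mul _ _
      _ ≤ η * |t| *
            ∫ p, (gradInner (g 0) (u t) (u t) p / 1 + 1 * gradInner (g 0) w w p) / 2 ∂V := by
          refine mul_le_mul_of_nonneg_left ?_ (by positivity)
          exact integral_mono i3 (((i4.div_const 1).add (i5.const_mul 1)).div_const 2) fun p ↦
            sqrt_mul_sqrt_le (gradInner_self_nonneg _ _ _) (gradInner_self_nonneg _ _ _) one_pos
      _ = η * |t| *
            ((∫ p, gradInner (g 0) (u t) (u t) p ∂V + ∫ p, gradInner (g 0) w w p ∂V) / 2) := by
          simp only [div_one, one_mul]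
          rw [integral_div, integral_add i4 i5]
      _ ≤ η * |t| * ((B + ∫ p, gradInner (g 0) w w p ∂V) / 2) := by gcongr
      _ = _ := by ring
  simpa using h2.add (h1.mono_left nhdsWithin_le_nhds)

/-- The derivative of the Riemannian measure, along a uniformly convergent family of functions. -/
theorem HasMetricDerivAt.tendsto_volume_quotient (hg : HasMetricDerivAt g H 0)
    {F : ℝ → C(M, ℝ)} (hF : ContinuousAt F 0) :
    Tendsto (fun t ↦ ∫ p, (volumeRatio (g 0) (g t) p - 1) / t * F t p ∂(riemannianVolume (g 0)))
      (𝓝[≠] 0) (𝓝 (∫ p, halfTrace (g 0) H p * F 0 p ∂(riemannianVolume (g 0)))) := by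
  have := isFiniteMeasure_riemannianVolume (g 0)
  obtain ⟨C, hC0, hC⟩ := hg.exists_bound
  have hne : ∀ᶠ t in 𝓝[≠] (0 : ℝ), t ≠ 0 := self_mem_nhdsWithin
  have hexp : ∀ η > 0, ∀ᶠ t in 𝓝[≠] (0 : ℝ), ∀ p,
      |(volumeRatio (g 0) (g t) p - 1) / t - halfTrace (g 0) H p| ≤ η * 1 := fun η hη ↦ by
    filter_upwards [(hg.eventually_expansion hη).filter_mono nhdsWithin_le_nhds, hne]
      with t ht ht0 p
    rw [div_sub' ht0, abs_div, div_le_iff₀ (abs_pos.2 ht0), mul_one]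
    exact (ht p).1
  refine tendsto_integral_filter_of_norm_le_const (Eventually.of_forall fun t ↦ ?_)
    ⟨(1 + C) * (‖F 0‖ + 1), ?_⟩ (Eventually.of_forall fun p ↦ ?_)
  · exact ((((continuous_volumeRatio (g 0) (g t)).sub continuous_const).div_const t).mul
      (F t).continuous).aestronglyMeasurable
  · have hFb : ∀ᶠ t in 𝓝 (0 : ℝ), ‖F t‖ ≤ ‖F 0‖ + 1 :=
      hF.norm.tendsto.eventually_le_const (by linarith)
    filter_upwards [hexp 1 one_pos, hFb.filter_mono nhdsWithin_le_nhds] with t h1 h2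
    refine Eventually.of_forall fun p ↦ ?_
    rw [norm_mul]
    refine mul_le_mul ?_ (((F t).norm_coe_le_norm p).trans h2) (norm_nonneg _) (by positivity)
    rw [Real.norm_eq_abs]
    have h3 := abs_sub_abs_le_abs_sub ((volumeRatio (g 0) (g t) p - 1) / t) (halfTrace (g 0) H p)
    linarith [h1 p, (hC p).1]
  · refine (tendsto_of_forall_eventually_abs_sub_le (B := 1) fun η hη ↦ ?_).mul
      ((((continuous_eval_const p).tendsto _).comp hF.tendsto).mono_left
        nhdsWithin_le_nhds)
    exact (hexp η hη).mono fun t ht ↦ ht p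

theorem tendsto_integral_of_continuousAt (g₀ : Metric n M k) {F : ℝ → C(M, ℝ)}
    (hF : ContinuousAt F 0) :
    Tendsto (fun t ↦ ∫ p, F t p ∂(riemannianVolume g₀)) (𝓝 0)
      (𝓝 (∫ p, F 0 p ∂(riemannianVolume g₀))) := by
  have := isFiniteMeasure_riemannianVolume g₀
  refine tendsto_integral_filter_of_norm_le_const
    (Eventually.of_forall fun t ↦ (F t).continuous.aestronglyMeasurable) ⟨‖F 0‖ + 1, ?_⟩
    (Eventually.of_forall fun p ↦ ((continuous_eval_const p).tendsto _).comp hF.tendsto)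
  filter_upwards [hF.norm.tendsto.eventually_le_const (show ‖F 0‖ < ‖F 0‖ + 1 by linarith)]
    with t ht
  exact Eventually.of_forall fun p ↦ ((F t).norm_coe_le_norm p).trans ht

end Energy

end Convergence

end NeumannVariation

theorem proposition3 {n : ℕ} [NeZero n] {M : Type*} [TopologicalSpace M]
    [ChartedSpace (EuclideanHalfSpace n) M] [IsManifold (𝓡∂ n) ∞ M]
    [T2Space M] [CompactSpace M] [MeasurableSpace M] [BorelSpace M]
    {k r : ℕ∞} (hk : 1 ≤ k) (hr : 2 ≤ r) {ι : Type*} [DecidableEq ι]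
    (g : ℝ → NeumannVariation.Metric n M k)
    (H : ∀ p : M, NeumannVariation.CovTwoTensor (n := n) p)
    (φ : ι → ℝ → C^(r : WithTop ℕ∞)⟮𝓡∂ n, M; ℝ⟯) (lam : ℝ → ℝ)
    (hg : NeumannVariation.HasMetricDerivAt g H 0)
    (hφ : ∀ i, DifferentiableAt ℝ (fun t : ℝ ↦ (φ i t : C(M, ℝ))) 0)
    (hlam : DifferentiableAt ℝ lam 0)
    (ε : ℝ) (hε : 0 < ε)
    (horth : ∀ t : ℝ, |t| < ε → ∀ i j,
      ∫ p, φ i t p * φ j t p ∂(NeumannVariation.riemannianVolume (g t)) = if i = j then 1 else 0)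
    (heig : ∀ t : ℝ, |t| < ε → ∀ i, ∀ p : M,
      -NeumannVariation.laplacian (g t) (φ i t) p = lam t * φ i t p)
    (hneu : ∀ t : ℝ, |t| < ε → ∀ i, ∀ p ∈ (𝓡∂ n).boundary M,
      NeumannVariation.normalDeriv (g t) (φ i t) p = 0)
    (i j : ι) :
    Integrable
      (fun p ↦ NeumannVariation.tensorInner (g 0) p
        (((1 / 4 : ℝ) * NeumannVariation.laplacian (g 0) (fun q ↦ φ i 0 q * φ j 0 q) p) •
            (g 0).inner p
          - NeumannVariation.diffTensor (φ i 0) (φ j 0) p) (H p))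
      (NeumannVariation.riemannianVolume (g 0)) ∧
    deriv lam 0 * (if i = j then 1 else 0) =
      ∫ p, NeumannVariation.tensorInner (g 0) p
        (((1 / 4 : ℝ) * NeumannVariation.laplacian (g 0) (fun q ↦ φ i 0 q * φ j 0 q) p) •
            (g 0).inner p
          - NeumannVariation.diffTensor (φ i 0) (φ j 0) p) (H p)
        ∂(NeumannVariation.riemannianVolume (g 0)) := by
  open NeumannVariation in
  have hr1 : 1 ≤ r := le_trans one_le_two hr
  set V := riemannianVolume (g 0) with hV
  have hs : ∀ i t, ContMDiff (𝓡∂ n) 𝓘(ℝ, ℝ) r (φ i t) := fun i t ↦ (φ i t).contMDiff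
  have hzero : |(0 : ℝ)| < ε := by simpa using hε
  have hsmall : ∀ᶠ t : ℝ in 𝓝 0, |t| < ε := by
    filter_upwards [Metric.ball_mem_nhds (0 : ℝ) hε] with t ht
    simpa using ht
  have hmul : ∀ i t j s, Continuous fun p ↦ φ i t p * φ j s p := fun i t j s ↦
    (hs i t).continuous.mul (hs j s).continuous
  have hcont : ∀ i j, ContinuousAt (fun t : ℝ ↦ (φ i t : C(M, ℝ)) * (φ j 0 : C(M, ℝ))) 0 :=
    fun i j ↦ (hφ i).continuousAt.mul continuousAt_const
  have hpair : ∀ i j, Tendsto (fun t ↦ ∫ p, φ i t p * φ j 0 p ∂V) (𝓝 0)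
      (𝓝 (if i = j then 1 else 0)) := fun i j ↦ by
    rw [← horth 0 hzero i j]
    exact tendsto_integral_of_continuousAt (g 0) (hcont i j)
  have hlamc : Tendsto lam (𝓝 0) (𝓝 (lam 0)) := hlam.continuousAt
  -- the weak equation at time `t`, with the measure at time `0`
  have hweak : ∀ t, |t| < ε → ∀ i j s, ∫ p, volumeRatio (g 0) (g t) p *
      gradInner (g t) (φ i t) (φ j s) p ∂V
      = lam t * ∫ p, volumeRatio (g 0) (g t) p * (φ i t p * φ j s p) ∂V := fun t ht i j s ↦ by
    rw [← integral_riemannianVolume_eq (g 0) (g t)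
      (continuous_gradInner _ hr1 hr1 (hs i t) (hs j s)),
      ← integral_riemannianVolume_eq (g 0) (g t) (hmul i t j s)]
    exact integral_gradInner_eigenfunction hk hr hr1 (g t) (hs i t) (hs j s) (heig t ht i)
      (hneu t ht i)
  have hweak0 : ∀ i j t, ∫ p, gradInner (g 0) (φ i t) (φ j 0) p ∂V
      = lam 0 * ∫ p, φ i t p * φ j 0 p ∂V := fun i j t ↦ by
    have := integral_gradInner_eigenfunction hk hr hr1 (g 0) (hs j 0) (hs i t) (heig 0 hzero j)
      (hneu 0 hzero j)
    rw [integral_congr_ae (Eventually.of_forall (gradInner_comm (g 0) (φ i t) (φ j 0))), this]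
    exact congrArg (lam 0 * ·) (integral_congr_ae (Eventually.of_forall fun p ↦ mul_comm _ _))
  -- energies of `φ i t` and their mixed version with `φ i 0`
  have henergy : Tendsto (fun t ↦ ∫ p, gradInner (g 0) (φ i t) (φ i t) p ∂V) (𝓝 0)
      (𝓝 (lam 0)) := by
    refine hg.tendsto_energy hr1 (hs i) (hlamc.congr' ?_)
    filter_upwards [hsmall] with t ht
    rw [hweak t ht i i t, ← integral_riemannianVolume_eq (g 0) (g t) (hmul i t i t), horth t ht,
      if_pos rfl, mul_one]
  have hcross : Tendsto (fun t ↦ ∫ p, gradInner (g 0) (φ i t) (φ i 0) p ∂V) (𝓝 0)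
      (𝓝 (lam 0)) := by
    simp_rw [hweak0]
    simpa using (hpair i i).const_mul (lam 0)
  -- strong convergence of the differentials at time `0`
  have hstrong := tendsto_energy_sub (g 0) hr1 (hs i) henergy hcross
    (by rw [hweak0, horth 0 hzero, if_pos rfl, mul_one])
  have hlhs := hg.tendsto_dirichlet_quotient hr1 hr1 (hs i) (hs j 0)
    (henergy.eventually_le_const (lt_add_one _)) hstrong
  have hvol := hg.tendsto_volume_quotient (hcont i j)
  have hslope : Tendsto (fun t ↦ (lam t - lam 0) / t) (𝓝[≠] 0) (𝓝 (deriv lam 0)) := by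
    have := hlam.hasDerivAt.tendsto_slope_zero
    simpa [div_eq_inv_mul] using this
  have hrhs := ((hlamc.mono_left (nhdsWithin_le_nhds (s := {0}ᶜ))).mul hvol).add
    (hslope.mul ((hpair i j).mono_left nhdsWithin_le_nhds))
  -- the difference of the weak equations, divided by `t`
  have hlim := tendsto_nhds_unique (hlhs.congr' ?_) hrhs
  rotate_left
  · filter_upwards [hsmall.filter_mono nhdsWithin_le_nhds, self_mem_nhdsWithin] with t ht ht0
    have ht0' : t ≠ 0 := ht0
    have hsplit : ∫ p, volumeRatio (g 0) (g t) p * (φ i t p * φ j 0 p) ∂V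
        = t * ∫ p, (volumeRatio (g 0) (g t) p - 1) / t * (φ i t p * φ j 0 p) ∂V
          + ∫ p, φ i t p * φ j 0 p ∂V := by
      have h1 : Continuous fun p ↦ (volumeRatio (g 0) (g t) p - 1) / t * (φ i t p * φ j 0 p) :=
        (((continuous_volumeRatio _ _).sub continuous_const).div_const t).mul (hmul i t j 0)
      rw [← integral_const_mul, ← integral_add ((integrable_of_continuous _ h1).const_mul t)
        (integrable_of_continuous _ (hmul i t j 0))]
      refine integral_congr_ae (Eventually.of_forall fun p ↦ ?_)
      simp only
      field_simp
      ring
    rw [hweak t ht i j 0, hweak0 i j t, hsplit]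
    change _ = lam t * ∫ p, (volumeRatio (g 0) (g t) p - 1) / t * (φ i t p * φ j 0 p) ∂V
      + (lam t - lam 0) / t * ∫ p, φ i t p * φ j 0 p ∂V
    field_simp
    ring
  have hvar : Continuous (dirichletVar (g 0) H (φ i 0) (φ j 0)) :=
    hg.continuous_dirichletVar hr1 hr1 (hs i 0) (hs j 0)
  have hht : Continuous fun p ↦ halfTrace (g 0) H p * (φ i 0 p * φ j 0 p) :=
    hg.continuous_halfTrace.mul (hmul i 0 j 0)
  -- the integrand, rewritten by the product rule and the eigenvalue equation
  have hintegrand : (fun p ↦ tensorInner (g 0) p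
      (((1 / 4 : ℝ) * laplacian (g 0) (fun q ↦ φ i 0 q * φ j 0 q) p) • (g 0).inner p
        - diffTensor (φ i 0) (φ j 0) p) (H p))
      = fun p ↦ dirichletVar (g 0) H (φ i 0) (φ j 0) p
        - lam 0 * (halfTrace (g 0) H p * (φ i 0 p * φ j 0 p)) := by
    ext p
    have hi := heig 0 hzero i p
    have hj := heig 0 hzero j p
    rw [tensorInner_smul_sub, laplacian_mul hr (g 0) (hs i 0) (hs j 0), dirichletVar, halfTrace,
      neg_eq_iff_eq_neg.1 hi, neg_eq_iff_eq_neg.1 hj]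
    ring
  have hint1 := integrable_of_continuous (g 0) hvar
  have hint2 := (integrable_of_continuous (g 0) hht).const_mul (lam 0)
  rw [hintegrand]
  refine ⟨hint1.sub hint2, ?_⟩
  rw [integral_sub hint1 hint2, integral_const_mul]
  change _ = lam 0 * ∫ p, halfTrace (g 0) H p * (φ i 0 p * φ j 0 p) ∂V + _ at hlim
  rw [hlim]
  ring
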